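/- **Definitions.** A *partial commutative monoid* is a set $S$ with a partial binary operation $+$ that is associative and commutative (in each law, one side is defined if and only if the other is, and then they are equal) and an element $0$ with $a+0=a$ for all $a$. Its *algebraic preordering* is: $a\le b$ iff $a+x=b$ for some $x$. Write $a\perp b$ if $x\le a,b$ implies $x=0$, and $X^\perp=\{s: s\perp x\ \forall x\in X\}$. A homomorphism preserves $0$ and all defined sums. A *projection* of $S$ is an endomorphism $p$ such that every $x\in S$ can be written $x=p(x)+y$ with $y\in(pS)^\perp$; $\mathbb B(S)$ is the set of projections, ordered by $p\le q$ iff $pq=p$; $p^\perp$ is the projection with $p^\perp S=(pS)^\perp$ and $(p^{\perp})^{-1}\{0\}=pS$. An element $a$ is *directly finite* if $x+a=a$ implies $x=0$, *purely infinite* if $a+a=a$, *multiple-free* if $x+x\le a$ implies $x=0$; $a$ is *removable* from $b$ if $a\le b$ and, for all $x$ such that $a+x$ is defined, $b\le a+x$ implies $b\le x$. $S$ is a *continuous dimension scale* if: (M1) $S$ has the refinement property (if $a_0+a_1=b_0+b_1$, there are $c_{ij}$ with $a_i=c_{i0}+c_{i1}$ and $b_j=c_{0j}+c_{1j}$) and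 $\le$ is antisymmetric; (M2) every nonempty subset of $S$ has an infimum; (M3) for all $x,y$ there is $p\in\mathbb B(S)$ with $p(x)\le p(y)$ and $p^\perp(y)\le p^\perp(x)$; (M4) for all $a,b$ there is a largest $p\in\mathbb B(S)$ with $p(a)\le p(b)$; (M5) every element is the sum of a directly finite and a purely infinite element; (M6) if $a,b$ are purely infinite and $a$ is removable from $b$, then the set of all purely infinite $x$ such that $a$ is removable from $x$ and $\{x\}^\perp=\{b\}^\perp$ has a least element. A *lower embedding* is an injective homomorphism $\varphi$ such that $\varphi(x)\le\varphi(y)$ implies $x\le y$ and whose range is a lower subset for the algebraic preordering. A *partial submonoid* of $S$ is a lower subset $T$ containing $0$, with $a+b=c$ in $T$ iff $a+b=c$ in $S$ and $c\in T$. For an ordinal $\gamma$, let $\mathbb Z_\gamma=\mathbb Z^+\cup A$, $\mathbb R_\gamma=\mathbb R^+\cup A$, $\mathbf 2_\gamma=\{0\}\cup A$, where $\mathbb Z^+$ and $\mathbb R^+$ contain $0$ and $A=\{\aleph_\xi:0\le\xi\le\gamma\}$, with the natural total ordering and its interval topology, and with the natural addition (finite elements are absorbed by the alephs, and $\aleph_\xi+\aleph_\eta=\aleph_{\max(\xi,\eta)}$).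 A *complete Boolean space* is an extremally disconnected compact Hausdorff space. If a topological space $\Omega$ is the disjoint union of clopen subsets $\Omega_{\mathrm I},\Omega_{\mathrm{II}},\Omega_{\mathrm{III}}$, then $\mathbf C(\Omega_{\mathrm I},\mathbb Z_\gamma;\Omega_{\mathrm{II}},\mathbb R_\gamma;\Omega_{\mathrm{III}},\mathbf 2_\gamma)$ is the commutative monoid, under pointwise addition, of all functions on $\Omega$ whose restrictions to $\Omega_{\mathrm I},\Omega_{\mathrm{II}},\Omega_{\mathrm{III}}$ are continuous maps into $\mathbb Z_\gamma,\mathbb R_\gamma,\mathbf 2_\gamma$, respectively. For $U\subseteq\Omega$, let $f\rfloor_U$ agree with $f$ on $U$ and vanish outside $U$. **Theorem.** (i) Let $S$ be a continuous dimension scale. Then $\mathbb B(S)$ is a complete Boolean algebra, and the space $\Omega$ of its ultrafilters, with the topology generated by the sets $\Omega_p=\{\mathfrak a\in\Omega: p\in\mathfrak a\}$ for $p\in\mathbb B(S)$, is a complete Boolean space. Let $S_{\mathrm{mf}}$ and $S_{\mathrm{fin}}$ be the sets of multiple-free and of directly finite elements of $S$. There are projections $p_{\mathrm I},p_{\mathrm{II}},p_{\mathrm{III}}$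 of $S$ with ranges $S_{\mathrm I}=S_{\mathrm{mf}}^{\perp\perp}$, $S_{\mathrm{II}}=S_{\mathrm{mf}}^{\perp}\cap S_{\mathrm{fin}}^{\perp\perp}$ and $S_{\mathrm{III}}=S_{\mathrm{fin}}^{\perp}$, and $\Omega$ is the disjoint union of the clopen sets $\Omega_{\mathrm I}=\Omega_{p_{\mathrm I}}$, $\Omega_{\mathrm{II}}=\Omega_{p_{\mathrm{II}}}$, $\Omega_{\mathrm{III}}=\Omega_{p_{\mathrm{III}}}$. Moreover, there are an ordinal $\gamma$ and a lower embedding $$\varepsilon\colon S\hookrightarrow\mathbf C(\Omega_{\mathrm I},\mathbb Z_\gamma;\Omega_{\mathrm{II}},\mathbb R_\gamma;\Omega_{\mathrm{III}},\mathbf 2_\gamma)$$ such that $\varepsilon(p(x))=\varepsilon(x)\rfloor_{\Omega_p}$ for all $x\in S$ and all $p\in\mathbb B(S)$, and such that $\varepsilon$ identifies $S$ with the partial submonoid $\varepsilon[S]$, that is, $\varepsilon(a)+\varepsilon(b)=\varepsilon(c)$ implies that $a+b$ is defined and equal to $c$. (ii) Conversely, for every ordinal $\gamma$ and every complete Boolean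 space $\Omega$ that is the disjoint union of clopen subsets $\Omega_{\mathrm I},\Omega_{\mathrm{II}},\Omega_{\mathrm{III}}$, every partial submonoid of $\mathbf C(\Omega_{\mathrm I},\mathbb Z_\gamma;\Omega_{\mathrm{II}},\mathbb R_\gamma;\Omega_{\mathrm{III}},\mathbf 2_\gamma)$ is a continuous dimension scale. -/

import Mathlib

universe u v w

/-! ### Partial commutative monoids -/

/-- A partial commutative monoid `(S, +, 0)`. The partial sum `padd a b : Part S` is defined when its
domain holds, and an equality of elements of `Part S` says that one side is defined if and only if
the other one is, and that they then have the same value. `c ∈ padd a b` means that `a + b` is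
defined and equal to `c`. -/
class PartialCommMonoid (S : Type u) extends Zero S where
  /-- The partial addition. -/
  padd : S → S → Part S
  padd_assoc : ∀ a b c : S, ((padd a b).bind fun s => padd s c) = (padd b c).bind fun s => padd a s
  padd_comm : ∀ a b : S, padd a b = padd b a
  padd_zero : ∀ a : S, padd a 0 = Part.some a

namespace PartialCommMonoid

infixl:65 " +ₚ " => PartialCommMonoid.padd

section Basic

variable {S : Type u} [PartialCommMonoid S]

/-- The algebraic preordering. -/
def AlgLE (a b : S) : Prop := ∃ x : S, b ∈ a +ₚ x

infix:50 " ≼ " => PartialCommMonoid.AlgLE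

theorem AlgLE.refl (a : S) : a ≼ a := ⟨0, by rw [padd_zero]; exact Part.mem_some a⟩

/-- The elements `a` and `b` are orthogonal. -/
def Orth (a b : S) : Prop := ∀ x : S, x ≼ a → x ≼ b → x = 0

/-- The set of all elements that are orthogonal to every element of `X`. -/
def perp (X : Set S) : Set S := {s | ∀ x ∈ X, Orth s x}

/-- `X` is a lower subset for the algebraic preordering. -/
def IsLowerSubset (X : Set S) : Prop := ∀ x y : S, x ≼ y → y ∈ X → x ∈ X

/-- The refinement property. -/
def HasRefinement (S : Type u) [PartialCommMonoid S] : Prop :=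
  ∀ a₀ a₁ b₀ b₁ s : S, s ∈ a₀ +ₚ a₁ → s ∈ b₀ +ₚ b₁ →
    ∃ c₀₀ c₀₁ c₁₀ c₁₁ : S, a₀ ∈ c₀₀ +ₚ c₀₁ ∧ a₁ ∈ c₁₀ +ₚ c₁₁ ∧ b₀ ∈ c₀₀ +ₚ c₁₀ ∧ b₁ ∈ c₀₁ +ₚ c₁₁

/-- `a` is directly finite. -/
def DirectlyFinite (a : S) : Prop := ∀ x : S, a ∈ x +ₚ a → x = 0

/-- `a` is purely infinite: `2a` is defined and equal to `a`. -/
def PurelyInfinite (a : S) : Prop := a ∈ a +ₚ a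

/-- `a` is multiple-free: `2x ≤ a` implies `x = 0`. -/
def MultipleFree (a : S) : Prop := ∀ x s : S, s ∈ x +ₚ x → s ≼ a → x = 0

/-- `a` is removable from `b`. -/
def Removable (a b : S) : Prop := a ≼ b ∧ ∀ x s : S, s ∈ a +ₚ x → b ≼ s → b ≼ x

end Basic

/-! ### Homomorphisms, lower embeddings, partial submonoids -/

/-- Homomorphisms of partial commutative monoids. -/
structure IsHom {A : Type u} {B : Type v} [PartialCommMonoid A] [PartialCommMonoid B]
    (φ : A → B) : Prop where
  map_zero : φ 0 = 0
  map_padd : ∀ a b c : A, c ∈ a +ₚ b → φ c ∈ φ a +ₚ φ b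

/-- Lower embeddings. -/
structure IsLowerEmbedding {A : Type u} {B : Type v} [PartialCommMonoid A] [PartialCommMonoid B]
    (φ : A → B) : Prop where
  isHom : IsHom φ
  injective : Function.Injective φ
  le_of_map_le : ∀ x y : A, φ x ≼ φ y → x ≼ y
  range_lower : IsLowerSubset (Set.range φ)

/-- A (total) commutative monoid, seen as a partial commutative monoid. -/
instance ofAddCommMonoid (M : Type u) [AddCommMonoid M] : PartialCommMonoid M where
  padd a b := Part.some (a + b)
  padd_assoc a b c := by simp [add_assoc]
  padd_comm a b := by simp [add_comm]
  padd_zero a := by simp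

/-- The underlying set of a partial submonoid: a lower subset that contains `0`. -/
structure LowerSubmonoid (S : Type u) [PartialCommMonoid S] where
  /-- The underlying set. -/
  carrier : Set S
  zero_mem : (0 : S) ∈ carrier
  lower : IsLowerSubset carrier

/-- A partial submonoid `T` with its partial addition: `a + b = c` in `T` if and only if `a + b = c`
in `S` and `c ∈ T`. -/
instance {S : Type u} [PartialCommMonoid S] (T : LowerSubmonoid S) :
    PartialCommMonoid T.carrier where
  zero := ⟨0, T.zero_mem⟩
  padd a b := ⟨∃ h : (a.1 +ₚ b.1).Dom, (a.1 +ₚ b.1).get h ∈ T.carrier,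
    fun h => ⟨(a.1 +ₚ b.1).get h.1, h.2⟩⟩
  padd_comm a b := by
    obtain ⟨a, ha⟩ := a
    obtain ⟨b, hb⟩ := b
    ext d
    constructor
    · rintro ⟨⟨h, h'⟩, rfl⟩
      have he : a +ₚ b = b +ₚ a := padd_comm a b
      simp only [he] at h h' ⊢
      exact ⟨⟨h, h'⟩, rfl⟩
    · rintro ⟨⟨h, h'⟩, rfl⟩
      have he : b +ₚ a = a +ₚ b := padd_comm b a
      simp only [he] at h h' ⊢
      exact ⟨⟨h, h'⟩, rfl⟩
  padd_zero a := by
    have h := padd_zero a.1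
    have hm : a.1 ∈ a.1 +ₚ 0 := by rw [h]; exact Part.mem_some _
    obtain ⟨hd, he⟩ := hm
    refine Part.eq_some_iff.2 ⟨⟨hd, ?_⟩, Subtype.ext he⟩
    change (a.1 +ₚ 0).get hd ∈ T.carrier
    rw [he]; exact a.2
  padd_assoc a b c := by
    have key : ∀ x y z : S, ∀ d : S,
        (∃ s, s ∈ x +ₚ y ∧ d ∈ s +ₚ z) ↔ ∃ s, s ∈ y +ₚ z ∧ d ∈ x +ₚ s := by
      intro x y z d
      have h := congrArg (fun p => d ∈ p) (padd_assoc x y z)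
      simpa only [Part.mem_bind_iff, eq_iff_iff] using h
    ext d
    simp only [Part.mem_bind_iff]
    constructor
    · rintro ⟨s, ⟨⟨h1, h1'⟩, rfl⟩, ⟨⟨h2, h2'⟩, rfl⟩⟩
      obtain ⟨t, ht, hd⟩ := (key a.1 b.1 c.1 _).1 ⟨_, ⟨h1, rfl⟩, ⟨h2, rfl⟩⟩
      obtain ⟨ht1, rfl⟩ := ht
      have htT : (b.1 +ₚ c.1).get ht1 ∈ T.carrier :=
        T.lower _ _ ⟨a.1, by rw [padd_comm]; exact hd⟩ h2'
      obtain ⟨hd1, hd2⟩ := hd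
      exact ⟨⟨_, htT⟩, ⟨⟨ht1, htT⟩, rfl⟩, ⟨⟨hd1, hd2.symm ▸ h2'⟩, Subtype.ext hd2⟩⟩
    · rintro ⟨s, ⟨⟨h1, h1'⟩, rfl⟩, ⟨⟨h2, h2'⟩, rfl⟩⟩
      obtain ⟨t, ht, hd⟩ := (key a.1 b.1 c.1 _).2 ⟨_, ⟨h1, rfl⟩, ⟨h2, rfl⟩⟩
      obtain ⟨ht1, rfl⟩ := ht
      have htT : (a.1 +ₚ b.1).get ht1 ∈ T.carrier := T.lower _ _ ⟨c.1, hd⟩ h2'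
      obtain ⟨hd1, hd2⟩ := hd
      exact ⟨⟨_, htT⟩, ⟨⟨ht1, htT⟩, rfl⟩, ⟨⟨hd1, hd2.symm ▸ h2'⟩, Subtype.ext hd2⟩⟩

/-! ### Projections -/

/-- A projection of `S`: an endomorphism `p` of `(S, +, 0)` such that `x ∈ p(x) + (pS)^⊥` for
all `x`. -/
structure Projection (S : Type u) [PartialCommMonoid S] where
  /-- The underlying map. -/
  toFun : S → S
  isHom : IsHom toFun
  decomp : ∀ x : S, ∃ y ∈ perp (Set.range toFun), x ∈ toFun x +ₚ y

section Projections

variable {S : Type u} [PartialCommMonoid S]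

instance : CoeFun (Projection S) fun _ => S → S := ⟨Projection.toFun⟩

theorem Projection.idem (p : Projection S) (x : S) : p (p x) = p x := by
  obtain ⟨z, hz, h⟩ := p.decomp (p x)
  have hz0 : z = 0 := hz (p x) ⟨x, rfl⟩ z (AlgLE.refl z) ⟨p (p x), by rw [padd_comm]; exact h⟩
  subst hz0
  rw [padd_zero] at h
  exact (Part.mem_some_iff.1 h).symm

/-- The ordering of the projections: `p ≤ q` if and only if `p ∧ q = p`, where `p ∧ q` is the
composition `pq`. -/
instance : Preorder (Projection S) where
  le p q := ∀ x, p (q x) = p x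
  le_refl p := p.idem
  le_trans p q r hpq hqr x := by
    rw [← hpq (r x), hqr x, hpq x]

/-- `q` is the projection `p^⊥`, characterized by `qS = (pS)^⊥` and `q⁻¹{0} = pS`. -/
def Projection.IsPerp (p q : Projection S) : Prop :=
  Set.range q = perp (Set.range p) ∧ q.toFun ⁻¹' {0} = Set.range p

end Projections

/-- General comparability. -/
def GeneralComparability (S : Type u) [PartialCommMonoid S] : Prop :=
  ∀ x y : S, ∃ p q : Projection S, p.IsPerp q ∧ p x ≼ p y ∧ q y ≼ q x

/-- `S` is Boolean-valued: for all `a` and `b`, there is a largest projection `p` of `S` such that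
`p(a) ≤ p(b)`. -/
def BooleanValued (S : Type u) [PartialCommMonoid S] : Prop :=
  ∀ a b : S, ∃ p : Projection S, IsGreatest {q : Projection S | q a ≼ q b} p

/-! ### Continuous dimension scales -/

/-- Continuous dimension scales. -/
structure IsContinuousDimensionScale (S : Type u) [PartialCommMonoid S] : Prop where
  refinement : HasRefinement S
  antisymm : ∀ a b : S, a ≼ b → b ≼ a → a = b
  exists_inf : ∀ X : Set S, X.Nonempty →
    ∃ m : S, (∀ x ∈ X, m ≼ x) ∧ ∀ t : S, (∀ x ∈ X, t ≼ x) → t ≼ m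
  generalComparability : GeneralComparability S
  booleanValued : BooleanValued S
  decomp : ∀ a : S, ∃ x y : S, DirectlyFinite x ∧ PurelyInfinite y ∧ a ∈ x +ₚ y
  exists_least : ∀ a b : S, PurelyInfinite a → PurelyInfinite b → Removable a b →
    ∃ m ∈ {x : S | PurelyInfinite x ∧ Removable a x ∧ perp {x} = perp {b}},
      ∀ x ∈ {x : S | PurelyInfinite x ∧ Removable a x ∧ perp {x} = perp {b}}, m ≼ x

section Types

variable (S : Type u) [PartialCommMonoid S]

/-- The ideal `S_I`. -/
def typeI : Set S := perp (perp {a | MultipleFree a})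

/-- The ideal `S_II`. -/
def typeII : Set S := perp {a | MultipleFree a} ∩ perp (perp {a | DirectlyFinite a})

/-- The ideal `S_III`. -/
def typeIII : Set S := perp {a | DirectlyFinite a}

end Types

end PartialCommMonoid

/-- The ordering of `P` makes `P` a complete Boolean algebra. -/
def IsCompleteBooleanAlgebra (P : Type u) [r : Preorder P] : Prop :=
  ∃ B : CompleteBooleanAlgebra P, ∀ p q : P, B.le p q ↔ r.le p q

/-! ### The space of ultrafilters of a partially (pre)ordered set -/

/-- The ultrafilters of `P`: the maximal elements among the proper filters of `P`. -/
def UltrafilterSpace (P : Type u) [Preorder P] : Type u :=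
  {F : Order.PFilter P // Maximal (fun G : Order.PFilter P => (G : Set P) ≠ Set.univ) F}

namespace UltrafilterSpace

variable {P : Type u} [Preorder P]

/-- The set `Ω_p` of all ultrafilters that contain `p`. -/
def basicSet (p : P) : Set (UltrafilterSpace P) := {F | p ∈ F.1}

/-- The Stone topology, generated by the sets `Ω_p`. -/
instance : TopologicalSpace (UltrafilterSpace P) :=
  TopologicalSpace.generateFrom (Set.range basicSet)

end UltrafilterSpace

/-! ### The monoids `ℤ_γ`, `ℝ_γ` and `2_γ` -/

/-- The disjoint union of a set `F` of finite elements and of `{ℵ_ξ | 0 ≤ ξ ≤ γ}`; the element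
`aleph ξ` stands for the cardinal `ℵ_ξ`. -/
inductive AlephExt (F : Type) (γ : Ordinal.{w}) : Type (w + 1)
  | fin (x : F) : AlephExt F γ
  | aleph (ξ : Set.Iic γ) : AlephExt F γ

namespace AlephExt

section Order

variable {F : Type} {γ : Ordinal.{w}}

/-- The identification with a lexicographic sum. -/
def toLexSum : AlephExt F γ → Lex (F ⊕ Set.Iic γ)
  | fin x => toLex (Sum.inl x)
  | aleph ξ => toLex (Sum.inr ξ)

theorem toLexSum_injective : Function.Injective (toLexSum : AlephExt F γ → _) := by
  rintro (x | x) (y | y) h <;> simp_all [toLexSum]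

/-- The natural total ordering: finite elements lie below the alephs. -/
noncomputable instance [LinearOrder F] : LinearOrder (AlephExt F γ) :=
  LinearOrder.lift' toLexSum toLexSum_injective

/-- The interval topology. -/
noncomputable instance [LinearOrder F] : TopologicalSpace (AlephExt F γ) := Preorder.topology _

instance [LinearOrder F] : OrderTopology (AlephExt F γ) := ⟨rfl⟩

variable [LinearOrder F]

theorem fin_le_fin {x y : F} : (fin x : AlephExt F γ) ≤ fin y ↔ x ≤ y := Sum.Lex.inl_le_inl_iff

theorem fin_lt_fin {x y : F} : (fin x : AlephExt F γ) < fin y ↔ x < y := Sum.Lex.inl_lt_inl_iff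

theorem aleph_le_aleph {x y : Set.Iic γ} : (aleph x : AlephExt F γ) ≤ aleph y ↔ x ≤ y :=
  Sum.Lex.inr_le_inr_iff

theorem aleph_lt_aleph {x y : Set.Iic γ} : (aleph x : AlephExt F γ) < aleph y ↔ x < y :=
  Sum.Lex.inr_lt_inr_iff

theorem fin_lt_aleph (x : F) (y : Set.Iic γ) : (fin x : AlephExt F γ) < aleph y :=
  Sum.Lex.inl_lt_inr _ _

theorem not_aleph_lt_fin (x : F) (y : Set.Iic γ) : ¬ (aleph y : AlephExt F γ) < fin x :=
  (fin_lt_aleph x y).le.not_gt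

theorem isOpenEmbedding_fin [TopologicalSpace F] [OrderTopology F] :
    Topology.IsOpenEmbedding (fin : F → AlephExt F γ) := by
  have hr : Set.range (fin : F → AlephExt F γ) = Set.Iio (aleph ⟨0, Set.mem_Iic.2 zero_le⟩) := by
    ext a
    constructor
    · rintro ⟨x, rfl⟩
      exact fin_lt_aleph _ _
    · intro h
      rcases a with x | x
      · exact ⟨x, rfl⟩
      · exact absurd (aleph_lt_aleph.1 h) (not_lt.2 (zero_le (a := x.1)))
  have hm : StrictMono (fin : F → AlephExt F γ) := fun _ _ h => fin_lt_fin.2 h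
  exact ⟨hm.isEmbedding_of_ordConnected (hr ▸ Set.ordConnected_Iio), hr ▸ isOpen_Iio⟩

end Order

section Add

variable {F : Type} {γ : Ordinal.{w}} [AddCommMonoid F]

instance : Zero (AlephExt F γ) := ⟨fin 0⟩

/-- The addition extends that of `F`, finite elements are absorbed by the alephs, and
`ℵ_ξ + ℵ_η = ℵ_{max ξ η}`. -/
noncomputable instance : Add (AlephExt F γ) where
  add a b := match a, b with
    | fin x, fin y => fin (x + y)
    | fin _, aleph η => aleph η
    | aleph ξ, fin _ => aleph ξ
    | aleph ξ, aleph η => aleph (max ξ η)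

noncomputable instance : AddCommMonoid (AlephExt F γ) where
  add_assoc := by
    rintro (x | x) (y | y) (z | z)
    · exact congrArg fin (add_assoc x y z)
    all_goals first | rfl | exact congrArg aleph (max_assoc x y z)
  zero_add := by
    rintro (x | x)
    · exact congrArg fin (zero_add x)
    · rfl
  add_zero := by
    rintro (x | x)
    · exact congrArg fin (add_zero x)
    · rfl
  add_comm := by
    rintro (x | x) (y | y)
    · exact congrArg fin (add_comm x y)
    · rfl
    · rfl
    · exact congrArg aleph (max_comm x y)
  nsmul := nsmulRec

theorem fin_add_fin (x y : F) : (fin x + fin y : AlephExt F γ) = fin (x + y) := rfl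

theorem fin_add_aleph (x : F) (y : Set.Iic γ) : (fin x + aleph y : AlephExt F γ) = aleph y := rfl

theorem aleph_add_fin (x : Set.Iic γ) (y : F) : (aleph x + fin y : AlephExt F γ) = aleph x := rfl

theorem aleph_add_aleph (x y : Set.Iic γ) :
    (aleph x + aleph y : AlephExt F γ) = aleph (max x y) := rfl

variable [LinearOrder F]

theorem add_lt_aleph {a b : AlephExt F γ} {ξ : Set.Iic γ} (ha : a < aleph ξ) (hb : b < aleph ξ) :
    a + b < aleph ξ := by
  rcases a with x | x <;> rcases b with y | y
  · exact fin_lt_aleph _ _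
  · exact hb
  · exact ha
  · exact aleph_lt_aleph.2 (max_lt (aleph_lt_aleph.1 ha) (aleph_lt_aleph.1 hb))

theorem left_le_add [CanonicallyOrderedAdd F] (a b : AlephExt F γ) : a ≤ a + b := by
  rcases a with x | x <;> rcases b with y | y
  · exact fin_le_fin.2 le_self_add
  · exact (fin_lt_aleph _ _).le
  · exact le_rfl
  · exact aleph_le_aleph.2 (le_max_left _ _)

theorem tendsto_add_of_aleph [CanonicallyOrderedAdd F] (ξ : Set.Iic γ) (b : AlephExt F γ) :
    Filter.Tendsto (fun z : AlephExt F γ × AlephExt F γ => z.1 + z.2) (nhds (aleph ξ, b))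
      (nhds (aleph ξ + b)) := by
  have hmax : aleph ξ + b = max (aleph ξ) b := by
    rcases b with y | y
    · exact (max_eq_left (fin_lt_aleph _ _).le).symm
    · rw [aleph_add_aleph]
      rcases le_total ξ y with h | h
      · rw [max_eq_right h, max_eq_right (aleph_le_aleph.2 h)]
      · rw [max_eq_left h, max_eq_left (aleph_le_aleph.2 h)]
  rw [hmax]
  refine tendsto_order.2 ⟨fun c hc => ?_, fun c hc => ?_⟩
  · rcases lt_max_iff.1 hc with h | h
    · filter_upwards [continuous_fst.continuousAt.eventually (lt_mem_nhds h)] with z hz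
      exact hz.trans_le (left_le_add _ _)
    · filter_upwards [continuous_snd.continuousAt.eventually (lt_mem_nhds h)] with z hz
      rw [add_comm]
      exact hz.trans_le (left_le_add _ _)
  · obtain ⟨h1, h2⟩ := max_lt_iff.1 hc
    rcases c with c | c
    · exact absurd h1 (not_aleph_lt_fin _ _)
    · filter_upwards [continuous_fst.continuousAt.eventually (gt_mem_nhds h1),
        continuous_snd.continuousAt.eventually (gt_mem_nhds h2)] with z hz1 hz2
      exact add_lt_aleph hz1 hz2

instance [CanonicallyOrderedAdd F] [TopologicalSpace F] [OrderTopology F] [ContinuousAdd F] :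
    ContinuousAdd (AlephExt F γ) where
  continuous_add := by
    refine continuous_iff_continuousAt.2 ?_
    rintro ⟨x | x, b⟩
    · rcases b with y | y
      · have ho := (isOpenEmbedding_fin (F := F) (γ := γ)).prodMap
          (isOpenEmbedding_fin (F := F) (γ := γ))
        have h : ContinuousAt ((fun z : AlephExt F γ × AlephExt F γ => z.1 + z.2) ∘
            Prod.map (fin : F → AlephExt F γ) (fin : F → AlephExt F γ)) (x, y) := by
          have h0 : Continuous fun z : F × F => (fin (z.1 + z.2) : AlephExt F γ) :=
            isOpenEmbedding_fin.continuous.comp continuous_add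
          exact h0.continuousAt
        exact ho.continuousAt_iff.1 h
      · have h := (tendsto_add_of_aleph (F := F) y (fin x)).comp
          (continuous_swap.tendsto ((fin x : AlephExt F γ), aleph y))
        have e : (fun z : AlephExt F γ × AlephExt F γ => z.1 + z.2) =
            (fun z : AlephExt F γ × AlephExt F γ => z.1 + z.2) ∘ Prod.swap :=
          funext fun z => add_comm z.1 z.2
        rw [ContinuousAt, e]
        exact h
    · exact tendsto_add_of_aleph x b

end Add

end AlephExt

instance : OrderTopology PUnit := ⟨Subsingleton.elim _ _⟩

/-- `ℤ_γ = ℤ⁺ ∪ {ℵ_ξ | 0 ≤ ξ ≤ γ}`. -/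
abbrev ZScale (γ : Ordinal.{w}) : Type (w + 1) := AlephExt ℕ γ

/-- `ℝ_γ = ℝ⁺ ∪ {ℵ_ξ | 0 ≤ ξ ≤ γ}`. -/
abbrev RScale (γ : Ordinal.{w}) : Type (w + 1) := AlephExt NNReal γ

/-- `2_γ = {0} ∪ {ℵ_ξ | 0 ≤ ξ ≤ γ}`. -/
abbrev TwoScale (γ : Ordinal.{w}) : Type (w + 1) := AlephExt PUnit γ

/-! ### The function monoids -/

/-- The monoid `C(Ω_I, ℤ_γ; Ω_II, ℝ_γ; Ω_III, 2_γ)` of all functions on `Ω` whose restrictions to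
`Ω_I`, `Ω_II`, `Ω_III` are continuous with values in `ℤ_γ`, `ℝ_γ`, `2_γ`, respectively. Such a
function is given by the triple of its restrictions, and the addition is pointwise. -/
abbrev FunctionScale {Ω : Type v} [TopologicalSpace Ω] (ΩI ΩII ΩIII : Set Ω) (γ : Ordinal.{w}) :
    Type (max v (w + 1)) :=
  C(ΩI, ZScale γ) × C(ΩII, RScale γ) × C(ΩIII, TwoScale γ)

/-- `g` is the function that agrees with `f` on `U` and vanishes outside `U`. -/
def FunctionScale.IsCutoff {Ω : Type v} [TopologicalSpace Ω] {ΩI ΩII ΩIII : Set Ω}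
    {γ : Ordinal.{w}} (U : Set Ω) (f g : FunctionScale ΩI ΩII ΩIII γ) : Prop :=
  (∀ x : ΩI, (x.1 ∈ U → g.1 x = f.1 x) ∧ (x.1 ∉ U → g.1 x = 0)) ∧
  (∀ x : ΩII, (x.1 ∈ U → g.2.1 x = f.2.1 x) ∧ (x.1 ∉ U → g.2.1 x = 0)) ∧
  (∀ x : ΩIII, (x.1 ∈ U → g.2.2 x = f.2.2 x) ∧ (x.1 ∉ U → g.2.2 x = 0))

/-- `Ω` is a complete Boolean space: an extremally disconnected compact Hausdorff space. -/
def IsCompleteBooleanSpace (Ω : Type v) [TopologicalSpace Ω] : Prop :=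
  CompactSpace Ω ∧ T2Space Ω ∧ ExtremallyDisconnected Ω

/-- `Ω` is the disjoint union of the clopen subsets `ΩI`, `ΩII`, `ΩIII`. -/
structure IsClopenDecomposition {Ω : Type v} [TopologicalSpace Ω] (ΩI ΩII ΩIII : Set Ω) :
    Prop where
  clopenI : IsClopen ΩI
  clopenII : IsClopen ΩII
  clopenIII : IsClopen ΩIII
  disjoint_I_II : Disjoint ΩI ΩII
  disjoint_I_III : Disjoint ΩI ΩIII
  disjoint_II_III : Disjoint ΩII ΩIII
  cover : ΩI ∪ ΩII ∪ ΩIII = Set.univ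

open PartialCommMonoid UltrafilterSpace

/-! Embedding. Elements are measured against units, and the value of `x` at an ultrafilter `ω` is
the supremum of the unit values `c` such that `x` dominates units of value `c` throughout a part
belonging to `ω`. An absorbing top element is added to `S` first, so that sums are total and the
order is a complete lattice on which projections act. Comparability (M3) and Boolean values (M4)
make every polar the range of a projection (`exists_polar`). Hence the projections form a complete
Boolean algebra, and a failure of `x ≤ y` can always be concentrated on a nonzero part where `x ≤ y`
holds nowhere (`exists_nowhereLE`).

By (M5), a projection cuts each element into a directly finite and a purely infinite part
(`exists_dfin_pinf`). Directly finite elements cancel and are Archimedean (`DFin.add_right_cancel`,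
`DFin.eq_zero_of_forall_nsmul_le`), so they can be measured by division with remainder. In type I
the unit on a given support is the multiple-free element, which is unique, and the multiplicities
are integers. In type II a maximal compatible family of directly finite elements serves as unit; it
can be halved forever, because what remains after a maximal halving is multiple-free and hence zero,
and the values are dyadic. In type III the only directly finite element is zero.

Purely infinite elements are measured by alephs, defined by transfinite recursion: `ℵ_ξ` on `q` is
the least purely infinite element with support `q` from which all earlier alephs are removable on
every part. Axiom (M6) supplies these minima (`exists_isAleph`), alephs restrict to smaller parts
(`IsAleph.psmul`), the size of `S` bounds their indices and so yields `γ` (`bddAbove_isAleph`), and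
every nonzero purely infinite element is an aleph on some nonzero part (`exists_isAleph_psmul`).

The fields of `UnitSystem` collect what makes values continuous, additive, order-reflecting and able
to realize every continuous function below a value (`continuous_val`, `val_add`,
`psmul_base_le_of_val_le`, `exists_val_eq`). Sums are reflected as well (`eq_add_of_val_eq`):
directly finite elements have finite values on a dense set, where one can cancel, and purely
infinite ones absorb.

Converse. On an extremally disconnected space every function into a complete chain has a continuous
envelope, so solutions of a closed relation that exist on densely many open sets can be glued
(`exists_global`). Differences and refinements are thereby reduced to local cases, infima are
envelopes of pointwise infima, and cutoffs by clopen sets provide the projections. For (M6), the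
idempotent values are well ordered: where `a` is constant, whatever `a` is removable from must reach
the next idempotent value. These properties pass to products and to lower subsets. -/

set_option linter.unusedSectionVars false

/-! ### Totalization of a partial monoid by an absorbing top element. -/

namespace PartialCommMonoid

/-- The total commutative monoid obtained from a partial commutative monoid by adding an absorbing
element, which is the value of all undefined sums. -/
inductive Tot (S : Type u) : Type u
  | of (x : S) : Tot S
  | top : Tot S

namespace Tot

section Monoid

variable {S : Type u} [PartialCommMonoid S]

instance : Zero (Tot S) := ⟨of 0⟩

theorem of_injective : Function.Injective (of : S → Tot S) := fun _ _ h => by cases h; rfl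

open Classical in
/-- The addition of `Tot S`. -/
noncomputable def addAux : Tot S → Tot S → Tot S
  | of a, of b => if h : (a +ₚ b).Dom then of ((a +ₚ b).get h) else top
  | _, _ => top

noncomputable instance : Add (Tot S) := ⟨addAux⟩

open Classical in
theorem of_add_of_eq_of {a b c : S} : (of a + of b : Tot S) = of c ↔ c ∈ a +ₚ b := by
  change (if h : (a +ₚ b).Dom then of ((a +ₚ b).get h) else top) = of c ↔ _
  constructor
  · intro h
    split_ifs at h with hd
    exact ⟨hd, of_injective h⟩
  · rintro ⟨hd, rfl⟩
    rw [dif_pos hd]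

theorem add_eq_of {x y : Tot S} {c : S} :
    x + y = of c ↔ ∃ a b, x = of a ∧ y = of b ∧ c ∈ a +ₚ b := by
  constructor
  · intro h
    rcases x with a | _
    · rcases y with b | _
      · exact ⟨a, b, rfl, rfl, of_add_of_eq_of.1 h⟩
      · cases h
    · rcases y with b | _ <;> cases h
  · rintro ⟨a, b, rfl, rfl, h⟩
    exact of_add_of_eq_of.2 h

theorem ext_of {x y : Tot S} (h : ∀ c, x = of c ↔ y = of c) : x = y := by
  rcases x with a | _
  · exact ((h a).1 rfl).symm
  · rcases y with b | _
    · exact (h b).2 rfl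
    · rfl

theorem mem_bind_iff (a b c d : S) :
    (∃ s, s ∈ a +ₚ b ∧ d ∈ s +ₚ c) ↔ ∃ s, s ∈ b +ₚ c ∧ d ∈ a +ₚ s := by
  have h := congrArg (fun p => d ∈ p) (padd_assoc a b c)
  simpa only [Part.mem_bind_iff, eq_iff_iff] using h

noncomputable instance : AddCommMonoid (Tot S) where
  add_assoc x y z := by
    refine ext_of fun d => ?_
    constructor
    · intro h
      obtain ⟨s, c, hs, rfl, hd⟩ := add_eq_of.1 h
      obtain ⟨a, b, rfl, rfl, hs'⟩ := add_eq_of.1 hs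
      obtain ⟨t, ht, hd⟩ := (mem_bind_iff a b c d).1 ⟨s, hs', hd⟩
      exact add_eq_of.2 ⟨a, t, rfl, of_add_of_eq_of.2 ht, hd⟩
    · intro h
      obtain ⟨a, s, rfl, hs, hd⟩ := add_eq_of.1 h
      obtain ⟨b, c, rfl, rfl, hs'⟩ := add_eq_of.1 hs
      obtain ⟨t, ht, hd⟩ := (mem_bind_iff a b c d).2 ⟨s, hs', hd⟩
      exact add_eq_of.2 ⟨t, c, of_add_of_eq_of.2 ht, rfl, hd⟩
  zero_add x := by
    rcases x with a | _
    · refine of_add_of_eq_of.2 ?_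
      rw [padd_comm, padd_zero]; exact Part.mem_some _
    · rfl
  add_zero x := by
    rcases x with a | _
    · refine of_add_of_eq_of.2 ?_
      rw [padd_zero]; exact Part.mem_some _
    · rfl
  add_comm x y := by
    rcases x with a | _ <;> rcases y with b | _
    · refine ext_of fun d => ?_
      rw [of_add_of_eq_of, of_add_of_eq_of, padd_comm]
    · rfl
    · rfl
    · rfl
  nsmul := nsmulRec

theorem add_top' (x : Tot S) : x + top = top := by rcases x with a | _ <;> rfl

theorem algLE_iff {a b : S} : a ≼ b ↔ ∃ z : Tot S, of b = of a + z := by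
  constructor
  · rintro ⟨x, hx⟩
    exact ⟨of x, (of_add_of_eq_of.2 hx).symm⟩
  · rintro ⟨z, hz⟩
    obtain ⟨a', x, h1, -, hx⟩ := add_eq_of.1 hz.symm
    rw [of_injective h1]
    exact ⟨x, hx⟩

end Monoid

section Order

variable {S : Type u} [PartialCommMonoid S] [hS : Fact (IsContinuousDimensionScale S)]

/-- The algebraic ordering of `Tot S`. -/
instance : PartialOrder (Tot S) where
  le x y := ∃ z, y = x + z
  le_refl x := ⟨0, (add_zero x).symm⟩
  le_trans := by
    rintro x y z ⟨s, rfl⟩ ⟨t, rfl⟩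
    exact ⟨s + t, add_assoc _ _ _⟩
  le_antisymm := by
    rintro x y ⟨s, hs⟩ ⟨t, ht⟩
    rcases x with a | _
    · rcases y with b | _
      · rw [hS.out.antisymm a b (algLE_iff.2 ⟨s, hs⟩) (algLE_iff.2 ⟨t, ht⟩)]
      · obtain ⟨a', x, h1, -, hx⟩ := add_eq_of.1 ht.symm
        cases h1
    · rcases y with b | _
      · obtain ⟨a', x, h1, -, hx⟩ := add_eq_of.1 hs.symm
        cases h1
      · rfl

theorem of_le_of {a b : S} : (of a : Tot S) ≤ of b ↔ a ≼ b := algLE_iff.symm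

theorem le_top' (x : Tot S) : x ≤ top := ⟨top, (add_top' x).symm⟩

theorem zero_le' (x : Tot S) : 0 ≤ x := ⟨x, (zero_add x).symm⟩

/-- Axiom (M2) handles every set that contains an element of `S`, the top being irrelevant to lower
bounds; any other set has infimum top. -/
theorem exists_isGLB (X : Set (Tot S)) : ∃ m, IsGLB X m := by
  by_cases h : ∃ a, of a ∈ X
  · obtain ⟨a, ha⟩ := h
    obtain ⟨m, hm, hm'⟩ := hS.out.exists_inf (of ⁻¹' X) ⟨a, ha⟩
    refine ⟨of m, ?_, ?_⟩
    · rintro (b | _) hb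
      · exact of_le_of.2 (hm b hb)
      · exact le_top' _
    · rintro (t | _) ht
      · exact of_le_of.2 (hm' t fun x hx => of_le_of.1 (ht hx))
      · obtain ⟨z, hz⟩ := ht ha
        rw [add_comm, add_top'] at hz
        cases hz
  · refine ⟨top, ?_, fun _ _ => le_top' _⟩
    rintro (b | _) hb
    · exact absurd ⟨b, hb⟩ h
    · exact le_rfl

noncomputable instance : InfSet (Tot S) := ⟨fun X => (exists_isGLB X).choose⟩

noncomputable instance : CompleteLattice (Tot S) :=
  { completeLatticeOfInf (Tot S) fun X => (exists_isGLB X).choose_spec with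
    top := top
    le_top := le_top'
    bot := 0
    bot_le := zero_le' }

instance : CanonicallyOrderedAdd (Tot S) where
  exists_add_of_le {_ _} h := h
  le_self_add _ b := ⟨b, rfl⟩
  le_add_self _ b := ⟨b, add_comm _ _⟩

instance : IsOrderedAddMonoid (Tot S) where
  add_le_add_left := by
    rintro a b ⟨z, rfl⟩ c
    exact ⟨z, add_right_comm _ _ _⟩

@[simp] theorem of_ne_top (a : S) : (of a : Tot S) ≠ ⊤ := fun h => by cases h

theorem zero_ne_top : (0 : Tot S) ≠ ⊤ := of_ne_top 0

theorem add_top (x : Tot S) : x + ⊤ = ⊤ := add_top' x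

theorem exists_of {x : Tot S} (h : x ≠ ⊤) : ∃ a, x = of a := by
  rcases x with a | _
  · exact ⟨a, rfl⟩
  · exact absurd rfl h

theorem ne_top_of_le {x y : Tot S} (h : x ≤ y) (hy : y ≠ ⊤) : x ≠ ⊤ := _root_.ne_top_of_le_ne_top hy h

theorem left_ne_top {x y : Tot S} (h : x + y ≠ ⊤) : x ≠ ⊤ := ne_top_of_le le_self_add h

theorem right_ne_top {x y : Tot S} (h : x + y ≠ ⊤) : y ≠ ⊤ := ne_top_of_le le_add_self h

/-- The sum must differ from the top: an equality between two undefined sums carries no information.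
-/
theorem refinement {a b c d : Tot S} (h : a + b = c + d) (ht : a + b ≠ ⊤) :
    ∃ x y z w : Tot S, a = x + y ∧ b = z + w ∧ c = x + z ∧ d = y + w := by
  obtain ⟨s, hs⟩ := exists_of ht
  obtain ⟨a', b', rfl, rfl, hab⟩ := add_eq_of.1 hs
  obtain ⟨c', d', rfl, rfl, hcd⟩ := add_eq_of.1 (h.symm.trans hs)
  obtain ⟨x, y, z, w, h1, h2, h3, h4⟩ := hS.out.refinement a' b' c' d' s hab hcd
  exact ⟨of x, of y, of z, of w, (of_add_of_eq_of.2 h1).symm, (of_add_of_eq_of.2 h2).symm,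
    (of_add_of_eq_of.2 h3).symm, (of_add_of_eq_of.2 h4).symm⟩

theorem exists_add_of_le_add {a b c : Tot S} (h : a ≤ b + c) (ht : b + c ≠ ⊤) :
    ∃ x y, x ≤ b ∧ y ≤ c ∧ a = x + y := by
  obtain ⟨d, hd⟩ := h
  obtain ⟨x, y, z, w, h1, h2, h3, h4⟩ := refinement hd ht
  exact ⟨x, z, h1 ▸ le_self_add, h2 ▸ le_self_add, h3⟩

theorem disjoint_iff {x y : Tot S} : Disjoint x y ↔ ∀ z, z ≤ x → z ≤ y → z = 0 := by
  constructor
  · intro h z h1 h2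
    exact le_bot_iff.1 (h h1 h2)
  · intro h z h1 h2
    exact (h z h1 h2).le

theorem orth_iff {a b : S} : Orth a b ↔ Disjoint (of a : Tot S) (of b) := by
  rw [disjoint_iff]
  constructor
  · intro h z h1 h2
    obtain ⟨c, rfl⟩ := exists_of (ne_top_of_le h1 (of_ne_top a))
    rw [h c (of_le_of.1 h1) (of_le_of.1 h2)]; rfl
  · intro h x h1 h2
    exact of_injective (h (of x) (of_le_of.2 h1) (of_le_of.2 h2))

theorem disjoint_add {x y z : Tot S} (hx : Disjoint x z) (hy : Disjoint y z) (ht : x + y ≠ ⊤) :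
    Disjoint (x + y) z := by
  rw [disjoint_iff] at *
  intro t h1 h2
  obtain ⟨a, b, ha, hb, rfl⟩ := exists_add_of_le_add h1 ht
  rw [hx a ha (le_self_add.trans h2), hy b hb (le_add_self.trans h2), add_zero]

theorem eq_zero_of_disjoint_self {x : Tot S} (h : Disjoint x x) : x = 0 :=
  disjoint_iff.1 h x le_rfl le_rfl

/-- Disjointness kills the off-diagonal entries of a refinement. This is the uniqueness of
decompositions along a projection. -/
theorem eq_and_eq_of_disjoint {a b c d : Tot S} (h : a + b = c + d) (ht : a + b ≠ ⊤)
    (had : Disjoint a d) (hbc : Disjoint b c) : a = c ∧ b = d := by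
  obtain ⟨x, y, z, w, rfl, rfl, rfl, rfl⟩ := refinement h ht
  have hy : y = 0 := disjoint_iff.1 had y le_add_self le_self_add
  have hz : z = 0 := disjoint_iff.1 hbc z le_self_add le_add_self
  subst hy hz
  exact ⟨rfl, rfl⟩

end Order

end Tot

end PartialCommMonoid

/-! ### Projections, their complements and polars. -/

namespace PartialCommMonoid

namespace Projection

variable {S : Type u} [PartialCommMonoid S]

/-- Projections act on `Tot S`. -/
instance : SMul (Projection S) (Tot S) where
  smul p x := match x with
    | .of a => .of (p a)
    | .top => .top

theorem smul_of (p : Projection S) (a : S) : p • Tot.of a = Tot.of (p a) := rfl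

@[simp] theorem psmul_zero (p : Projection S) : p • (0 : Tot S) = 0 :=
  congrArg Tot.of p.isHom.map_zero

theorem ext_smul {p q : Projection S} (h : ∀ x : Tot S, p • x = q • x) : p = q := by
  rcases p with ⟨f, hf, hf'⟩
  rcases q with ⟨g, hg, hg'⟩
  have : f = g := funext fun a => Tot.of_injective (h (Tot.of a))
  subst this
  rfl

variable [hS : Fact (IsContinuousDimensionScale S)]

@[simp] theorem psmul_eq_top {p : Projection S} {x : Tot S} : p • x = ⊤ ↔ x = ⊤ := by
  rcases x with a | _
  · exact iff_of_false (Tot.of_ne_top (p a)) (Tot.of_ne_top a)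
  · exact iff_of_true rfl rfl

theorem psmul_ne_top {p : Projection S} {x : Tot S} (h : x ≠ ⊤) : p • x ≠ ⊤ :=
  fun h' => h (psmul_eq_top.1 h')

theorem psmul_add (p : Projection S) {x y : Tot S} (h : x + y ≠ ⊤) :
    p • (x + y) = p • x + p • y := by
  obtain ⟨c, hc⟩ := Tot.exists_of h
  obtain ⟨a, b, rfl, rfl, hab⟩ := Tot.add_eq_of.1 hc
  rw [hc]
  exact (Tot.of_add_of_eq_of.2 (p.isHom.map_padd _ _ _ hab)).symm

@[simp] theorem psmul_idem (p : Projection S) (x : Tot S) : p • p • x = p • x := by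
  rcases x with a | _
  · exact congrArg Tot.of (p.idem a)
  · rfl

theorem exists_eq_psmul_add (p : Projection S) {x : Tot S} (hx : x ≠ ⊤) :
    ∃ y, x = p • x + y ∧ ∀ z ≠ ⊤, Disjoint y (p • z) := by
  obtain ⟨a, rfl⟩ := Tot.exists_of hx
  obtain ⟨y, hy, h⟩ := p.decomp a
  refine ⟨.of y, (Tot.of_add_of_eq_of.2 h).symm, fun z hz => ?_⟩
  obtain ⟨c, rfl⟩ := Tot.exists_of hz
  exact Tot.orth_iff.1 (hy _ ⟨c, rfl⟩)

theorem psmul_le (p : Projection S) (x : Tot S) : p • x ≤ x := by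
  by_cases hx : x = ⊤
  · rw [hx]; exact le_top
  · obtain ⟨y, hy, -⟩ := p.exists_eq_psmul_add hx
    exact ⟨y, hy⟩

theorem psmul_mono (p : Projection S) {x y : Tot S} (h : x ≤ y) : p • x ≤ p • y := by
  by_cases hy : y = ⊤
  · rw [hy]; exact le_top
  · obtain ⟨z, rfl⟩ := h
    rw [p.psmul_add hy]
    exact le_self_add

/-- The part of `y` left over by `p` is orthogonal to the range of `p` and yet lies below `x`, which
is in that range. So ranges of projections are lower sets. -/
theorem psmul_eq_of_le {p : Projection S} {x y : Tot S} (hx : x ≠ ⊤) (h : p • x = x)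
    (hy : y ≤ x) : p • y = y := by
  obtain ⟨z, hz, hd⟩ := p.exists_eq_psmul_add (Tot.ne_top_of_le hy hx)
  have : z = 0 := Tot.disjoint_iff.1 (hd x hx) z le_rfl (by
    rw [h]
    exact le_trans (by rw [hz]; exact le_add_self) hy)
  rw [this, add_zero] at hz
  exact hz.symm

theorem le_iff_psmul {p q : Projection S} : p ≤ q ↔ ∀ x : Tot S, p • q • x = p • x := by
  constructor
  · rintro h (a | _)
    · exact congrArg Tot.of (h a)
    · rfl
  · intro h a
    exact Tot.of_injective (h (.of a))

/-- The ordering of projections is inclusion of ranges; most comparisons of projections below go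
through this form. -/
theorem le_iff_fixed {p q : Projection S} :
    p ≤ q ↔ ∀ x : Tot S, x ≠ ⊤ → p • x = x → q • x = x := by
  rw [le_iff_psmul]
  constructor
  · intro h x hx hp
    refine le_antisymm (psmul_le _ _) ?_
    calc x = p • q • x := by rw [h, hp]
      _ ≤ q • x := psmul_le _ _
  · intro h x
    by_cases hx : x = ⊤
    · rw [hx]; rfl
    refine le_antisymm (psmul_mono _ (psmul_le _ _)) ?_
    have := h (p • x) (psmul_ne_top hx) (psmul_idem _ _)
    calc p • x = p • q • p • x := by rw [this, psmul_idem]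
      _ ≤ p • q • x := psmul_mono _ (psmul_mono _ (psmul_le _ _))

instance : PartialOrder (Projection S) :=
  { (inferInstance : Preorder (Projection S)) with
    le_antisymm := fun p q hpq hqp => by
      refine ext_smul fun x => ?_
      by_cases hx : x = ⊤
      · rw [hx]; rfl
      have key : ∀ p q : Projection S, p ≤ q → p • x ≤ q • x := fun p q hpq => by
        have := le_iff_fixed.1 hpq (p • x) (psmul_ne_top hx) (psmul_idem _ _)
        rw [← this]
        exact psmul_mono _ (psmul_le _ _)
      exact le_antisymm (key p q hpq) (key q p hqp) }

theorem eq_of_fixed {p q : Projection S} (h : ∀ x : Tot S, x ≠ ⊤ → (p • x = x ↔ q • x = x)) :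
    p = q :=
  le_antisymm (le_iff_fixed.2 fun x hx => (h x hx).1) (le_iff_fixed.2 fun x hx => (h x hx).2)

/-- A subset `I` that is closed under sums and such that all elements decompose in `I + I^⊥` is the
range of a projection. -/
theorem exists_of_ideal (I : Set (Tot S)) (hI : ∀ x ∈ I, ∀ y ∈ I, x + y ≠ ⊤ → x + y ∈ I)
    (hd : ∀ x ≠ ⊤, ∃ a ∈ I, ∃ b, (∀ c ∈ I, c ≠ ⊤ → Disjoint b c) ∧ x = a + b) :
    ∃ p : Projection S, ∀ x : Tot S, x ≠ ⊤ → (p • x = x ↔ x ∈ I) := by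
  have hd' : ∀ x : S, ∃ a b : S, .of a ∈ I ∧ (∀ c ∈ I, c ≠ ⊤ → Disjoint (.of b) c) ∧
      Tot.of a + Tot.of b = .of x := by
    intro x
    obtain ⟨a, ha, b, hb, h⟩ := hd (.of x) (Tot.of_ne_top x)
    obtain ⟨a, b, rfl, rfl, -⟩ := Tot.add_eq_of.1 h.symm
    exact ⟨a, b, ha, hb, h.symm⟩
  choose f g hf hg hfg using hd'
  -- Uniqueness of the decomposition is what makes the chosen component `f` additive.
  have uniq : ∀ x y z : S, .of y ∈ I → (∀ c ∈ I, c ≠ ⊤ → Disjoint (.of z) c) →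
      Tot.of y + Tot.of z = .of x → y = f x := by
    intro x y z hy hz h
    refine Tot.of_injective (Tot.eq_and_eq_of_disjoint (h.trans (hfg x).symm) ?_ ?_ ?_).1
    · rw [h]; exact Tot.of_ne_top _
    · exact (hg x _ hy (Tot.of_ne_top _)).symm
    · exact hz _ (hf x) (Tot.of_ne_top _)
  refine ⟨⟨f, ⟨?_, ?_⟩, ?_⟩, ?_⟩
  · have h := hfg 0
    have h0 : Tot.of (f 0) ≤ 0 := ⟨_, h.symm⟩
    exact Tot.of_injective (le_antisymm h0 (Tot.zero_le' _))
  · intro a b c hc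
    have hc' := Tot.of_add_of_eq_of.2 hc
    have e : Tot.of c = (Tot.of (f a) + Tot.of (f b)) + (Tot.of (g a) + Tot.of (g b)) := by
      rw [← hc', ← hfg a, ← hfg b]; exact add_add_add_comm _ _ _ _
    have ht : (Tot.of (f a) + Tot.of (f b)) + (Tot.of (g a) + Tot.of (g b)) ≠ ⊤ := by
      rw [← e]; exact Tot.of_ne_top _
    obtain ⟨y, hy⟩ := Tot.exists_of (Tot.left_ne_top ht)
    obtain ⟨z, hz⟩ := Tot.exists_of (Tot.right_ne_top ht)
    refine Tot.of_add_of_eq_of.1 (hy.trans ?_)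
    rw [uniq c y z (hy ▸ hI _ (hf a) _ (hf b) (Tot.left_ne_top ht)) ?_ (by rw [e, hy, hz])]
    intro t htI htt
    rw [← hz]
    exact Tot.disjoint_add (hg a t htI htt) (hg b t htI htt) (Tot.right_ne_top ht)
  · intro x
    refine ⟨g x, ?_, Tot.of_add_of_eq_of.1 (hfg x)⟩
    rintro _ ⟨y, rfl⟩
    exact Tot.orth_iff.2 (hg x _ (hf y) (Tot.of_ne_top _))
  · intro x hx
    obtain ⟨a, rfl⟩ := Tot.exists_of hx
    constructor
    · intro h
      rw [← h]
      exact hf a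
    · intro h
      refine congrArg Tot.of (uniq a a 0 h (fun c _ _ => ?_) (add_zero _)).symm
      exact disjoint_bot_left

/-- The decomposition provided by `p` is used with its two summands exchanged. -/
theorem exists_compl (p : Projection S) :
    ∃ q : Projection S, ∀ x : Tot S, x ≠ ⊤ → (q • x = x ↔ ∀ z ≠ ⊤, Disjoint x (p • z)) := by
  obtain ⟨q, hq⟩ := exists_of_ideal {x : Tot S | ∀ z ≠ ⊤, Disjoint x (p • z)}
    (fun x hx y hy hxy z hz => Tot.disjoint_add (hx z hz) (hy z hz) hxy) (fun x hx => by
      obtain ⟨y, hy, hd⟩ := p.exists_eq_psmul_add hx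
      exact ⟨y, hd, p • x, fun c hc _ => (hc x hx).symm, by rw [add_comm]; exact hy⟩)
  exact ⟨q, hq⟩

noncomputable instance : Compl (Projection S) := ⟨fun p => (exists_compl p).choose⟩

theorem compl_psmul_eq_iff {p : Projection S} {x : Tot S} (hx : x ≠ ⊤) :
    pᶜ • x = x ↔ ∀ z ≠ ⊤, Disjoint x (p • z) :=
  (exists_compl p).choose_spec x hx

theorem disjoint_compl_psmul (p : Projection S) {x y : Tot S} (hx : x ≠ ⊤) (hy : y ≠ ⊤) :
    Disjoint (pᶜ • x) (p • y) :=
  (compl_psmul_eq_iff (psmul_ne_top hx)).1 (psmul_idem _ _) y hy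

theorem psmul_add_compl_psmul (p : Projection S) (x : Tot S) : p • x + pᶜ • x = x := by
  by_cases hx : x = ⊤
  · rw [hx]; rfl
  obtain ⟨y, hy, hd⟩ := p.exists_eq_psmul_add hx
  obtain ⟨z, hz, hd'⟩ := pᶜ.exists_eq_psmul_add hx
  have hyt : y ≠ ⊤ := Tot.right_ne_top (hy ▸ hx)
  have hzt : z ≠ ⊤ := Tot.right_ne_top (hz ▸ hx)
  have hpy : pᶜ • y = y := (compl_psmul_eq_iff hyt).2 hd
  have hpx : pᶜ • (p • x) = 0 := Tot.eq_zero_of_disjoint_self <|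
    (disjoint_compl_psmul p (psmul_ne_top hx) hx).mono_right (psmul_le _ _)
  have : pᶜ • x = y := by
    conv_lhs => rw [hy]
    rw [psmul_add _ (hy ▸ hx), hpx, hpy, zero_add]
  rw [this]
  exact hy.symm

theorem compl_psmul_psmul (p : Projection S) {x : Tot S} (hx : x ≠ ⊤) : pᶜ • p • x = 0 :=
  Tot.eq_zero_of_disjoint_self <|
    (disjoint_compl_psmul p (psmul_ne_top hx) hx).mono_right (psmul_le _ _)

theorem psmul_compl_psmul (p : Projection S) {x : Tot S} (hx : x ≠ ⊤) : p • pᶜ • x = 0 :=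
  Tot.eq_zero_of_disjoint_self <|
    ((disjoint_compl_psmul p hx (psmul_ne_top hx)).mono_left (psmul_le _ _)).symm.mono_left le_rfl

/-- Links the perpendicular projection in the axiom of general comparability to the complement used
from here on. -/
theorem isPerp_iff {p q : Projection S} : p.IsPerp q ↔ q = pᶜ := by
  have hr : ∀ (p : Projection S) (x : S), x ∈ Set.range p ↔ p • Tot.of x = Tot.of x := by
    intro p x
    constructor
    · rintro ⟨y, rfl⟩
      exact psmul_idem p (.of y)
    · intro h
      exact ⟨x, Tot.of_injective h⟩
  have hp : ∀ (p : Projection S) (x : S),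
      x ∈ perp (Set.range p) ↔ ∀ z ≠ ⊤, Disjoint (Tot.of x) (p • z) := by
    intro p x
    constructor
    · intro h z hz
      obtain ⟨c, rfl⟩ := Tot.exists_of hz
      exact Tot.orth_iff.1 (h _ ⟨c, rfl⟩)
    · rintro h _ ⟨y, rfl⟩
      exact Tot.orth_iff.2 (h _ (Tot.of_ne_top y))
  constructor
  · intro h
    refine eq_of_fixed fun x hx => ?_
    obtain ⟨a, rfl⟩ := Tot.exists_of hx
    rw [← hr, h.1, hp, compl_psmul_eq_iff hx]
  · rintro rfl
    refine ⟨Set.ext fun x => ?_, Set.ext fun x => ?_⟩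
    · rw [hr, hp, compl_psmul_eq_iff (Tot.of_ne_top x)]
    · rw [hr, Set.mem_preimage, Set.mem_singleton_iff]
      have := psmul_add_compl_psmul p (.of x)
      constructor
      · intro h
        have h' : pᶜ • Tot.of x = 0 := congrArg Tot.of h
        rwa [h', add_zero] at this
      · intro h
        have := compl_psmul_psmul p (Tot.of_ne_top x)
        rw [h] at this
        exact Tot.of_injective this

theorem exists_comparable {x y : Tot S} (hx : x ≠ ⊤) (hy : y ≠ ⊤) :
    ∃ p : Projection S, p • x ≤ p • y ∧ pᶜ • y ≤ pᶜ • x := by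
  obtain ⟨a, rfl⟩ := Tot.exists_of hx
  obtain ⟨b, rfl⟩ := Tot.exists_of hy
  obtain ⟨p, q, hpq, h1, h2⟩ := hS.out.generalComparability a b
  rw [isPerp_iff] at hpq
  subst hpq
  exact ⟨p, Tot.of_le_of.2 h1, Tot.of_le_of.2 h2⟩

theorem exists_greatest {x y : Tot S} (hx : x ≠ ⊤) (hy : y ≠ ⊤) :
    ∃ p : Projection S, p • x ≤ p • y ∧ ∀ q : Projection S, q • x ≤ q • y → q ≤ p := by
  obtain ⟨a, rfl⟩ := Tot.exists_of hx
  obtain ⟨b, rfl⟩ := Tot.exists_of hy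
  obtain ⟨p, h1, h2⟩ := hS.out.booleanValued a b
  exact ⟨p, Tot.of_le_of.2 h1, fun q hq => h2 (Tot.of_le_of.1 hq)⟩

/-- The projection is the largest one that kills `a`, obtained from (M4) by comparing `a` with `0`.
If `x` is disjoint from `a`, comparability gives `q` such that `q` kills `x` and `qᶜ` kills `a`;
then `x` is fixed by `qᶜ`, which is below that largest projection. -/
theorem exists_polar_singleton {a : Tot S} (ha : a ≠ ⊤) :
    ∃ p : Projection S, ∀ x : Tot S, x ≠ ⊤ → (p • x = x ↔ Disjoint x a) := by
  obtain ⟨p, h1, h2⟩ := exists_greatest ha Tot.zero_ne_top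
  have h0 : p • a = 0 := le_antisymm (by rwa [psmul_zero] at h1) (Tot.zero_le' _)
  refine ⟨p, fun x hx => ⟨fun h => ?_, fun h => ?_⟩⟩
  · refine Tot.disjoint_iff.2 fun z hz hza => le_antisymm ?_ (Tot.zero_le' _)
    rw [← psmul_eq_of_le hx h hz, ← h0]
    exact psmul_mono _ hza
  · obtain ⟨q, hq1, hq2⟩ := exists_comparable hx ha
    have hqx : q • x = 0 := Tot.disjoint_iff.1 h _ (psmul_le _ _) (hq1.trans (psmul_le _ _))
    have hqa : qᶜ • a = 0 := Tot.disjoint_iff.1 h _ (hq2.trans (psmul_le _ _)) (psmul_le _ _)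
    have hqp : qᶜ ≤ p := h2 _ (by rw [hqa]; exact Tot.zero_le' _)
    have := psmul_add_compl_psmul q x
    rw [hqx, zero_add] at this
    exact le_iff_fixed.1 hqp x hx this

/-- Let `y` be the supremum of the parts of `x` carried by the single elements of `X`. The
projection onto the polar of `y` splits `x`: the component orthogonal to `y` is orthogonal to all of
`X`, and the other one is orthogonal to the polar of `X`, because `y` is. -/
theorem exists_polar (X : Set (Tot S)) (hX : ∀ a ∈ X, a ≠ ⊤) :
    ∃ p : Projection S, ∀ x : Tot S, x ≠ ⊤ → (p • x = x ↔ ∀ a ∈ X, Disjoint x a) := by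
  have hp : ∀ a : X, ∃ p : Projection S, ∀ x : Tot S, x ≠ ⊤ → (p • x = x ↔ Disjoint x a) :=
    fun a => exists_polar_singleton (hX a a.2)
  choose p hp using hp
  refine exists_of_ideal {x | ∀ a ∈ X, Disjoint x a}
    (fun x hx y hy hxy a ha => Tot.disjoint_add (hx a ha) (hy a ha) hxy) fun x hx => ?_
  set y : Tot S := ⨆ a : X, (p a)ᶜ • x with hy
  have hle : ∀ a, (p a)ᶜ • x ≤ y := fun a => le_iSup (fun a : X => (p a)ᶜ • x) a
  have hyx : y ≤ x := iSup_le fun a => psmul_le _ _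
  have hyt : y ≠ ⊤ := Tot.ne_top_of_le hyx hx
  have hyI : ∀ t ≠ ⊤, (∀ a ∈ X, Disjoint t a) → Disjoint y t := by
    intro t ht h
    obtain ⟨q, hq⟩ := exists_polar_singleton ht
    refine (hq y hyt).1 (le_antisymm (psmul_le _ _) (iSup_le fun a => ?_))
    have h1 : Disjoint ((p a)ᶜ • x) t := by
      rw [← (hp a t ht).2 (h a a.2)]
      exact disjoint_compl_psmul _ hx ht
    rw [← (hq _ (psmul_ne_top hx)).2 h1]
    exact psmul_mono _ (hle a)
  obtain ⟨r, hr⟩ := exists_polar_singleton hyt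
  have hrx := (hr (r • x) (psmul_ne_top hx)).1 (psmul_idem _ _)
  refine ⟨r • x, ?_, rᶜ • x, ?_, (psmul_add_compl_psmul r x).symm⟩
  · intro a ha
    have h0 : (p ⟨a, ha⟩)ᶜ • r • x = 0 := Tot.disjoint_iff.1 hrx _ (psmul_le _ _)
      ((psmul_mono _ (psmul_le _ _)).trans (hle ⟨a, ha⟩))
    have := psmul_add_compl_psmul (p ⟨a, ha⟩) (r • x)
    rw [h0, add_zero] at this
    exact (hp ⟨a, ha⟩ _ (psmul_ne_top hx)).1 this
  · intro t ht htt
    rw [← (hr t htt).2 (hyI t htt ht).symm]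
    exact disjoint_compl_psmul _ hx htt

end Projection

end PartialCommMonoid

/-! ### The complete Boolean algebra of projections. -/

namespace PartialCommMonoid

namespace Projection

variable {S : Type u} [PartialCommMonoid S] [hS : Fact (IsContinuousDimensionScale S)]

/-- An intersection of ranges is the polar of the union of the complementary ranges. -/
theorem exists_inf (P : Set (Projection S)) : ∃ q : Projection S, ∀ x : Tot S, x ≠ ⊤ →
    (q • x = x ↔ ∀ p ∈ P, p • x = x) := by
  obtain ⟨q, hq⟩ := exists_polar {a : Tot S | a ≠ ⊤ ∧ ∃ p ∈ P, pᶜ • a = a} fun a ha => ha.1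
  refine ⟨q, fun x hx => (hq x hx).trans ⟨fun h p hp => ?_, fun h a ha => ?_⟩⟩
  · have h0 : pᶜ • x = 0 := Tot.disjoint_iff.1
      (h (pᶜ • x) ⟨psmul_ne_top hx, p, hp, psmul_idem _ _⟩) _ (psmul_le _ _) le_rfl
    have := psmul_add_compl_psmul p x
    rwa [h0, add_zero] at this
  · obtain ⟨ha, p, hp, hpa⟩ := ha
    rw [← h p hp, ← hpa]
    exact (disjoint_compl_psmul p ha hx).symm

noncomputable instance : InfSet (Projection S) := ⟨fun P => (exists_inf P).choose⟩

theorem sInf_psmul_eq_iff {P : Set (Projection S)} {x : Tot S} :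
    sInf P • x = x ↔ ∀ p ∈ P, p • x = x := by
  by_cases hx : x = ⊤
  · subst hx; simp
  · exact (exists_inf P).choose_spec x hx

noncomputable instance : CompleteLattice (Projection S) :=
  completeLatticeOfInf (Projection S) fun _ =>
    ⟨fun p hp => le_iff_fixed.2 fun _ _ h => sInf_psmul_eq_iff.1 h p hp,
      fun _ hq => le_iff_fixed.2 fun x hx h => sInf_psmul_eq_iff.2 fun _ hp =>
        le_iff_fixed.1 (hq hp) x hx h⟩

@[simp] theorem top_psmul (x : Tot S) : (⊤ : Projection S) • x = x := by
  have : (⊤ : Projection S) = sInf ∅ := sInf_empty.symm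
  rw [this, sInf_psmul_eq_iff]
  simp

theorem psmul_eq_of_le_of_eq {p q : Projection S} (h : p ≤ q) {x : Tot S} (hx : p • x = x) :
    q • x = x := by
  by_cases ht : x = ⊤
  · subst ht; rfl
  · exact le_iff_fixed.1 h x ht hx

theorem inf_psmul_eq_iff {p q : Projection S} {x : Tot S} :
    (p ⊓ q) • x = x ↔ p • x = x ∧ q • x = x := by
  constructor
  · intro h
    exact ⟨psmul_eq_of_le_of_eq inf_le_left h, psmul_eq_of_le_of_eq inf_le_right h⟩
  · rintro ⟨h1, h2⟩
    have : p ⊓ q = sInf {p, q} := sInf_pair.symm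
    rw [this, sInf_psmul_eq_iff]
    rintro r (rfl | rfl)
    exacts [h1, h2]

theorem psmul_psmul_fixed (p q : Projection S) (x : Tot S) : p • q • p • x = q • p • x := by
  by_cases hx : x = ⊤
  · subst hx; rfl
  · exact psmul_eq_of_le (psmul_ne_top hx) (psmul_idem p x) (psmul_le _ _)

/-- Since ranges are lower sets, `q • p • x` stays in the range of `p`. This makes projections
commute, and their composition is then the meet. -/
theorem inf_psmul (p q : Projection S) (x : Tot S) : (p ⊓ q) • x = p • q • x := by
  have h1 : q • p • x ≤ p • q • x := by
    rw [← psmul_psmul_fixed]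
    exact psmul_mono _ (psmul_mono _ (psmul_le _ _))
  have h2 : p • q • x ≤ q • p • x := by
    rw [← psmul_psmul_fixed]
    exact psmul_mono _ (psmul_mono _ (psmul_le _ _))
  have h3 : p • q • x = q • p • x := le_antisymm h2 h1
  refine le_antisymm ?_ ?_
  · have := (inf_psmul_eq_iff (p := p) (q := q)).1 (psmul_idem (p ⊓ q) x)
    rw [← this.1, ← this.2]
    exact psmul_mono _ (psmul_mono _ (psmul_le _ _))
  · have : (p ⊓ q) • p • q • x = p • q • x :=
      inf_psmul_eq_iff.2 ⟨psmul_idem _ _, by rw [h3, psmul_idem]⟩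
    rw [← this]
    exact psmul_mono _ ((psmul_le _ _).trans (psmul_le _ _))

theorem psmul_comm (p q : Projection S) (x : Tot S) : p • q • x = q • p • x := by
  rw [← inf_psmul, inf_comm, inf_psmul]

theorem le_compl_iff_psmul {p q : Projection S} : p ≤ qᶜ ↔ ∀ x : Tot S, x ≠ ⊤ → p • q • x = 0 := by
  constructor
  · intro h x hx
    have := psmul_eq_of_le_of_eq h (psmul_idem p (q • x))
    rw [← this, psmul_comm p q x, compl_psmul_psmul _ (psmul_ne_top hx)]
  · intro h
    refine le_iff_fixed.2 fun x hx hp => ?_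
    have := psmul_add_compl_psmul q x
    have h0 : q • x = 0 := by rw [← h x hx, psmul_comm, hp]
    rwa [h0, zero_add] at this

theorem bot_psmul {x : Tot S} (hx : x ≠ ⊤) : (⊥ : Projection S) • x = 0 := by
  have := le_compl_iff_psmul.1 (bot_le : (⊥ : Projection S) ≤ ⊤ᶜ) x hx
  rwa [top_psmul] at this

theorem eq_bot_of_psmul {p : Projection S} (h : ∀ x : Tot S, x ≠ ⊤ → p • x = 0) : p = ⊥ :=
  le_bot_iff.1 <| le_iff_fixed.2 fun x hx hp => by
    rw [← hp, h x hx, psmul_zero]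

theorem psmul_eq_of_parts {p q : Projection S} {x : Tot S} (h1 : q • p • x = p • x)
    (h2 : q • pᶜ • x = pᶜ • x) : q • x = x := by
  by_cases hx : x = ⊤
  · subst hx; rfl
  have := psmul_add_compl_psmul p x
  conv_lhs => rw [← this]
  rw [psmul_add _ (by rw [this]; exact hx), h1, h2, this]

noncomputable instance : CompleteBooleanAlgebra (Projection S) :=
  { (inferInstance : CompleteLattice (Projection S)) with
    compl := compl
    le_sup_inf := fun x y z => le_iff_fixed.2 fun a ha h => by
      obtain ⟨h1, h2⟩ := inf_psmul_eq_iff.1 h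
      have key : ∀ y : Projection S, (x ⊔ y) • a = a → y • xᶜ • a = xᶜ • a := by
        intro y h1
        have hc : yᶜ • xᶜ • a = 0 := by
          -- The part of `a` missed by both `x` and `y`. The polar projection of `c` lies above `x`
          -- and `y`, hence above their join, which fixes `c`; so `c` is disjoint from itself.
          set c := yᶜ • xᶜ • a with hc
          have hct : c ≠ ⊤ := psmul_ne_top (psmul_ne_top ha)
          obtain ⟨q, hq⟩ := exists_polar_singleton hct
          have hx : x ≤ q := le_iff_fixed.2 fun t ht hxt => (hq t ht).2 (by
            rw [← hxt, hc, psmul_comm]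
            exact (disjoint_compl_psmul x (psmul_ne_top ha) ht).symm)
          have hy : y ≤ q := le_iff_fixed.2 fun t ht hyt => (hq t ht).2 (by
            rw [← hyt, hc]
            exact (disjoint_compl_psmul y (psmul_ne_top ha) ht).symm)
          have h3 : (x ⊔ y) • c = c := psmul_eq_of_le ha h1 ((psmul_le _ _).trans (psmul_le _ _))
          exact Tot.eq_zero_of_disjoint_self
            ((hq c hct).1 (psmul_eq_of_le_of_eq (sup_le hx hy) h3))
        have := psmul_add_compl_psmul y (xᶜ • a)
        rwa [hc, add_zero] at this
      refine psmul_eq_of_parts (p := x)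
        (psmul_eq_of_le_of_eq le_sup_left (psmul_idem _ _)) ?_
      exact psmul_eq_of_le_of_eq (p := y ⊓ z) le_sup_right
        (inf_psmul_eq_iff.2 ⟨key y h1, key z h2⟩)
    inf_compl_le_bot := fun p => (eq_bot_of_psmul fun x hx => by
      rw [inf_psmul, psmul_compl_psmul _ hx]).le
    top_le_sup_compl := fun p => le_iff_fixed.2 fun x _ _ =>
      psmul_eq_of_parts (p := p) (psmul_eq_of_le_of_eq le_sup_left (psmul_idem _ _))
        (psmul_eq_of_le_of_eq le_sup_right (psmul_idem _ _))
    le_top := fun _ => le_top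
    bot_le := fun _ => bot_le
    sdiff := fun p q => p ⊓ qᶜ
    himp := fun p q => q ⊔ pᶜ
    sdiff_eq := fun _ _ => rfl
    himp_eq := fun _ _ => rfl }

theorem eq_of_psmul (p : Projection S) {x y : Tot S} (h1 : p • x = p • y)
    (h2 : pᶜ • x = pᶜ • y) : x = y := by
  rw [← psmul_add_compl_psmul p x, ← psmul_add_compl_psmul p y, h1, h2]

theorem le_of_psmul (p : Projection S) {x y : Tot S} (h1 : p • x ≤ p • y)
    (h2 : pᶜ • x ≤ pᶜ • y) : x ≤ y := by
  rw [← psmul_add_compl_psmul p x, ← psmul_add_compl_psmul p y]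
  exact add_le_add h1 h2

theorem psmul_of_le {p q : Projection S} (h : p ≤ q) (x : Tot S) : p • q • x = p • x := by
  rw [← inf_psmul, inf_eq_left.2 h]

theorem psmul_of_le' {p q : Projection S} (h : p ≤ q) (x : Tot S) : q • p • x = p • x := by
  rw [psmul_comm, psmul_of_le h]

theorem psmul_le_psmul {p q : Projection S} (h : p ≤ q) (x : Tot S) : p • x ≤ q • x := by
  rw [← psmul_of_le' h]
  exact psmul_mono _ (psmul_le _ _)

/-- The sum of the supremum of the `p`-parts and the complementary part of `sSup X` is an upper
bound of `X`; apply `p` to it. -/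
theorem psmul_sSup (p : Projection S) {X : Set (Tot S)} (hX : sSup X ≠ ⊤) :
    p • sSup X = sSup ((fun x => p • x) '' X) := by
  apply le_antisymm
  · set s := sSup ((fun x => p • x) '' X)
    have hs : s ≤ p • sSup X := sSup_le (by
      rintro _ ⟨x, hx, rfl⟩
      exact psmul_mono _ (le_sSup hx))
    have ht : s + pᶜ • sSup X ≠ ⊤ :=
      Tot.ne_top_of_le (add_le_add_left hs _) (by rw [psmul_add_compl_psmul]; exact hX)
    have h : sSup X ≤ s + pᶜ • sSup X := sSup_le fun x hx => by
      rw [← psmul_add_compl_psmul p x]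
      exact add_le_add (le_sSup ⟨x, hx, rfl⟩) (psmul_mono _ (le_sSup hx))
    refine (psmul_mono p h).trans ?_
    rw [psmul_add _ ht, psmul_compl_psmul _ hX, add_zero]
    exact psmul_le _ _
  · exact sSup_le (by
      rintro _ ⟨x, hx, rfl⟩
      exact psmul_mono _ (le_sSup hx))

theorem psmul_sSup_eq {p : Projection S} {X : Set (Tot S)} (h : ∀ x ∈ X, p • x = x) :
    p • sSup X = sSup X :=
  le_antisymm (psmul_le _ _) (sSup_le fun x hx => by
    rw [← h x hx]; exact psmul_mono _ (le_sSup hx))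

theorem psmul_nsmul (p : Projection S) (n : ℕ) {x : Tot S} (h : n • x ≠ ⊤) :
    p • (n • x) = n • (p • x) := by
  induction n with
  | zero => simp
  | succ n ih =>
    rw [succ_nsmul] at h
    rw [succ_nsmul, succ_nsmul, psmul_add _ h, ih (Tot.left_ne_top h)]

/-! ### Supports -/

/-- The smallest projection that fixes `x`. -/
noncomputable def supp (x : Tot S) : Projection S := sInf {p | p • x = x}

theorem supp_le_iff {x : Tot S} {p : Projection S} : supp x ≤ p ↔ p • x = x := by
  constructor
  · intro h
    exact psmul_eq_of_le_of_eq h (sInf_psmul_eq_iff.2 fun p hp => hp)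
  · intro h
    exact sInf_le h

@[simp] theorem supp_psmul_self (x : Tot S) : supp x • x = x := supp_le_iff.1 le_rfl

theorem supp_zero : supp (0 : Tot S) = ⊥ :=
  le_bot_iff.1 (supp_le_iff.2 (psmul_zero _))

theorem psmul_eq_zero_iff {p : Projection S} {x : Tot S} (hx : x ≠ ⊤) :
    p • x = 0 ↔ p ⊓ supp x = ⊥ := by
  constructor
  · intro h
    have := psmul_add_compl_psmul p x
    rw [h, zero_add] at this
    have h1 := supp_le_iff.2 this
    exact (le_compl_iff_disjoint_left.1 h1).eq_bot
  · intro h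
    rw [← supp_psmul_self x, ← inf_psmul, h, bot_psmul hx]

theorem supp_eq_bot {x : Tot S} (hx : x ≠ ⊤) : supp x = ⊥ ↔ x = 0 := by
  have := psmul_eq_zero_iff (p := ⊤) hx
  rw [top_psmul, top_inf_eq] at this
  exact this.symm

theorem supp_psmul (p : Projection S) {x : Tot S} (_ : x ≠ ⊤) :
    supp (p • x) = p ⊓ supp x := by
  apply le_antisymm
  · rw [supp_le_iff, inf_psmul, psmul_comm (supp x), supp_psmul_self, psmul_idem]
  · have h : supp x ≤ supp (p • x) ⊔ pᶜ := by
      rw [supp_le_iff]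
      exact psmul_eq_of_parts (p := p) (psmul_eq_of_le_of_eq le_sup_left (supp_psmul_self _))
        (psmul_eq_of_le_of_eq le_sup_right (psmul_idem _ _))
    calc p ⊓ supp x ≤ p ⊓ (supp (p • x) ⊔ pᶜ) := inf_le_inf_left _ h
      _ = p ⊓ supp (p • x) := by rw [inf_sup_left, inf_compl_self, sup_bot_eq]
      _ ≤ _ := inf_le_right

theorem supp_mono {x y : Tot S} (h : x ≤ y) (hy : y ≠ ⊤) : supp x ≤ supp y :=
  supp_le_iff.2 (psmul_eq_of_le hy (supp_psmul_self y) h)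

theorem supp_add {x y : Tot S} (h : x + y ≠ ⊤) : supp (x + y) = supp x ⊔ supp y :=
  le_antisymm (supp_le_iff.2 (by
    rw [psmul_add _ h, supp_le_iff.1 le_sup_left, supp_le_iff.1 le_sup_right]))
    (sup_le (supp_mono le_self_add h) (supp_mono le_add_self h))

/-- The polar of `y` is the range of a projection, which must contain the support of anything
disjoint from `y`. -/
theorem disjoint_iff_supp {x y : Tot S} (hx : x ≠ ⊤) (hy : y ≠ ⊤) :
    Disjoint x y ↔ Disjoint (supp x) (supp y) := by
  constructor
  · intro h
    obtain ⟨p, hp⟩ := exists_polar_singleton hy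
    have h1 : supp x ≤ p := supp_le_iff.2 ((hp x hx).2 h)
    have h2 : p • y = 0 := Tot.disjoint_iff.1
      ((hp (p • y) (psmul_ne_top hy)).1 (psmul_idem _ _)) _ le_rfl (psmul_le _ _)
    rw [psmul_eq_zero_iff hy] at h2
    exact (_root_.disjoint_iff.2 h2).mono_left h1
  · intro h
    refine Tot.disjoint_iff.2 fun z h1 h2 => ?_
    rw [← supp_eq_bot (Tot.ne_top_of_le h1 hx)]
    exact le_bot_iff.1 (h (supp_mono h1 hx) (supp_mono h2 hy))

/-- Turns the condition on polars in (M6) into an equality of supports. -/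
theorem perp_singleton_eq_iff {a b : S} :
    perp {a} = perp {b} ↔ supp (.of a) = supp (.of b) := by
  have key : ∀ a c : S, c ∈ perp {a} ↔ supp (.of c) ≤ (supp (.of a))ᶜ := by
    intro a c
    rw [le_compl_iff_disjoint_right, ← disjoint_iff_supp (Tot.of_ne_top c) (Tot.of_ne_top a),
      ← Tot.orth_iff]
    exact ⟨fun h => h a rfl, fun h x hx => by rw [Set.mem_singleton_iff.1 hx]; exact h⟩
  have imp : ∀ a b : S, perp {a} = perp {b} → supp (.of a) ≤ supp (.of b) := by
    intro a b h
    have h1 : (supp (.of b))ᶜ • Tot.of a = 0 := by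
      have h2 : (supp (.of b))ᶜ • Tot.of a = .of ((supp (.of b))ᶜ a) := rfl
      have h3 : (supp (.of b))ᶜ a ∈ perp {a} := by
        rw [h, key, supp_le_iff, ← h2, psmul_idem]
      rw [key, ← h2, supp_psmul _ (Tot.of_ne_top a)] at h3
      rw [psmul_eq_zero_iff (Tot.of_ne_top a)]
      exact le_bot_iff.1 (by
        calc _ ≤ (supp (Tot.of a))ᶜ ⊓ supp (Tot.of a) := le_inf h3 inf_le_right
          _ = ⊥ := compl_inf_self _)
    rw [psmul_eq_zero_iff (Tot.of_ne_top a), inf_comm, ← sdiff_eq, sdiff_eq_bot_iff] at h1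
    exact h1
  constructor
  · intro h
    exact le_antisymm (imp a b h) (imp b a h.symm)
  · intro h
    ext c
    rw [key, key, h]

/-! ### Comparisons -/

/-- `x ≤ y` holds on no nonzero part of `q`. -/
def NowhereLE (q : Projection S) (x y : Tot S) : Prop :=
  ∀ p ≤ q, p • x ≤ p • y → p = ⊥

/-- Take for `q` the complement of the largest projection under which `x ≤ y`. This is the tool that
localizes every proof by contradiction about the order. -/
theorem exists_nowhereLE {x y : Tot S} (hx : x ≠ ⊤) (hy : y ≠ ⊤) (h : ¬ x ≤ y) :
    ∃ q ≤ supp x, q ≠ ⊥ ∧ NowhereLE q x y ∧ q • y ≤ q • x := by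
  obtain ⟨p, hp, hp'⟩ := exists_greatest hx hy
  refine ⟨pᶜ, ?_, ?_, ?_, ?_⟩
  · have : (supp x)ᶜ ≤ p := hp' _ (by
      rw [(psmul_eq_zero_iff hx).2 (compl_inf_self _)]; exact Tot.zero_le' _)
    exact compl_le_of_compl_le this
  · intro h0
    rw [compl_eq_bot] at h0
    subst h0
    rw [top_psmul, top_psmul] at hp
    exact h hp
  · intro r hr h1
    exact le_bot_iff.1 ((le_inf (hp' r h1) hr).trans (inf_compl_self p).le)
  · obtain ⟨r, hr1, hr2⟩ := exists_comparable hx hy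
    have : pᶜ ≤ rᶜ := compl_le_compl (hp' r hr1)
    rw [← psmul_of_le this, ← psmul_of_le this x]
    exact psmul_mono _ hr2

theorem NowhereLE.mono {p q : Projection S} {x y : Tot S} (h : NowhereLE q x y) (hp : p ≤ q) :
    NowhereLE p x y := fun r hr => h r (hr.trans hp)

theorem exists_nowhereLE_of_psmul {q : Projection S} {x y : Tot S} (hx : x ≠ ⊤) (hy : y ≠ ⊤)
    (h : ¬ q • x ≤ q • y) :
    ∃ r ≤ q ⊓ supp x, r ≠ ⊥ ∧ NowhereLE r x y ∧ r • y ≤ r • x := by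
  obtain ⟨r, h1, h2, h3, h4⟩ := exists_nowhereLE (psmul_ne_top hx) (psmul_ne_top hy) h
  rw [supp_psmul _ hx] at h1
  have hrq : r ≤ q := h1.trans inf_le_left
  refine ⟨r, h1, h2, fun p hp hle => h3 p hp ?_, ?_⟩
  · rwa [psmul_of_le (hp.trans hrq), psmul_of_le (hp.trans hrq)]
  · rwa [psmul_of_le hrq, psmul_of_le hrq] at h4

theorem NowhereLE.le {q : Projection S} {x y : Tot S} (hx : x ≠ ⊤) (hy : y ≠ ⊤)
    (h : NowhereLE q x y) : q • y ≤ q • x := by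
  obtain ⟨r, hr1, hr2⟩ := exists_comparable hx hy
  have h0 : q ⊓ r = ⊥ := h _ inf_le_left (by
    rw [inf_psmul, inf_psmul]; exact psmul_mono _ hr1)
  have : q ≤ rᶜ := le_compl_iff_disjoint_right.2 (_root_.disjoint_iff.2 h0)
  rw [← psmul_of_le this, ← psmul_of_le this x]
  exact psmul_mono _ hr2

theorem eq_add_of_psmul (p : Projection S) {a b c : Tot S} (h1 : p • c = p • a + p • b)
    (h2 : pᶜ • c = pᶜ • a + pᶜ • b) : c = a + b := by
  rw [← psmul_add_compl_psmul p c, h1, h2, add_add_add_comm, psmul_add_compl_psmul,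
    psmul_add_compl_psmul]

end Projection

end PartialCommMonoid

/-! ### The Stone space of a complete Boolean algebra. -/

namespace UltrafilterSpace

variable {P : Type u} [CompleteBooleanAlgebra P]

theorem bot_notMem (F : UltrafilterSpace P) : (⊥ : P) ∉ F.1 := fun h =>
  F.2.prop (Set.eq_univ_of_forall fun _ => Order.PFilter.mem_of_le bot_le h)

theorem maximal_of {F : Order.PFilter P} (hb : (⊥ : P) ∉ F) (h : ∀ p : P, p ∈ F ∨ pᶜ ∈ F) :
    Maximal (fun G : Order.PFilter P => (G : Set P) ≠ Set.univ) F := by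
  refine ⟨fun h => hb (h ▸ Set.mem_univ (⊥ : P) : (⊥ : P) ∈ (F : Set P)), fun G hG hFG p hp => ?_⟩
  refine (h p).resolve_right fun hc => hG (Set.eq_univ_of_forall fun q => ?_)
  have hc' : pᶜ ∈ G := hFG hc
  have := Order.PFilter.inf_mem hp hc'
  rw [inf_compl_self] at this
  exact Order.PFilter.mem_of_le bot_le this

theorem isPFilter_of {F : Set P} (ht : ⊤ ∈ F) (hi : ∀ p ∈ F, ∀ q ∈ F, p ⊓ q ∈ F)
    (hle : ∀ p q, p ≤ q → p ∈ F → q ∈ F) : Order.IsPFilter F :=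
  Order.IsPFilter.of_def ⟨⊤, ht⟩ (fun p hp q hq => ⟨p ⊓ q, hi p hp q hq, inf_le_left, inf_le_right⟩)
    fun {p q} h hp => hle p q h hp

/-- If `pᶜ` is not in `F`, the filter generated by `F` and `p` is proper, so maximality puts `p` in
`F`. -/
theorem mem_or_compl_mem (F : UltrafilterSpace P) (p : P) : p ∈ F.1 ∨ pᶜ ∈ F.1 := by
  by_contra! h
  have hG : Order.IsPFilter {q : P | ∃ f ∈ F.1, f ⊓ p ≤ q} := isPFilter_of
    ⟨⊤, F.1.top_mem, le_top⟩
    (by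
      rintro x ⟨f, hf, hx⟩ y ⟨g, hg, hy⟩
      refine ⟨f ⊓ g, Order.PFilter.inf_mem hf hg, le_inf (le_trans ?_ hx) (le_trans ?_ hy)⟩
      · exact inf_le_inf_right _ inf_le_left
      · exact inf_le_inf_right _ inf_le_right)
    (by
      rintro x y hxy ⟨f, hf, hx⟩
      exact ⟨f, hf, hx.trans hxy⟩)
  have hne : ((hG.toPFilter : Order.PFilter P) : Set P) ≠ Set.univ := by
    intro hu
    have hb : (⊥ : P) ∈ ((hG.toPFilter : Order.PFilter P) : Set P) := by
      rw [hu]; exact Set.mem_univ _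
    obtain ⟨f, hf, hfp⟩ := hb
    refine h.2 (Order.PFilter.mem_of_le ?_ hf)
    exact le_compl_iff_disjoint_right.2 (disjoint_iff_inf_le.2 hfp)
  have hle : F.1 ≤ hG.toPFilter := fun f hf => ⟨f, hf, inf_le_left⟩
  have hp : p ∈ hG.toPFilter := ⟨⊤, F.1.top_mem, inf_le_right⟩
  exact h.1 (F.2.le_of_ge hne hle hp)

theorem compl_mem_iff {F : UltrafilterSpace P} {p : P} : pᶜ ∈ F.1 ↔ p ∉ F.1 := by
  constructor
  · intro h h'
    have := Order.PFilter.inf_mem h' h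
    rw [inf_compl_self] at this
    exact bot_notMem F this
  · exact (mem_or_compl_mem F p).resolve_left

/-- A prime ideal avoiding `p` exists; the complements of its elements form the ultrafilter. -/
theorem exists_mem {p : P} (hp : p ≠ ⊥) : ∃ F : UltrafilterSpace P, p ∈ F.1 := by
  have hd : Disjoint ((Order.PFilter.principal p : Order.PFilter P) : Set P)
      ((Order.Ideal.principal ⊥ : Order.Ideal P) : Set P) := by
    rw [Set.disjoint_left]
    intro x hx hx'
    exact hp (le_bot_iff.1 (le_trans (Order.PFilter.mem_principal.1 hx)
      (Order.Ideal.mem_principal.1 hx')))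
  obtain ⟨J, hJ, -, hdJ⟩ := DistribLattice.prime_ideal_of_disjoint_filter_ideal hd
  have hpJ : p ∉ J := Set.disjoint_left.1 hdJ (Order.PFilter.mem_principal.2 le_rfl)
  have hor : ∀ q : P, q ∈ J ∨ qᶜ ∈ J := fun q =>
    hJ.mem_or_mem (by rw [inf_compl_self]; exact J.bot_mem)
  have hnot : ∀ q : P, q ∈ J → qᶜ ∉ J := fun q h1 h2 => by
    have := J.sup_mem h1 h2
    rw [sup_compl_eq_top] at this
    exact hpJ (J.lower le_top this)
  have hF : Order.IsPFilter {q : P | qᶜ ∈ J} := isPFilter_of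
    (by change (⊤ : P)ᶜ ∈ J; rw [compl_top]; exact J.bot_mem)
    (fun x hx y hy => by change (x ⊓ y)ᶜ ∈ J; rw [compl_inf]; exact J.sup_mem hx hy)
    (fun x y hxy hx => J.lower (compl_le_compl hxy) hx)
  refine ⟨⟨hF.toPFilter, maximal_of ?_ ?_⟩, ?_⟩
  · intro (h : (⊥ : P)ᶜ ∈ J)
    rw [compl_bot] at h
    exact hpJ (J.lower le_top h)
  · intro q
    rcases hor q with h | h
    · exact Or.inr (show qᶜᶜ ∈ J by rwa [compl_compl])
    · exact Or.inl h
  · exact (hor p).resolve_left hpJ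

theorem basicSet_inf (p q : P) : basicSet (p ⊓ q) = basicSet p ∩ basicSet q := by
  ext F
  exact Order.PFilter.inf_mem_iff

theorem basicSet_compl (p : P) : basicSet pᶜ = (basicSet p)ᶜ := by
  ext F
  exact compl_mem_iff

theorem basicSet_top : basicSet (⊤ : P) = Set.univ :=
  Set.eq_univ_of_forall fun F => F.1.top_mem

theorem basicSet_bot : basicSet (⊥ : P) = ∅ :=
  Set.eq_empty_of_forall_notMem fun F => bot_notMem F

theorem basicSet_mono {p q : P} (h : p ≤ q) : basicSet p ⊆ basicSet q := fun _ hF =>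
  Order.PFilter.mem_of_le h hF

theorem basicSet_sup (p q : P) : basicSet (p ⊔ q) = basicSet p ∪ basicSet q := by
  rw [← compl_compl (p ⊔ q), basicSet_compl, compl_sup, basicSet_inf, basicSet_compl,
    basicSet_compl, Set.compl_inter, compl_compl, compl_compl]

theorem le_of_basicSet_subset {p q : P} (h : basicSet p ⊆ basicSet q) : p ≤ q := by
  by_contra hc
  have : p ⊓ qᶜ ≠ ⊥ := fun h0 => hc (by rwa [← sdiff_eq, sdiff_eq_bot_iff] at h0)
  obtain ⟨F, hF⟩ := exists_mem this
  have h1 := Order.PFilter.inf_mem_iff.1 hF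
  exact compl_mem_iff.1 h1.2 (h h1.1)

theorem isOpen_basicSet (p : P) : IsOpen (basicSet p) :=
  TopologicalSpace.isOpen_generateFrom_of_mem ⟨p, rfl⟩

theorem isClopen_basicSet (p : P) : IsClopen (basicSet p) :=
  ⟨⟨by rw [← basicSet_compl]; exact isOpen_basicSet _⟩, isOpen_basicSet p⟩

theorem isTopologicalBasis_basicSet :
    TopologicalSpace.IsTopologicalBasis (Set.range (basicSet : P → Set (UltrafilterSpace P))) where
  exists_subset_inter := by
    rintro _ ⟨p, rfl⟩ _ ⟨q, rfl⟩ F hF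
    exact ⟨_, ⟨p ⊓ q, rfl⟩, by rwa [basicSet_inf], by rw [basicSet_inf]⟩
  sUnion_eq := Set.eq_univ_of_forall fun F =>
    Set.mem_sUnion.2 ⟨_, ⟨⊤, rfl⟩, F.1.top_mem⟩
  eq_generateFrom := rfl

theorem exists_basicSet_subset {U : Set (UltrafilterSpace P)} (hU : IsOpen U)
    {F : UltrafilterSpace P} (hF : F ∈ U) : ∃ p : P, p ∈ F.1 ∧ basicSet p ⊆ U := by
  obtain ⟨_, ⟨p, rfl⟩, h1, h2⟩ := isTopologicalBasis_basicSet.exists_subset_of_mem_open hF hU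
  exact ⟨p, h1, h2⟩

theorem ne_bot_of_mem {F : UltrafilterSpace P} {p : P} (h : p ∈ F.1) : p ≠ ⊥ := by
  rintro rfl
  exact bot_notMem F h

/-- A basic set that meets the basic set of `sSup Q` meets that of some `q ∈ Q`, because meets
distribute over joins. This is the source of extremal disconnectedness. -/
theorem closure_iUnion_basicSet (Q : Set P) :
    closure (⋃ q ∈ Q, basicSet q) = basicSet (sSup Q) := by
  apply Set.Subset.antisymm
  · refine closure_minimal (Set.iUnion₂_subset fun q hq => basicSet_mono (le_sSup hq))
      (isClopen_basicSet _).1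
  · intro F hF
    rw [isTopologicalBasis_basicSet.mem_closure_iff]
    rintro _ ⟨p, rfl⟩ hp
    have h0 : p ⊓ sSup Q ≠ ⊥ := ne_bot_of_mem (Order.PFilter.inf_mem hp hF)
    rw [inf_sSup_eq] at h0
    have : ∃ q ∈ Q, p ⊓ q ≠ ⊥ := by
      by_contra! hc
      exact h0 (by simpa using hc)
    obtain ⟨q, hq, hpq⟩ := this
    obtain ⟨G, hG⟩ := exists_mem hpq
    rw [Order.PFilter.inf_mem_iff] at hG
    exact ⟨G, hG.1, Set.mem_biUnion hq hG.2⟩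

theorem isCompleteBooleanSpace : IsCompleteBooleanSpace (UltrafilterSpace P) := by
  refine ⟨⟨?_⟩, ⟨?_⟩, ⟨?_⟩⟩
  · rw [isCompact_iff_ultrafilter_le_nhds]
    intro U _
    -- The limit of the ultrafilter `U` on the space is the trace of `U` on the basic sets.
    have hF : Order.IsPFilter {p : P | basicSet p ∈ U} := isPFilter_of
      (by change basicSet ⊤ ∈ U; rw [basicSet_top]; exact Filter.univ_mem)
      (fun x hx y hy => by
        change basicSet (x ⊓ y) ∈ U; rw [basicSet_inf]; exact Filter.inter_mem hx hy)
      (fun x y hxy hx => Filter.mem_of_superset hx (basicSet_mono hxy))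
    refine ⟨⟨hF.toPFilter, maximal_of ?_ ?_⟩, trivial, ?_⟩
    · intro h
      have h' : basicSet ⊥ ∈ U := h
      rw [basicSet_bot] at h'
      exact Filter.empty_notMem _ h'
    · intro p
      rcases Ultrafilter.mem_or_compl_mem U (basicSet p) with h | h
      · exact Or.inl h
      · exact Or.inr (show basicSet pᶜ ∈ U by rwa [basicSet_compl])
    · refine le_of_le_of_eq ?_ (TopologicalSpace.nhds_generateFrom).symm
      refine le_iInf₂ fun s hs => ?_
      obtain ⟨h1, p, rfl⟩ := hs
      exact Filter.le_principal_iff.2 h1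
  · intro F G hFG
    have : ∃ p, p ∈ F.1 ∧ p ∉ G.1 := by
      by_contra! hc
      exact hFG (Subtype.ext (le_antisymm hc (F.2.le_of_ge G.2.prop hc)))
    obtain ⟨p, h1, h2⟩ := this
    refine ⟨basicSet p, basicSet pᶜ, isOpen_basicSet _, isOpen_basicSet _, h1,
      compl_mem_iff.2 h2, ?_⟩
    rw [basicSet_compl]
    exact disjoint_compl_right
  · intro U hU
    have : U = ⋃ q ∈ {q : P | basicSet q ⊆ U}, basicSet q := by
      apply Set.Subset.antisymm
      · intro F hF
        obtain ⟨p, h1, h2⟩ := exists_basicSet_subset hU hF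
        exact Set.mem_biUnion (show p ∈ {q : P | basicSet q ⊆ U} from h2) h1
      · exact Set.iUnion₂_subset fun q hq => hq
    rw [this, closure_iUnion_basicSet]
    exact isOpen_basicSet _

theorem isClopenDecomposition {p q r : P} (hpq : Disjoint p q) (hpr : Disjoint p r)
    (hqr : Disjoint q r) (h : p ⊔ q ⊔ r = ⊤) :
    IsClopenDecomposition (basicSet p) (basicSet q) (basicSet r) := by
  have hd : ∀ {p q : P}, Disjoint p q → Disjoint (basicSet p) (basicSet q) := fun {p q} h => by
    rw [Set.disjoint_iff_inter_eq_empty, ← basicSet_inf, h.eq_bot, basicSet_bot]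
  exact ⟨isClopen_basicSet _, isClopen_basicSet _, isClopen_basicSet _, hd hpq, hd hpr, hd hqr,
    by rw [← basicSet_sup, ← basicSet_sup, h, basicSet_top]⟩

end UltrafilterSpace

namespace PartialCommMonoid.Projection

variable (S : Type u) [PartialCommMonoid S] [hS : Fact (IsContinuousDimensionScale S)]

theorem isCompleteBooleanAlgebra : IsCompleteBooleanAlgebra (Projection S) :=
  ⟨inferInstance, fun _ _ => Iff.rfl⟩

theorem isCompleteBooleanSpace_ultrafilterSpace :
    IsCompleteBooleanSpace (UltrafilterSpace (Projection S)) :=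
  UltrafilterSpace.isCompleteBooleanSpace (P := Projection S)

end PartialCommMonoid.Projection

/-! ### Directly finite and purely infinite elements: cancellation, splitting, alephs. -/

namespace PartialCommMonoid

namespace Tot

open Projection

section Defs

variable {S : Type u} [PartialCommMonoid S]

/-- Direct finiteness in `Tot S`. -/
def DFin (x : Tot S) : Prop := ∀ z, z + x = x → z = 0

/-- Pure infiniteness in `Tot S`. -/
def PInf (x : Tot S) : Prop := x + x = x

theorem dfin_of {a : S} : DFin (of a) ↔ DirectlyFinite a := by
  constructor
  · intro h x hx
    exact of_injective (h (of x) (of_add_of_eq_of.2 hx))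
  · intro h z hz
    obtain ⟨x, a', rfl, h', hx⟩ := add_eq_of.1 hz
    rw [← of_injective h'] at hx
    exact congrArg of (h x hx)

theorem pinf_of {a : S} : PInf (of a) ↔ PurelyInfinite a := of_add_of_eq_of

end Defs

variable {S : Type u} [PartialCommMonoid S] [hS : Fact (IsContinuousDimensionScale S)]

/-- Multiple-freeness in `Tot S`. -/
def MFree (x : Tot S) : Prop := ∀ z, z + z ≤ x → z = 0

theorem mfree_of {a : S} : MFree (of a) ↔ MultipleFree a := by
  constructor
  · intro h x s hs hsa
    exact of_injective (h (of x) (by rw [of_add_of_eq_of.2 hs]; exact of_le_of.2 hsa))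
  · intro h z hz
    obtain ⟨s, hs⟩ := exists_of (ne_top_of_le hz (of_ne_top a))
    obtain ⟨x, x', rfl, h', hx⟩ := add_eq_of.1 hs
    rw [← of_injective h'] at hx
    rw [hs] at hz
    exact congrArg of (h x s hx (of_le_of.1 hz))

theorem DFin.ne_top {x : Tot S} (h : DFin x) : x ≠ ⊤ := by
  rintro rfl
  exact zero_ne_top (h ⊤ (add_top ⊤)).symm

theorem dfin_zero : DFin (0 : Tot S) := fun z hz => by rwa [add_zero] at hz

theorem pinf_zero : PInf (0 : Tot S) := add_zero 0

theorem DFin.of_le {x y : Tot S} (hy : DFin y) (h : x ≤ y) : DFin x := by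
  obtain ⟨w, rfl⟩ := h
  intro z hz
  exact hy z (by rw [← add_assoc, hz])

theorem DFin.psmul {x : Tot S} (h : DFin x) (p : Projection S) : DFin (p • x) :=
  h.of_le (psmul_le _ _)

theorem PInf.psmul {x : Tot S} (h : PInf x) (hx : x ≠ ⊤) (p : Projection S) : PInf (p • x) := by
  have h' : x + x = x := h
  change p • x + p • x = p • x
  rw [← psmul_add p (by rwa [h']), h']

theorem PInf.of_psmul {x : Tot S} (p : Projection S) (h1 : PInf (p • x)) (h2 : PInf (pᶜ • x)) :
    PInf x :=
  (eq_add_of_psmul p h1.symm h2.symm).symm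

theorem PInf.eq_zero_of_dfin {x : Tot S} (h : PInf x) (h' : DFin x) : x = 0 := h' x h

theorem PInf.add_of_le {x a : Tot S} (h : PInf a) (hx : x ≤ a) : x + a = a :=
  le_antisymm ((add_le_add_left hx a).trans h.le) le_add_self

/-- On a part where `b = a + d`, the difference `d` is absorbed by `c` and hence vanishes;
comparability covers the whole by two such parts. -/
theorem DFin.eq_of_add_eq {a b c f : Tot S} (hc : DFin c) (ha : a + f = c) (hb : b + f = c) :
    a = b := by
  have hct := hc.ne_top
  have key : ∀ a b : Tot S, a + f = c → b + f = c → ∀ p : Projection S, p • a ≤ p • b →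
      p • a = p • b := by
    intro a b ha hb p hp
    obtain ⟨d, hd⟩ := hp
    have h1 : p • c = p • a + p • f := by rw [← ha, psmul_add]; rwa [ha]
    have h2 : p • c = p • b + p • f := by rw [← hb, psmul_add]; rwa [hb]
    have h3 : d + p • c = p • c := by
      conv_rhs => rw [h2, hd]
      rw [h1]; abel
    rw [hd, hc.psmul p d h3, add_zero]
  obtain ⟨p, h1, h2⟩ := exists_comparable (left_ne_top (ha ▸ hct)) (left_ne_top (hb ▸ hct))
  exact eq_of_psmul p (key a b ha hb p h1) (key b a hb ha pᶜ h2).symm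

/-- Only the cancelled term need be directly finite: after refinement the off-diagonal entries are
two complements of the same element in `g`, to which the preceding lemma applies. -/
theorem DFin.add_right_cancel {a b g : Tot S} (hg : DFin g) (h : a + g = b + g)
    (ht : a + g ≠ ⊤) : a = b := by
  obtain ⟨x, y, z, w, rfl, h2, rfl, h4⟩ := refinement h ht
  have : z = y := hg.eq_of_add_eq h2.symm h4.symm
  rw [this]

theorem DFin.le_of_add_le_add_right {a b g : Tot S} (hg : DFin g) (h : a + g ≤ b + g)
    (ht : b + g ≠ ⊤) : a ≤ b := by
  obtain ⟨z, hz⟩ := h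
  have : b = a + z := hg.add_right_cancel (hz.trans (add_right_comm _ _ _)) ht
  exact ⟨z, this⟩

theorem DFin.add {f g : Tot S} (hf : DFin f) (hg : DFin g) (ht : f + g ≠ ⊤) : DFin (f + g) := by
  intro z hz
  rw [← add_assoc] at hz
  exact hf z (hg.add_right_cancel hz (by rwa [hz]))

theorem DFin.nsmul {x : Tot S} (hx : DFin x) {n : ℕ} (h : n • x ≠ ⊤) : DFin (n • x) := by
  induction n with
  | zero => rw [zero_nsmul]; exact dfin_zero
  | succ n ih =>
    rw [succ_nsmul] at h ⊢
    exact (ih (left_ne_top h)).add hx h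

/-- Write `x = b + c` by (M5), with `b` directly finite and `c` purely infinite, and compare `c`
with `b`. Where `c ≤ b`, adding `c` does not change `b`, so `c` vanishes; where `b ≤ c`, the element
`b` is absorbed. -/
theorem exists_dfin_pinf {x : Tot S} (hx : x ≠ ⊤) :
    ∃ p : Projection S, DFin (p • x) ∧ PInf (pᶜ • x) := by
  obtain ⟨a, rfl⟩ := exists_of hx
  obtain ⟨b, c, hb, hc, h⟩ := hS.out.decomp a
  have hb' := dfin_of.2 hb
  have hc' := pinf_of.2 hc
  have h' := of_add_of_eq_of.2 h
  have hsum : ∀ p : Projection S, p • of a = p • of b + p • of c := fun p => by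
    rw [← h', psmul_add]; rw [h']; exact hx
  obtain ⟨p, h1, h2⟩ := exists_comparable (of_ne_top c) (of_ne_top b)
  refine ⟨p, ?_, ?_⟩
  · obtain ⟨d, hd⟩ := h1
    have h0 : p • of c = 0 := hb'.psmul p _ (by
      rw [hd, ← add_assoc, show p • of c + p • of c = p • of c from hc'.psmul (of_ne_top c) p])
    rw [hsum, h0, add_zero]
    exact hb'.psmul p
  · rw [hsum, (hc'.psmul (of_ne_top c) pᶜ).add_of_le h2]
    exact hc'.psmul (of_ne_top c) pᶜ

/-- Where `y` is directly finite, so is `x + y`, and `a` vanishes there; where `y` is purely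
infinite, it absorbs `x`. -/
theorem PInf.le_of_le_add {a x y : Tot S} (ha : PInf a) (h : a ≤ x + y) (hxy : x ≤ y)
    (ht : x + y ≠ ⊤) : a ≤ y := by
  have hat := ne_top_of_le h ht
  obtain ⟨p, h1, h2⟩ := exists_dfin_pinf (right_ne_top ht)
  refine le_of_psmul p ?_ ?_
  · have h3 : DFin (p • (x + y)) := by
      rw [psmul_add p ht]
      refine (h1.of_le (psmul_mono _ hxy)).add h1 ?_
      rw [← psmul_add p ht]; exact psmul_ne_top ht
    rw [(ha.psmul hat p).eq_zero_of_dfin (h3.of_le (psmul_mono p h))]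
    exact zero_le' _
  · have := psmul_mono pᶜ h
    rwa [psmul_add _ ht, h2.add_of_le (psmul_mono _ hxy)] at this

theorem add_eq_zero_left {x y : Tot S} (h : x + y = 0) : x = 0 :=
  le_antisymm (le_self_add.trans h.le) (zero_le' x)

/-- The Archimedean property comes from completeness: the supremum `s` of the multiples of `e`
satisfies `s = e + s`, and `s` is directly finite. -/
theorem DFin.eq_zero_of_forall_nsmul_le {x e : Tot S} (hx : DFin x) (h : ∀ n : ℕ, n • e ≤ x) :
    e = 0 := by
  set s : Tot S := ⨆ n : ℕ, n • e
  have hs : s ≤ x := iSup_le h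
  have hle : ∀ n : ℕ, n • e ≤ s := le_iSup (fun n : ℕ => n • e)
  have he : e ≤ s := by simpa using hle 1
  obtain ⟨s', hs'⟩ := he
  have heF : DFin e := hx.of_le (by simpa using h 1)
  have hst : s ≠ ⊤ := ne_top_of_le hs hx.ne_top
  have h1 : s ≤ s' := iSup_le fun n => by
    refine heF.le_of_add_le_add_right ?_ (by rw [add_comm, ← hs']; exact hst)
    rw [← succ_nsmul, add_comm s', ← hs']
    exact hle _
  have h2 : s' = s := le_antisymm (by rw [hs']; exact le_add_self) h1
  rw [h2] at hs'
  exact hx.of_le hs e hs'.symm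

theorem DFin.eq_of_nsmul_eq {s t : Tot S} {n : ℕ} (hn : n ≠ 0) (hs : DFin s) (ht : DFin t)
    (h : n • s = n • t) (hne : n • s ≠ ⊤) : s = t := by
  have key : ∀ s t : Tot S, DFin s → n • s = n • t → n • s ≠ ⊤ → ∀ p : Projection S,
      p • s ≤ p • t → p • s = p • t := by
    intro s t hs h hne p hp
    obtain ⟨d, hd⟩ := hp
    have h1 : n • (p • s) = n • (p • t) := by
      rw [← psmul_nsmul p n hne, h, psmul_nsmul p n (by rwa [← h])]
    have h2 : n • d + n • (p • s) = n • (p • s) := by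
      conv_rhs => rw [h1, hd, nsmul_add]
      exact add_comm _ _
    have h3 : n • d = 0 := (hs.psmul p).nsmul (by
      rw [← psmul_nsmul p n hne]; exact psmul_ne_top hne) _ h2
    have h4 : d = 0 := by
      obtain ⟨m, rfl⟩ := Nat.exists_eq_succ_of_ne_zero hn
      rw [succ_nsmul, add_comm] at h3
      exact add_eq_zero_left h3
    rw [hd, h4, add_zero]
  obtain ⟨p, h1, h2⟩ := exists_comparable hs.ne_top ht.ne_top
  exact eq_of_psmul p (key s t hs h hne p h1) (key t s ht h.symm (h ▸ hne) pᶜ h2).symm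

/-! ### The relation corresponding to removability -/

/-- `a ≤ b`, and `a` and `b` agree on no part where `b` does not vanish. -/
def MuchLess (a b : Tot S) : Prop := a ≤ b ∧ ∀ p : Projection S, p • a = p • b → p • b = 0

/-- If `a` and `b` agree on `p`, then `b ≤ a + pᶜ • b`, and removing `a` shows that `b` vanishes on
`p`. Conversely, given `b ≤ a + x`, compare `a` with `x`: where `a ≤ x` one gets `b ≤ x`, and where
`x ≤ a` one gets `b ≤ a`, so that `b` vanishes there. -/
theorem removable_iff {a b : S} (ha : PurelyInfinite a) (hb : PurelyInfinite b) :
    Removable a b ↔ MuchLess (of a) (of b) := by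
  have ha' := pinf_of.2 ha
  have hb' := pinf_of.2 hb
  constructor
  · rintro ⟨h1, h2⟩
    refine ⟨of_le_of.2 h1, fun p hp => ?_⟩
    have h3 : of a + pᶜ • of b ≤ of b := by
      have := add_le_add (of_le_of.2 h1) (psmul_le pᶜ (of b))
      exact this.trans (le_of_eq hb')
    obtain ⟨s, hs⟩ := exists_of (ne_top_of_le h3 (of_ne_top b))
    have h4 : of b ≤ of s := by
      rw [← hs]
      conv_lhs => rw [← psmul_add_compl_psmul p (of b), ← hp]
      exact add_le_add_left (psmul_le _ _) _
    have h5 := h2 (pᶜ b) s (of_add_of_eq_of.1 hs) (of_le_of.1 h4)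
    have h6 : of b ≤ pᶜ • of b := of_le_of.2 h5
    have h7 := psmul_mono p h6
    rw [psmul_compl_psmul _ (of_ne_top b)] at h7
    exact le_antisymm h7 (zero_le' _)
  · rintro ⟨h1, h2⟩
    refine ⟨of_le_of.1 h1, fun x s hs hbs => ?_⟩
    have hs' := of_add_of_eq_of.2 hs
    have hbs' : of b ≤ of a + of x := by rw [hs']; exact of_le_of.2 hbs
    have ht : of a + of x ≠ ⊤ := by rw [hs']; exact of_ne_top s
    have hle : ∀ p : Projection S, p • of b ≤ p • of a + p • of x := fun p => by
      rw [← psmul_add p ht]; exact psmul_mono p hbs'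
    have hnt : ∀ p : Projection S, p • of a + p • of x ≠ ⊤ := fun p => by
      rw [← psmul_add p ht]; exact psmul_ne_top ht
    obtain ⟨p, hp1, hp2⟩ := exists_comparable (of_ne_top a) (of_ne_top x)
    refine of_le_of.1 (le_of_psmul p ?_ ?_)
    · exact (hb'.psmul (of_ne_top b) p).le_of_le_add (hle p) hp1 (hnt p)
    · have h3 : pᶜ • of b ≤ pᶜ • of a :=
        (hb'.psmul (of_ne_top b) pᶜ).le_of_le_add (by rw [add_comm]; exact hle pᶜ) hp2
          (by rw [add_comm]; exact hnt pᶜ)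
      rw [h2 pᶜ (le_antisymm (psmul_mono _ h1) h3)]
      exact zero_le' _

theorem MuchLess.mono_right {a b c : Tot S} (h : MuchLess a b) (hbc : b ≤ c) (hc : c ≠ ⊤)
    (hs : supp c ≤ supp b) : MuchLess a c := by
  refine ⟨h.1.trans hbc, fun p hp => ?_⟩
  have h1 : p • a = p • b :=
    le_antisymm (psmul_mono p h.1) ((psmul_mono p hbc).trans hp.symm.le)
  have h2 := h.2 p h1
  rw [psmul_eq_zero_iff (ne_top_of_le hbc hc)] at h2
  rw [psmul_eq_zero_iff hc]
  exact le_bot_iff.1 ((inf_le_inf_left p hs).trans h2.le)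

theorem MuchLess.of_psmul {a b : Tot S} (p : Projection S) (h1 : MuchLess (p • a) (p • b))
    (h2 : MuchLess (pᶜ • a) (pᶜ • b)) : MuchLess a b := by
  refine ⟨le_of_psmul p h1.1 h2.1, fun q hq => eq_of_psmul p ?_ ?_⟩
  · rw [psmul_comm, h1.2 q (by rw [psmul_comm, hq, psmul_comm]), psmul_zero]
  · rw [psmul_comm, h2.2 q (by rw [psmul_comm, hq, psmul_comm]), psmul_zero]

theorem muchLess_zero (b : Tot S) : MuchLess 0 b :=
  ⟨zero_le' b, fun p h => by rw [← h, psmul_zero]⟩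

/-- Axiom (M6), rephrased with supports and `MuchLess`. -/
theorem exists_least_muchLess {a b : Tot S} (ha : PInf a) (hb : PInf b) (hbt : b ≠ ⊤)
    (hab : MuchLess a b) :
    ∃ m, PInf m ∧ MuchLess a m ∧ supp m = supp b ∧
      ∀ x, x ≠ ⊤ → PInf x → MuchLess a x → supp x = supp b → m ≤ x := by
  obtain ⟨b, rfl⟩ := exists_of hbt
  obtain ⟨a, rfl⟩ := exists_of (ne_top_of_le hab.1 hbt)
  have ha' := pinf_of.1 ha
  obtain ⟨m, ⟨hm1, hm2, hm3⟩, hm⟩ := hS.out.exists_least a b ha' (pinf_of.1 hb)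
    ((removable_iff ha' (pinf_of.1 hb)).2 hab)
  refine ⟨of m, pinf_of.2 hm1, (removable_iff ha' hm1).1 hm2, perp_singleton_eq_iff.1 hm3, ?_⟩
  intro x hx h1 h2 h3
  obtain ⟨x, rfl⟩ := exists_of hx
  exact of_le_of.2 (hm x ⟨pinf_of.1 h1, (removable_iff ha' (pinf_of.1 h1)).2 h2,
    perp_singleton_eq_iff.2 h3⟩)

/-! ### The elements that represent the alephs -/

/-- `t` is the element with support `q` that represents `ℵ_ξ` on `q`. -/
def IsAleph (ξ : Ordinal.{u}) (q : Projection S) (t : Tot S) : Prop :=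
  IsLeast {x : Tot S | x ≠ ⊤ ∧ PInf x ∧ supp x = q ∧ ∀ η, ∀ _ : η < ξ, ∀ p ≤ q, ∀ s,
    IsAleph η p s → MuchLess s (p • x)} t
termination_by ξ

/-- The purely infinite elements with support `q` that are larger than all `ℵ_η` with `η < ξ`. -/
def Above (ξ : Ordinal.{u}) (q : Projection S) : Set (Tot S) :=
  {x : Tot S | x ≠ ⊤ ∧ PInf x ∧ supp x = q ∧ ∀ η, ∀ _ : η < ξ, ∀ p ≤ q, ∀ s,
    IsAleph η p s → MuchLess s (p • x)}

theorem isAleph_iff {ξ : Ordinal.{u}} {q : Projection S} {t : Tot S} :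
    IsAleph ξ q t ↔ IsLeast (Above ξ q) t := by
  rw [IsAleph]; rfl

theorem above_anti {η ξ : Ordinal.{u}} (h : η ≤ ξ) (q : Projection S) : Above ξ q ⊆ Above η q :=
  fun _ hx => ⟨hx.1, hx.2.1, hx.2.2.1, fun ζ hζ => hx.2.2.2 ζ (hζ.trans_le h)⟩

theorem IsAleph.mem {ξ : Ordinal.{u}} {q : Projection S} {t : Tot S} (h : IsAleph ξ q t) :
    t ∈ Above ξ q := (isAleph_iff.1 h).1

theorem Above.psmul {ξ : Ordinal.{u}} {q p : Projection S} {x : Tot S} (hx : x ∈ Above ξ q) :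
    p • x ∈ Above ξ (p ⊓ q) := by
  refine ⟨psmul_ne_top hx.1, hx.2.1.psmul hx.1 p, by rw [supp_psmul p hx.1, hx.2.2.1], ?_⟩
  intro η hη r hr s hs
  rw [psmul_of_le (hr.trans inf_le_left)]
  exact hx.2.2.2 η hη r (hr.trans inf_le_right) s hs

/-- The infimum `y` of the class stays in the class because minima from (M6) bound it below. The one
over `0` protects its support and its pure infiniteness; for each earlier aleph `s` on `p`, the
least `m` far above `s` protects the relation between `s` and `p • y`. -/
theorem exists_isAleph {ξ : Ordinal.{u}} {q : Projection S} {x : Tot S} (hx : x ∈ Above ξ q) :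
    ∃ t, IsAleph ξ q t := by
  set y := sInf (Above ξ q)
  have hyx : ∀ z ∈ Above ξ q, y ≤ z := fun z hz => sInf_le hz
  have hyt : y ≠ ⊤ := ne_top_of_le (hyx x hx) hx.1
  obtain ⟨z, hz1, -, hz3, hz⟩ := exists_least_muchLess pinf_zero hx.2.1 hx.1 (muchLess_zero x)
  have hzy : z ≤ y := le_sInf fun w hw => hz w hw.1 hw.2.1 (muchLess_zero w) (by
    rw [hw.2.2.1, hx.2.2.1])
  have hzt := ne_top_of_le hzy hyt
  have hys : supp y = q := by
    apply le_antisymm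
    · exact (supp_mono (hyx x hx) hx.1).trans hx.2.2.1.le
    · rw [← hx.2.2.1, ← hz3]
      exact supp_mono hzy hyt
  have hyP : PInf y := by
    obtain ⟨p, h1, h2⟩ := exists_dfin_pinf hyt
    refine PInf.of_psmul p ?_ h2
    have h3 : p • z = 0 :=
      (hz1.psmul hzt p).eq_zero_of_dfin (h1.of_le (psmul_mono p hzy))
    have h4 : p • y = 0 := by
      rw [psmul_eq_zero_iff hzt, hz3, hx.2.2.1] at h3
      rw [psmul_eq_zero_iff hyt, hys, h3]
    rw [h4]
    exact pinf_zero
  refine ⟨y, isAleph_iff.2 ⟨⟨hyt, hyP, hys, ?_⟩, fun w hw => hyx w hw⟩⟩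
  intro η hη p hp s hs
  have hsm := hs.mem
  obtain ⟨m, hm1, hm2, hm3, hm⟩ := exists_least_muchLess hsm.2.1 (hx.2.1.psmul hx.1 p)
    (psmul_ne_top hx.1) (hx.2.2.2 η hη p hp s hs)
  rw [supp_psmul p hx.1, hx.2.2.1, inf_eq_left.2 hp] at hm3 hm
  have hmy : m ≤ y := le_sInf fun w hw =>
    (hm (p • w) (psmul_ne_top hw.1) (hw.2.1.psmul hw.1 p) (hw.2.2.2 η hη p hp s hs) (by
      rw [supp_psmul p hw.1, hw.2.2.1, inf_eq_left.2 hp])).trans (psmul_le _ _)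
  refine hm2.mono_right (c := p • y) ?_ (psmul_ne_top hyt) ?_
  · rw [← supp_psmul_self m, hm3]
    exact psmul_mono p hmy
  · rw [supp_psmul p hyt, hm3]
    exact inf_le_left

/-- Minimality is local: a competitor on `p ⊓ q` that were smaller somewhere could be patched into
`t` and would contradict the minimality of `t`. The induction restricts the earlier alephs to the
two pieces of the patch. -/
theorem IsAleph.psmul {ξ : Ordinal.{u}} {q : Projection S} {t : Tot S} (h : IsAleph ξ q t)
    (p : Projection S) : IsAleph ξ (p ⊓ q) (p • t) := by
  induction ξ using WellFoundedLT.induction generalizing q t p with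
  | ind ξ ih =>
  have htm := h.mem
  refine isAleph_iff.2 ⟨Above.psmul htm, fun x hx => ?_⟩
  obtain ⟨r, hr1, hr2⟩ := exists_comparable hx.1 (psmul_ne_top (p := p) htm.1)
  refine le_of_psmul r ?_ hr2
  have hpx : p • x = x := supp_le_iff.1 (hx.2.2.1.le.trans inf_le_left)
  set w := r ⊓ p
  have hwx : w • x ≤ w • t := by
    rw [inf_psmul, inf_psmul, hpx]
    exact hr1
  -- The patched competitor: `x` on the part `w`, where it lies below `t`, and `t` elsewhere.
  set x' := w • x + wᶜ • t
  have hx't : x' ≤ t := by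
    conv_rhs => rw [← psmul_add_compl_psmul w t]
    exact add_le_add_left hwx _
  have hx'top : x' ≠ ⊤ := ne_top_of_le hx't htm.1
  have e1 : w • x' = w • x := by
    rw [psmul_add _ hx'top, psmul_idem, psmul_compl_psmul _ htm.1, add_zero]
  have e2 : wᶜ • x' = wᶜ • t := by
    rw [psmul_add _ hx'top, psmul_idem, compl_psmul_psmul _ hx.1, zero_add]
  have hmem : x' ∈ Above ξ q := by
    refine ⟨hx'top, PInf.of_psmul w (e1 ▸ hx.2.1.psmul hx.1 w) (e2 ▸ htm.2.1.psmul htm.1 _),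
      ?_, ?_⟩
    · rw [supp_add hx'top, supp_psmul _ hx.1, supp_psmul _ htm.1, hx.2.2.1, htm.2.2.1,
        ← inf_assoc, inf_eq_left.2 (show w ≤ p from inf_le_right), ← inf_sup_right,
        sup_compl_eq_top, top_inf_eq]
    · intro η hη p' hp' s hs
      refine MuchLess.of_psmul w ?_ ?_
      · rw [psmul_comm, e1, ← inf_psmul, inf_comm]
        exact hx.2.2.2 η hη _ (inf_le_inf inf_le_right hp') _ (ih η hη hs w)
      · rw [psmul_comm, e2, ← inf_psmul, inf_comm]
        exact htm.2.2.2 η hη _ (inf_le_right.trans hp') _ (ih η hη hs wᶜ)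
  have h1 := psmul_mono w ((isAleph_iff.1 h).2 hmem)
  rw [e1] at h1
  calc r • p • t = w • t := (inf_psmul _ _ _).symm
    _ ≤ w • x := h1
    _ = r • x := by rw [inf_psmul, hpx]

theorem IsAleph.le {η ξ : Ordinal.{u}} {q : Projection S} {s t : Tot S} (hs : IsAleph η q s)
    (ht : IsAleph ξ q t) (h : η ≤ ξ) : s ≤ t :=
  (isAleph_iff.1 hs).2 (above_anti h q ht.mem)

theorem IsAleph.eq_bot_of_le {η ξ : Ordinal.{u}} {q : Projection S} {s t : Tot S}
    (hs : IsAleph η q s) (ht : IsAleph ξ q t) (h : η < ξ) (hts : t ≤ s) : q = ⊥ := by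
  have h1 := ht.mem.2.2.2 η h q le_rfl s hs
  have hqt : q • t = t := by
    have := supp_psmul_self t
    rwa [ht.mem.2.2.1] at this
  rw [hqt] at h1
  have h2 := h1.2 ⊤ (by rw [top_psmul, top_psmul]; exact le_antisymm h1.1 hts)
  rw [top_psmul] at h2
  rw [← ht.mem.2.2.1, h2, supp_zero]

/-- An aleph determines its support, and on a nonzero support alephs of different index differ. So
the occurring indices inject into `Tot S`, form a small set and are bounded. -/
theorem bddAbove_isAleph : ∃ γ : Ordinal.{u}, ∀ (ξ : Ordinal.{u}) (q : Projection S) (t : Tot S),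
    IsAleph ξ q t → q ≠ ⊥ → ξ ≤ γ := by
  set Ξ : Set Ordinal.{u} := {ξ | ∃ (q : Projection S) (t : Tot S), IsAleph ξ q t ∧ q ≠ ⊥}
  have hc : ∀ ξ : Ξ, ∃ t : Tot S, ∃ q : Projection S, IsAleph ξ.1 q t ∧ q ≠ ⊥ := by
    rintro ⟨ξ, q, t, h⟩
    exact ⟨t, q, h⟩
  choose f g hf hg using hc
  have hinj : Function.Injective f := by
    intro ξ η h
    have hq : g ξ = g η := by rw [← (hf ξ).mem.2.2.1, ← (hf η).mem.2.2.1, h]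
    have key : ∀ ξ η : Ξ, g ξ = g η → f ξ = f η → ¬ ξ.1 < η.1 := by
      intro ξ η hq h hlt
      refine hg η ((hq ▸ hf ξ).eq_bot_of_le (hf η) hlt h.ge)
    exact Subtype.ext (le_antisymm (not_lt.1 (key η ξ hq.symm h.symm)) (not_lt.1 (key ξ η hq h)))
  have : Small.{u} Ξ := small_of_injective hinj
  obtain ⟨γ, hγ⟩ : BddAbove Ξ := Ordinal.bddAbove_of_small
  exact ⟨γ, fun ξ q t h hq => hγ ⟨q, t, h, hq⟩⟩

/-- If no nonzero part of `y` were an aleph, then by induction `y` would lie strictly above all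
alephs on every part, and an aleph of index beyond the bound `γ` would exist. -/
theorem exists_isAleph_psmul {y : Tot S} (hy : PInf y) (hyt : y ≠ ⊤) (hy0 : y ≠ 0) :
    ∃ (ξ : Ordinal.{u}) (r : Projection S), r ≤ supp y ∧ r ≠ ⊥ ∧ IsAleph ξ r (r • y) := by
  by_contra! hc
  have hA : ∀ ξ : Ordinal.{u}, y ∈ Above ξ (supp y) := by
    intro ξ
    induction ξ using WellFoundedLT.induction with
    | ind ξ ih =>
    refine ⟨hyt, hy, rfl, fun η hη p hp s hs => ?_⟩
    have h1 := Above.psmul (p := p) (ih η hη)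
    rw [inf_eq_left.2 hp] at h1
    refine ⟨(isAleph_iff.1 hs).2 h1, fun p' hp' => ?_⟩
    have h2 := hs.psmul p'
    rw [hp', ← inf_psmul] at h2
    by_contra hne
    refine hc η (p' ⊓ p) (inf_le_right.trans hp) (fun h0 => hne ?_) h2
    rw [← inf_psmul, h0, bot_psmul hyt]
  obtain ⟨γ, hγ⟩ := bddAbove_isAleph (S := S)
  obtain ⟨t, ht⟩ := exists_isAleph (hA (Order.succ γ))
  exact absurd (hγ _ _ _ ht (fun h => hy0 ((supp_eq_bot hyt).1 h))) (not_le.2 (Order.lt_succ γ))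

end Tot

end PartialCommMonoid

/-! ### Unit systems and the values of elements at ultrafilters. -/

namespace PartialCommMonoid

open Projection

/-- A system of units: `A c q t` says that `t` represents the constant function with value `c` on
the part `q`. The values of the units form the set `D`, and the projection `base` carries all
nonzero units. -/
structure UnitSystem (S : Type u) [PartialCommMonoid S] [Fact (IsContinuousDimensionScale S)]
    (K : Type v) [LinearOrder K] [AddCommMonoid K] where
  /-- The projection that carries the units. -/
  base : Projection S
  /-- The values of the units. -/
  D : Set K
  /-- The units. -/
  A : K → Projection S → Tot S → Prop
  mem_D : ∀ {c q t}, A c q t → c ∈ D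
  ne_top : ∀ {c q t}, A c q t → t ≠ ⊤
  fixed : ∀ {c q t}, A c q t → q • t = t
  psmul : ∀ {c q t} (p : Projection S), A c q t → A c (p ⊓ q) (p • t)
  zero : ∀ q, A 0 q 0
  le_base : ∀ {c q t}, A c q t → 0 < c → q ≤ base
  le : ∀ {c d q t s}, A c q t → A d q s → c ≤ d → t ≤ s
  eq_bot : ∀ {c d q t s}, A c q t → A d q s → c < d → s ≤ t → q = ⊥
  add : ∀ {c d q t s}, A c q t → A d q s → t + s ≠ ⊤ → A (c + d) q (t + s)
  add_eq : ∀ {c d q t s u}, A c q t → A d q s → A (c + d) q u → t + s = u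
  add_mem : ∀ {c d}, c ∈ D → d ∈ D → c + d ∈ D
  exists_of_le : ∀ {c d q s}, A d q s → q ≠ ⊥ → c ∈ D → c ≤ d →
    ∃ p ≤ q, p ≠ ⊥ ∧ ∃ t, A c p t
  dense : ∀ {a b : K}, a < b → ∃ c ∈ D, a < c ∧ c ≤ b
  -- The lower end of a jump cannot be approximated from above, so it must be a unit value itself.
  covBy : ∀ {a b : K}, a ⋖ b → a ∈ D
  -- Units detect the order: where `x ≤ y` holds nowhere, some part carries a unit below `x` whose
  -- value exceeds that of a unit above `y`.
  sep : ∀ {q x y}, q ≤ base → q ≠ ⊥ → x ≠ ⊤ → y ≠ ⊤ → NowhereLE q x y →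
    ∃ r ≤ q, r ≠ ⊥ ∧ ∃ v c t s, v < c ∧ A c r t ∧ t ≤ x ∧ A v r s ∧ r • y ≤ s
  exists_lub : ∀ s : Set K, ∃ m, IsLUB s m

namespace UnitSystem

section Order

variable {S : Type u} [PartialCommMonoid S] [hS : Fact (IsContinuousDimensionScale S)]
  {K : Type v} [LinearOrder K] [AddCommMonoid K] (E : UnitSystem S K)

/-- The largest part on which `x` is at least `c`. -/
noncomputable def ge (c : K) (x : Tot S) : Projection S := sSup {q | ∃ t, E.A c q t ∧ t ≤ x}

theorem _root_.inf_compl_ne_bot {B : Type*} [BooleanAlgebra B] {p q : B} (h : ¬ p ≤ q) :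
    p ⊓ qᶜ ≠ ⊥ := fun h0 => h (by rwa [← sdiff_eq, sdiff_eq_bot_iff] at h0)

theorem _root_.eq_bot_of_le_of_le_compl {B : Type*} [BooleanAlgebra B] {p q : B} (h : p ≤ q)
    (h' : p ≤ qᶜ) : p = ⊥ := le_bot_iff.1 ((le_inf h h').trans (inf_compl_self q).le)

variable {E}

theorem A.psmul_of_le {c : K} {p q : Projection S} {t : Tot S} (h : E.A c q t) (hp : p ≤ q) :
    E.A c p (p • t) := by
  have := E.psmul p h
  rwa [inf_eq_left.2 hp] at this

theorem le_ge {c : K} {q : Projection S} {t x : Tot S} (h : E.A c q t) (hx : t ≤ x) :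
    q ≤ E.ge c x := le_sSup ⟨t, h, hx⟩

/-- There need be no unit on all of `ge c x`, which is only a join; distributivity gives one on a
nonzero part, and that suffices in every contradiction below. -/
theorem exists_of_le_ge {c : K} {q : Projection S} {x : Tot S} (h : q ≤ E.ge c x) (hq : q ≠ ⊥) :
    ∃ p ≤ q, p ≠ ⊥ ∧ ∃ t, E.A c p t ∧ t ≤ x := by
  have h1 : q ⊓ E.ge c x ≠ ⊥ := by rwa [inf_eq_left.2 h]
  rw [ge, inf_sSup_eq] at h1
  have : ∃ r ∈ {q | ∃ t, E.A c q t ∧ t ≤ x}, q ⊓ r ≠ ⊥ := by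
    by_contra! hc
    exact h1 (by simpa using hc)
  obtain ⟨r, ⟨t, ht, htx⟩, hr⟩ := this
  exact ⟨q ⊓ r, inf_le_left, hr, q • t, E.psmul q ht, (psmul_le _ _).trans htx⟩

theorem ge_anti {c d : K} (hc : c ∈ E.D) (hcd : c ≤ d) (x : Tot S) : E.ge d x ≤ E.ge c x := by
  by_contra hn
  obtain ⟨p, hp, hp0, t, ht, htx⟩ := exists_of_le_ge (E := E) (c := d) (x := x) inf_le_left
    (inf_compl_ne_bot hn)
  obtain ⟨r, hr, hr0, s, hs⟩ := E.exists_of_le ht hp0 hc hcd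
  have hst : s ≤ x := (E.le hs (A.psmul_of_le ht hr) hcd).trans ((psmul_le _ _).trans htx)
  exact hr0 (eq_bot_of_le_of_le_compl (le_ge hs hst) ((hr.trans hp).trans inf_le_right))

theorem ge_mono (c : K) {x y : Tot S} (h : x ≤ y) : E.ge c x ≤ E.ge c y :=
  sSup_le_sSup fun _ ⟨t, ht, htx⟩ => ⟨t, ht, htx.trans h⟩

/-- Treats dense and discrete places of `K` alike. If something lies strictly between `v` and `d`,
take `a = c`; at a jump take `a = v`. Since no value above `a` is below `c`, not reaching `c` means
having value at most `a`. -/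
theorem exists_gap {v d : K} (h : v < d) :
    ∃ c ∈ E.D, ∃ a ∈ E.D, v ≤ a ∧ a < d ∧ v < c ∧ c ≤ d ∧ ∀ k, a < k → c ≤ k := by
  by_cases he : ∃ e, v < e ∧ e < d
  · obtain ⟨e, h1, h2⟩ := he
    obtain ⟨c, hc, h3, h4⟩ := E.dense h1
    exact ⟨c, hc, c, hc, h3.le, h4.trans_lt h2, h3, h4.trans h2.le, fun k hk => hk.le⟩
  · push Not at he
    have hv : v ∈ E.D := E.covBy ⟨h, fun e h1 h2 => absurd h2 (not_lt.2 (he e h1))⟩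
    obtain ⟨c, hc, h3, h4⟩ := E.dense h
    exact ⟨c, hc, v, hv, le_rfl, h, h3, h4, fun k hk => h4.trans (he k hk)⟩

variable (E)

/-- The value of `x` at an ultrafilter. -/
noncomputable def val (x : Tot S) (ω : UltrafilterSpace (Projection S)) : K :=
  (E.exists_lub {c | c ∈ E.D ∧ E.ge c x ∈ ω.1}).choose

variable {E}

theorem isLUB_val (x : Tot S) (ω : UltrafilterSpace (Projection S)) :
    IsLUB {c | c ∈ E.D ∧ E.ge c x ∈ ω.1} (E.val x ω) :=
  (E.exists_lub {c | c ∈ E.D ∧ E.ge c x ∈ ω.1}).choose_spec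

theorem le_val {c : K} (hc : c ∈ E.D) {x : Tot S} {ω : UltrafilterSpace (Projection S)}
    (h : E.ge c x ∈ ω.1) : c ≤ E.val x ω := (isLUB_val x ω).1 ⟨hc, h⟩

theorem lt_val_iff {a : K} {x : Tot S} {ω : UltrafilterSpace (Projection S)} :
    a < E.val x ω ↔ ∃ c ∈ E.D, a < c ∧ E.ge c x ∈ ω.1 := by
  rw [lt_isLUB_iff (isLUB_val x ω)]
  constructor
  · rintro ⟨c, ⟨h1, h2⟩, h3⟩
    exact ⟨c, h1, h3, h2⟩
  · rintro ⟨c, h1, h3, h2⟩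
    exact ⟨c, ⟨h1, h2⟩, h3⟩

theorem ge_mem_of_lt_val {a c : K} (hc : c ∈ E.D) (h : ∀ k, a < k → c ≤ k) {x : Tot S}
    {ω : UltrafilterSpace (Projection S)} (ha : a < E.val x ω) : E.ge c x ∈ ω.1 := by
  obtain ⟨d, hd, had, h1⟩ := lt_val_iff.1 ha
  exact Order.PFilter.mem_of_le (ge_anti hc (h d had) x) h1

theorem val_le {a c : K} (hc : c ∈ E.D) (h : ∀ k, a < k → c ≤ k) {x : Tot S}
    {ω : UltrafilterSpace (Projection S)} (hn : E.ge c x ∉ ω.1) : E.val x ω ≤ a :=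
  not_lt.1 fun h' => hn (ge_mem_of_lt_val hc h h')

theorem zero_mem : (0 : K) ∈ E.D := E.mem_D (E.zero ⊥)

theorem ge_zero (x : Tot S) : E.ge 0 x = ⊤ := top_le_iff.1 (le_ge (E.zero ⊤) (Tot.zero_le' _))

theorem val_nonneg (x : Tot S) (ω : UltrafilterSpace (Projection S)) : 0 ≤ E.val x ω :=
  le_val zero_mem (by rw [ge_zero]; exact ω.1.top_mem)

theorem val_mono {x y : Tot S} (h : x ≤ y) (ω : UltrafilterSpace (Projection S)) :
    E.val x ω ≤ E.val y ω :=
  (isLUB_le_iff (isLUB_val x ω)).2 fun _ hc =>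
    le_val hc.1 (Order.PFilter.mem_of_le (ge_mono _ h) hc.2)

theorem ge_le_base {c : K} (hc : 0 < c) (x : Tot S) : E.ge c x ≤ E.base :=
  sSup_le fun _ ⟨_, ht, _⟩ => E.le_base ht hc

theorem val_eq_zero_of_base_notMem {x : Tot S} {ω : UltrafilterSpace (Projection S)}
    (h : E.base ∉ ω.1) : E.val x ω = 0 := by
  refine le_antisymm (not_lt.1 fun h0 => ?_) (val_nonneg _ _)
  obtain ⟨c, hc, hc0, h1⟩ := lt_val_iff.1 h0
  exact h (Order.PFilter.mem_of_le (ge_le_base hc0 x) h1)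

theorem val_psmul_of_mem {p : Projection S} {ω : UltrafilterSpace (Projection S)} (hp : p ∈ ω.1)
    (x : Tot S) : E.val (p • x) ω = E.val x ω := by
  refine le_antisymm (val_mono (psmul_le _ _) ω) ((isLUB_le_iff (isLUB_val x ω)).2 ?_)
  intro c hc
  refine le_val hc.1 (Order.PFilter.mem_of_le ?_ (Order.PFilter.inf_mem hp hc.2))
  rw [ge, inf_sSup_eq]
  refine iSup₂_le fun q hq => ?_
  obtain ⟨t, ht, htx⟩ := hq
  exact le_ge (E.psmul p ht) (psmul_mono p htx)

theorem val_psmul_of_notMem {p : Projection S} {ω : UltrafilterSpace (Projection S)}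
    (hp : p ∉ ω.1) {x : Tot S} (hx : x ≠ ⊤) : E.val (p • x) ω = 0 := by
  refine le_antisymm (not_lt.1 fun h0 => ?_) (val_nonneg _ _)
  obtain ⟨c, hc, hc0, h1⟩ := lt_val_iff.1 h0
  have h2 := Order.PFilter.inf_mem h1 (UltrafilterSpace.compl_mem_iff.2 hp)
  obtain ⟨q, hq, hq0, t, ht, htx⟩ := exists_of_le_ge (E := E) inf_le_left
    (UltrafilterSpace.ne_bot_of_mem h2)
  have h3 : t ≤ 0 := by
    rw [← E.fixed ht, ← compl_psmul_psmul p hx]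
    exact (psmul_mono q htx).trans (psmul_le_psmul (hq.trans inf_le_right) _)
  exact hq0 (E.eq_bot (E.zero q) ht hc0 h3)

/-- A unit whose value is not exceeded by `x` dominates `x`. -/
theorem psmul_le_unit {a c : K} (ha : ∀ k, a < k → c ≤ k) (hc : c ∈ E.D) {q : Projection S}
    {x t : Tot S} (hx : x ≠ ⊤) (hq : q ≤ E.base) (hqx : q ≤ (E.ge c x)ᶜ) (ht : E.A a q t) :
    q • x ≤ t := by
  by_contra hn
  rw [← E.fixed ht] at hn
  obtain ⟨r, hr, hr0, hrn, -⟩ := exists_nowhereLE_of_psmul hx (E.ne_top ht) hn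
  have hrq : r ≤ q := hr.trans inf_le_left
  obtain ⟨r', hr', hr'0, v, c', t', s, hvc, ht', htx, hs, hts⟩ :=
    E.sep (hrq.trans hq) hr0 hx (E.ne_top ht) hrn
  -- The separating value `v` belongs to a unit above `t`, so it is at least `a`. Hence `c' > a`, so
  -- `c ≤ c'`, and `x` reaches `c` inside `q`.
  have hav : a ≤ v := by
    by_contra hlt
    exact hr'0 (E.eq_bot hs (A.psmul_of_le ht (hr'.trans hrq)) (not_le.1 hlt) hts)
  have h1 := (le_ge ht' htx).trans (ge_anti hc (ha _ (hav.trans_lt hvc)) x)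
  exact hr'0 (eq_bot_of_le_of_le_compl h1 ((hr'.trans hrq).trans hqx))

/-- Otherwise `sep` yields a part with a unit of value `c` below `x` and one of smaller value `v`
above `y`. At an ultrafilter through that part the value of `y` exceeds `v`, so a unit larger than
`v` fits under `y` somewhere in the part. -/
theorem psmul_base_le_of_val_le {x y : Tot S} (hx : x ≠ ⊤) (hy : y ≠ ⊤)
    (h : ∀ ω, E.base ∈ ω.1 → E.val x ω ≤ E.val y ω) : E.base • x ≤ E.base • y := by
  by_contra hn
  obtain ⟨q, hq, hq0, hqn, -⟩ := exists_nowhereLE_of_psmul hx hy hn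
  obtain ⟨r, hr, hr0, v, c, t, s, hvc, ht, htx, hs, hys⟩ :=
    E.sep (hq.trans inf_le_left) hq0 hx hy hqn
  obtain ⟨ω, hω⟩ := UltrafilterSpace.exists_mem hr0
  have h1 : c ≤ E.val x ω := le_val (E.mem_D ht) (Order.PFilter.mem_of_le (le_ge ht htx) hω)
  have h2 : v < E.val y ω :=
    hvc.trans_le (h1.trans (h ω (Order.PFilter.mem_of_le ((hr.trans hq).trans inf_le_left) hω)))
  obtain ⟨c', hc', hvc', h3⟩ := lt_val_iff.1 h2
  obtain ⟨p, hp, hp0, t', ht', hty⟩ := exists_of_le_ge (E := E) inf_le_left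
    (UltrafilterSpace.ne_bot_of_mem (Order.PFilter.inf_mem h3 hω))
  have hpr : p ≤ r := hp.trans inf_le_right
  refine hp0 (E.eq_bot (A.psmul_of_le hs hpr) ht' hvc' ?_)
  calc t' = p • t' := (E.fixed ht').symm
    _ ≤ p • r • y := by rw [psmul_of_le hpr]; exact psmul_mono p hty
    _ ≤ p • s := psmul_mono p hys

end Order

section Topology

variable {S : Type u} [PartialCommMonoid S] [hS : Fact (IsContinuousDimensionScale S)]
  {K : Type v} [LinearOrder K] [AddCommMonoid K] [TopologicalSpace K] [OrderTopology K]
  {E : UnitSystem S K}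

theorem continuous_val (x : Tot S) : Continuous (E.val x) := by
  rw [OrderTopology.continuous_iff]
  refine fun d => ⟨isOpen_iff_forall_mem_open.2 fun ω hω => ?_,
    isOpen_iff_forall_mem_open.2 fun ω hω => ?_⟩
  · obtain ⟨c, hc, hdc, h⟩ := lt_val_iff.1 (show d < E.val x ω from hω)
    exact ⟨basicSet (E.ge c x), fun ω' hω' => hdc.trans_le (le_val hc hω'), isOpen_basicSet _, h⟩
  · obtain ⟨c, hc, a, -, hva, had, hvc, -, hk⟩ :=
      exists_gap (E := E) (show E.val x ω < d from hω)
    refine ⟨basicSet (E.ge c x)ᶜ, fun ω' hω' => ?_, isOpen_basicSet _, ?_⟩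
    · exact (val_le hc hk (compl_mem_iff.1 hω')).trans_lt had
    · exact compl_mem_iff.2 fun h => absurd (le_val hc h) (not_le.2 hvc)

/-- Units bound the sum from both sides. Where `x` and `y` lie under units with values `a₁` and
`a₂`, the sum lies under the unit of value `a₁ + a₂`; units below `x` and `y` add up to a unit below
the sum. Continuity of the addition in `K` provides room for the approximation. -/
theorem val_add [CanonicallyOrderedAdd K] [ContinuousAdd K] {x y : Tot S} (h : x + y ≠ ⊤)
    (ω : UltrafilterSpace (Projection S)) : E.val (x + y) ω = E.val x ω + E.val y ω := by
  have hx := Tot.left_ne_top h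
  have hy := Tot.right_ne_top h
  have hcont : Continuous fun z : K × K => z.1 + z.2 := continuous_add
  apply le_antisymm
  · refine not_lt.1 fun hlt => ?_
    obtain ⟨c, hc, hac, hcm⟩ := lt_val_iff.1 hlt
    have hn : {z : K × K | z.1 + z.2 < c} ∈ nhds (E.val x ω, E.val y ω) :=
      (isOpen_Iio.preimage hcont).mem_nhds hac
    rw [nhds_prod_eq, Filter.mem_prod_iff] at hn
    obtain ⟨V, hV, W, hW, hVW⟩ := hn
    -- Room to the right is needed; `c` shows that the value of `x` is not maximal in `K`.
    obtain ⟨d, hd, hdV⟩ := exists_Ico_subset_of_mem_nhds hV ⟨c, le_self_add.trans_lt hac⟩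
    obtain ⟨e, he, heW⟩ := exists_Ico_subset_of_mem_nhds hW ⟨c, le_add_self.trans_lt hac⟩
    obtain ⟨c₁, hc₁, a₁, ha₁, h1, h1', h1'', -, hk₁⟩ := exists_gap (E := E) hd
    obtain ⟨c₂, hc₂, a₂, ha₂, h2, h2', h2'', -, hk₂⟩ := exists_gap (E := E) he
    have hlt : a₁ + a₂ < c := hVW (Set.mk_mem_prod (hdV ⟨h1, h1'⟩) (heW ⟨h2, h2'⟩))
    have hm₁ : (E.ge c₁ x)ᶜ ∈ ω.1 :=
      compl_mem_iff.2 fun h => absurd (le_val hc₁ h) (not_le.2 h1'')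
    have hm₂ : (E.ge c₂ y)ᶜ ∈ ω.1 :=
      compl_mem_iff.2 fun h => absurd (le_val hc₂ h) (not_le.2 h2'')
    obtain ⟨q, hq, hq0, s, hs, hsx⟩ := exists_of_le_ge (E := E) (inf_le_left.trans inf_le_right)
      (ne_bot_of_mem (Order.PFilter.inf_mem (Order.PFilter.inf_mem hm₁ hcm) hm₂))
    have hqb : q ≤ E.base := E.le_base hs ((zero_le (a := a₁ + a₂)).trans_lt hlt)
    obtain ⟨q₁, hq₁, hq₁0, t₁, ht₁⟩ := E.exists_of_le hs hq0 ha₁ (le_self_add.trans hlt.le)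
    obtain ⟨q₂, hq₂, hq₂0, t₂, ht₂⟩ := E.exists_of_le (A.psmul_of_le hs hq₁) hq₁0 ha₂
      (le_add_self.trans hlt.le)
    obtain ⟨r, hr, hr0, u, hu⟩ := E.exists_of_le (A.psmul_of_le hs (hq₂.trans hq₁)) hq₂0
      (E.add_mem ha₁ ha₂) hlt.le
    have ht₁' := A.psmul_of_le ht₁ (hr.trans hq₂)
    have ht₂' := A.psmul_of_le ht₂ hr
    have hrq : r ≤ q := hr.trans (hq₂.trans hq₁)
    have e1 : r • x ≤ r • t₁ := psmul_le_unit hk₁ hc₁ hx (hrq.trans hqb)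
      ((hrq.trans hq).trans (inf_le_left.trans inf_le_left)) ht₁'
    have e2 : r • y ≤ r • t₂ := psmul_le_unit hk₂ hc₂ hy (hrq.trans hqb)
      ((hrq.trans hq).trans inf_le_right) ht₂'
    refine hr0 (E.eq_bot hu (A.psmul_of_le hs hrq) hlt ?_)
    calc r • s ≤ r • (x + y) := psmul_mono r hsx
      _ = r • x + r • y := psmul_add r h
      _ ≤ r • t₁ + r • t₂ := add_le_add e1 e2
      _ = u := E.add_eq ht₁' ht₂' hu
  · refine not_lt.1 fun hlt => ?_
    have hn : IsOpen {z : K × K | E.val (x + y) ω < z.1 + z.2} := isOpen_Ioi.preimage hcont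
    -- The values are suprema, hence limits, of attained unit values, so some pair of attained
    -- values already has too large a sum.
    have hcl : (E.val x ω, E.val y ω) ∈ closure
        ({c | c ∈ E.D ∧ E.ge c x ∈ ω.1} ×ˢ {c | c ∈ E.D ∧ E.ge c y ∈ ω.1}) := by
      rw [closure_prod_eq]
      have h0 : ∀ x : Tot S, Set.Nonempty {c | c ∈ E.D ∧ E.ge c x ∈ ω.1} := fun x =>
        ⟨0, zero_mem, by rw [ge_zero]; exact ω.1.top_mem⟩
      exact ⟨(isLUB_val x ω).mem_closure (h0 x), (isLUB_val y ω).mem_closure (h0 y)⟩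
    obtain ⟨⟨c, d⟩, hcd, ⟨hc, hcx⟩, hd, hdy⟩ := mem_closure_iff.1 hcl _ hn hlt
    obtain ⟨c', hc', a, -, hva, had, hvc, hcc, hk⟩ := exists_gap (E := E) hcd
    have hm : (E.ge c' (x + y))ᶜ ∈ ω.1 :=
      compl_mem_iff.2 fun h => absurd (le_val hc' h) (not_le.2 hvc)
    obtain ⟨q, hq, hq0, t, ht, htx⟩ := exists_of_le_ge (E := E) (inf_le_left.trans inf_le_right)
      (ne_bot_of_mem (Order.PFilter.inf_mem (Order.PFilter.inf_mem hm hcx) hdy))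
    obtain ⟨r, hr, hr0, s, hs, hsy⟩ := exists_of_le_ge (E := E)
      (hq.trans inf_le_right) hq0
    have ht' := A.psmul_of_le ht hr
    have hle : r • t + s ≤ x + y := add_le_add ((psmul_le _ _).trans htx) hsy
    have hA := E.add ht' hs (Tot.ne_top_of_le hle h)
    exact hr0 (eq_bot_of_le_of_le_compl
      ((le_ge hA hle).trans (ge_anti hc' hcc _))
      ((hr.trans hq).trans (inf_le_left.trans inf_le_left)))

/-- The witness is the supremum of the units below `x` whose value does not exceed `g` on their
part. This is why the range of the embedding is a lower set. -/
theorem exists_val_eq [CanonicallyOrderedAdd K] {x : Tot S} (hx : x ≠ ⊤)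
    {g : UltrafilterSpace (Projection S) → K}
    (hg : Continuous g) (hgx : ∀ ω, g ω ≤ E.val x ω) :
    ∃ y ≤ x, E.base • y = y ∧ ∀ ω, E.val y ω = g ω := by
  set Y : Set (Tot S) := {t | t ≤ x ∧ ∃ c q, E.A c q t ∧ ∀ ω : UltrafilterSpace (Projection S),
    q ∈ ω.1 → c ≤ g ω}
  set y := sSup Y
  have hyx : y ≤ x := sSup_le fun t ht => ht.1
  have hyt := Tot.ne_top_of_le hyx hx
  refine ⟨y, hyx, psmul_sSup_eq ?_, fun ω => le_antisymm ?_ ?_⟩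
  · rintro t ⟨-, c, q, ht, -⟩
    rcases (zero_le (a := c)).eq_or_lt with h0 | h0
    · subst h0
      have : t = 0 := le_antisymm (E.le ht (E.zero q) le_rfl) (Tot.zero_le' _)
      rw [this, psmul_zero]
    · exact psmul_eq_of_le_of_eq (E.le_base ht h0) (E.fixed ht)
  · refine not_lt.1 fun hlt => ?_
    obtain ⟨c, hc, a, ha, hva, had, hvc, -, hk⟩ := exists_gap (E := E) hlt
    obtain ⟨c', hc', hac, hm⟩ := lt_val_iff.1 had
    obtain ⟨p, hp, hpg⟩ := exists_basicSet_subset (isOpen_Iio.preimage hg)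
      (show ω ∈ g ⁻¹' Set.Iio c from hvc)
    obtain ⟨q, hq, hq0, s, hs, hsy⟩ := exists_of_le_ge (E := E) inf_le_right
      (ne_bot_of_mem (Order.PFilter.inf_mem hp hm))
    obtain ⟨r, hr, hr0, u, hu⟩ := E.exists_of_le hs hq0 ha hac.le
    -- On `r` the function `g` stays below `c`, so each unit in `Y` that meets `r` has value at most
    -- `a`; as projections commute with suprema, `u` dominates `y` on `r`.
    have hry : r • y ≤ u := by
      rw [psmul_sSup r hyt]
      refine sSup_le ?_
      rintro _ ⟨t, ⟨htx, d, q', ht, hd⟩, rfl⟩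
      have htA := E.psmul r ht
      by_cases h0 : r ⊓ q' = ⊥
      · have : r • t = 0 := by
          rw [← E.fixed ht, ← inf_psmul, h0, bot_psmul (E.ne_top ht)]
        change r • t ≤ u
        rw [this]
        exact Tot.zero_le' _
      · obtain ⟨ω', hω'⟩ := exists_mem h0
        rw [Order.PFilter.inf_mem_iff] at hω'
        have hlt : d < c := (hd ω' hω'.2).trans_lt (hpg (Order.PFilter.mem_of_le
          ((hr.trans hq).trans inf_le_left) hω'.1))
        have hda : d ≤ a := not_lt.1 fun h => absurd (hk d h) (not_le.2 hlt)
        exact (E.le htA (A.psmul_of_le hu inf_le_left) hda).trans (psmul_le _ _)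
    exact hr0 (E.eq_bot hu (A.psmul_of_le hs hr) hac ((psmul_mono r hsy).trans hry))
  · refine not_lt.1 fun hlt => ?_
    obtain ⟨c, hc, a, ha, hva, had, hvc, hcd, hk⟩ := exists_gap (E := E) hlt
    have hm : (E.ge c y)ᶜ ∈ ω.1 :=
      compl_mem_iff.2 fun h => absurd (le_val hc h) (not_le.2 hvc)
    obtain ⟨p, hp, hpg⟩ := exists_basicSet_subset (isOpen_Ioi.preimage hg)
      (show ω ∈ g ⁻¹' Set.Ioi a from had)
    have hpx : p ≤ E.ge c x := le_of_basicSet_subset fun ω' hω' =>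
      ge_mem_of_lt_val hc hk ((hpg hω').trans_le (hgx ω'))
    obtain ⟨q, hq, hq0, t, ht, htx⟩ := exists_of_le_ge (E := E) (inf_le_left.trans hpx)
      (ne_bot_of_mem (Order.PFilter.inf_mem hp hm))
    have hty : t ≤ y := le_sSup ⟨htx, c, q, ht, fun ω' hω' =>
      hk _ (hpg (Order.PFilter.mem_of_le (hq.trans inf_le_left) hω'))⟩
    exact hq0 (eq_bot_of_le_of_le_compl (le_ge ht hty) (hq.trans inf_le_right))

end Topology

end UnitSystem

end PartialCommMonoid

/-! ### Order completeness of the value scales. -/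

namespace AlephExt

section Order

variable {F : Type} {γ : Ordinal.{w}} [LinearOrder F]

/-- A set without finite upper bound has `aleph γ` as an upper bound, and the alephs are well
ordered. -/
theorem exists_isLUB (hF : ∀ s : Set F, BddAbove s → ∃ m, IsLUB s m) (s : Set (AlephExt F γ)) :
    ∃ m, IsLUB s m := by
  by_cases hb : ∃ x : F, fin x ∈ upperBounds s
  · obtain ⟨x, hx⟩ := hb
    have hs : ∀ a ∈ s, ∃ z, a = fin z := by
      rintro (z | z) hz
      · exact ⟨z, rfl⟩
      · exact absurd (hx hz) (not_le.2 (fin_lt_aleph _ _))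
    obtain ⟨m, hm⟩ := hF (fin ⁻¹' s) ⟨x, fun z hz => fin_le_fin.1 (hx hz)⟩
    refine ⟨fin m, fun a ha => ?_, ?_⟩
    · obtain ⟨z, rfl⟩ := hs a ha
      exact fin_le_fin.2 (hm.1 ha)
    · rintro (z | z) hz
      · exact fin_le_fin.2 (hm.2 fun y hy => fin_le_fin.1 (hz hy))
      · exact (fin_lt_aleph _ _).le
  · have hne : {ξ : Set.Iic γ | aleph ξ ∈ upperBounds s}.Nonempty := by
      refine ⟨⟨γ, Set.mem_Iic.2 le_rfl⟩, ?_⟩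
      rintro (z | z) _
      · exact (fin_lt_aleph _ _).le
      · exact aleph_le_aleph.2 z.2
    obtain ⟨ξ, hξ, hmin⟩ := WellFounded.has_min (wellFounded_lt (α := Set.Iic γ)) _ hne
    refine ⟨aleph ξ, hξ, ?_⟩
    rintro (z | z) hz
    · exact absurd ⟨z, hz⟩ hb
    · exact aleph_le_aleph.2 (not_lt.1 (hmin z hz))

end Order

section Add

variable {F : Type} {γ : Ordinal.{w}} [AddCommMonoid F] [LinearOrder F] [CanonicallyOrderedAdd F]

theorem add_aleph_of_le {a : AlephExt F γ} {ξ : Set.Iic γ} (h : a ≤ aleph ξ) :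
    a + aleph ξ = aleph ξ := by
  rcases a with x | x
  · rfl
  · rw [aleph_add_aleph, max_eq_right (aleph_le_aleph.1 h)]

instance : CanonicallyOrderedAdd (AlephExt F γ) where
  exists_add_of_le := by
    rintro (x | x) (y | y) h
    · obtain ⟨z, rfl⟩ := exists_add_of_le (fin_le_fin.1 h)
      exact ⟨fin z, rfl⟩
    · exact ⟨aleph y, rfl⟩
    · exact absurd (fin_lt_aleph y x) (not_lt.2 h)
    · exact ⟨aleph y, by rw [aleph_add_aleph, max_eq_right (aleph_le_aleph.1 h)]⟩
  le_self_add := left_le_add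
  le_add_self a b := by rw [add_comm]; exact left_le_add a b

end Add

end AlephExt

/-! ### Extending finite units by the alephs. -/

namespace PartialCommMonoid

open Projection Tot

/-- Units with finite values. -/
structure FinUnits (S : Type u) [PartialCommMonoid S] [Fact (IsContinuousDimensionScale S)]
    (F : Type) [LinearOrder F] [AddCommMonoid F] where
  /-- The projection that carries the units. -/
  base : Projection S
  /-- The values of the units. -/
  D : Set F
  /-- The units. -/
  A : F → Projection S → Tot S → Prop
  mem_D : ∀ {c q t}, A c q t → c ∈ D
  dfin : ∀ {c q t}, A c q t → DFin t
  fixed : ∀ {c q t}, A c q t → q • t = t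
  psmul : ∀ {c q t} (p : Projection S), A c q t → A c (p ⊓ q) (p • t)
  zero : ∀ q, A 0 q 0
  le_base : ∀ {c q t}, A c q t → 0 < c → q ≤ base
  le : ∀ {c d q t s}, A c q t → A d q s → c ≤ d → t ≤ s
  eq_bot : ∀ {c d q t s}, A c q t → A d q s → c < d → s ≤ t → q = ⊥
  add : ∀ {c d q t s}, A c q t → A d q s → t + s ≠ ⊤ → A (c + d) q (t + s)
  add_eq : ∀ {c d q t s u}, A c q t → A d q s → A (c + d) q u → t + s = u
  add_mem : ∀ {c d}, c ∈ D → d ∈ D → c + d ∈ D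
  exists_of_le : ∀ {c d q s}, A d q s → q ≠ ⊥ → c ∈ D → c ≤ d →
    ∃ p ≤ q, p ≠ ⊥ ∧ ∃ t, A c p t
  exists_of_pinf : ∀ {c s}, PInf s → s ≠ ⊤ → s ≠ 0 → supp s ≤ base → c ∈ D →
    ∃ p ≤ supp s, p ≠ ⊥ ∧ ∃ t, A c p t
  dense : ∀ {a b : F}, a < b → ∃ c ∈ D, a < c ∧ c ≤ b
  covBy : ∀ {a b : F}, a ⋖ b → a ∈ D
  -- Keeps a finite value outside `D` from being covered by `ℵ₀`.
  exists_gt : ∀ {a : F}, a ∉ D → ∃ b, a < b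
  -- The second alternative serves type III: there finite units separate nothing, and the separating
  -- values are `0` and `ℵ₀`.
  sep : ∀ {q x y}, q ≤ base → q ≠ ⊥ → x ≠ ⊤ → y ≠ ⊤ → DFin (q • y) → NowhereLE q x y →
    (∃ r ≤ q, r ≠ ⊥ ∧ ∃ v c t s, v < c ∧ A c r t ∧ t ≤ x ∧ A v r s ∧ r • y ≤ s) ∨
    ∃ r ≤ q, r ≠ ⊥ ∧ r • y = 0 ∧ PInf (r • x)
  bounded : ∀ {q y}, q ≤ base → q ≠ ⊥ → DFin (q • y) →
    ∃ r ≤ q, r ≠ ⊥ ∧ ∃ v : F, ∀ p ≤ r, ∀ c, v < c → ∀ t, A c p t → t ≤ y → p = ⊥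
  exists_lub : ∀ s : Set F, BddAbove s → ∃ m, IsLUB s m

namespace FinUnits

variable {S : Type u} [PartialCommMonoid S] [hS : Fact (IsContinuousDimensionScale S)]
  {F : Type} [LinearOrder F] [AddCommMonoid F]

theorem _root_.PartialCommMonoid.Tot.IsAleph.psmul_of_le {ξ : Ordinal.{u}} {p q : Projection S}
    {t : Tot S} (h : IsAleph ξ q t) (hp : p ≤ q) : IsAleph ξ p (p • t) := by
  have := h.psmul p
  rwa [inf_eq_left.2 hp] at this

theorem _root_.PartialCommMonoid.Tot.IsAleph.fixed {ξ : Ordinal.{u}} {q : Projection S}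
    {t : Tot S} (h : IsAleph ξ q t) : q • t = t :=
  supp_le_iff.1 h.mem.2.2.1.le

theorem _root_.PartialCommMonoid.Tot.IsAleph.unique {ξ : Ordinal.{u}} {q : Projection S}
    {t s : Tot S} (h : IsAleph ξ q t) (h' : IsAleph ξ q s) : t = s :=
  le_antisymm (h.le h' le_rfl) (h'.le h le_rfl)

/-- The units with values in `AlephExt F γ`. -/
def extA (E : FinUnits S F) (γ : Ordinal.{u}) : AlephExt F γ → Projection S → Tot S → Prop
  | .fin c, q, t => E.A c q t
  | .aleph ξ, q, t => IsAleph ξ.1 q t ∧ q ≤ E.base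

theorem fin_le_isAleph {E : FinUnits S F} {c : F} {ξ : Ordinal.{u}} {q : Projection S}
    {t s : Tot S} (ht : E.A c q t) (hs : IsAleph ξ q s) : t ≤ s := by
  obtain ⟨p, h1, h2⟩ := exists_comparable (E.dfin ht).ne_top hs.mem.1
  refine le_of_psmul p h1 ?_
  have h3 := (hs.mem.2.1.psmul hs.mem.1 pᶜ).eq_zero_of_dfin (((E.dfin ht).psmul pᶜ).of_le h2)
  rw [psmul_eq_zero_iff hs.mem.1, hs.mem.2.2.1] at h3
  rw [← E.fixed ht, ← inf_psmul pᶜ, h3, bot_psmul (E.dfin ht).ne_top]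
  exact zero_le' _

theorem eq_bot_of_isAleph_le {ξ : Ordinal.{u}} {q : Projection S}
    {x s : Tot S} (hx : DFin x) (hs : IsAleph ξ q s) (h : s ≤ x) : q = ⊥ := by
  rw [← hs.mem.2.2.1, supp_eq_bot hs.mem.1]
  exact hs.mem.2.1.eq_zero_of_dfin (hx.of_le h)

/-- If `y` is directly finite on some part of `q`, use the finite units, or `0` and `ℵ₀` when `y`
vanishes there. Otherwise `y`, and with it the larger `x`, is purely infinite on `q`. Cut down to a
part where `y` is an aleph `ξ`; there `x` lies strictly above it everywhere, so the values `ξ` and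
`ξ + 1` separate. -/
theorem ext_sep (E : FinUnits S F) {γ : Ordinal.{u}}
    (hγ : ∀ (ξ : Ordinal.{u}) (q : Projection S) (t : Tot S), IsAleph ξ q t → q ≠ ⊥ → ξ ≤ γ)
    [CanonicallyOrderedAdd F] {q : Projection S} {x y : Tot S} (hq : q ≤ E.base) (hq0 : q ≠ ⊥)
    (hx : x ≠ ⊤) (hy : y ≠ ⊤) (hn : NowhereLE q x y) :
    ∃ r ≤ q, r ≠ ⊥ ∧ ∃ v c t s, v < c ∧ E.extA γ c r t ∧ t ≤ x ∧ E.extA γ v r s ∧ r • y ≤ s := by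
  by_cases hd : ∃ r ≤ q, r ≠ ⊥ ∧ DFin (r • y)
  · obtain ⟨r, hrq, hr0, hr⟩ := hd
    rcases E.sep (hrq.trans hq) hr0 hx hy hr (hn.mono hrq) with
      ⟨r', h1, h2, v, c, t, s, hvc, h3, h4, h5, h6⟩ | ⟨r', h1, h2, h3, h4⟩
    · exact ⟨r', h1.trans hrq, h2, .fin v, .fin c, t, s, AlephExt.fin_lt_fin.2 hvc, h3, h4, h5, h6⟩
    · have hr'q := h1.trans hrq
      have hs : r' ⊓ supp x ≠ ⊥ := by
        intro h0
        rw [← psmul_eq_zero_iff hx] at h0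
        exact h2 (hn r' hr'q (by rw [h0]; exact zero_le' _))
      have hmem : r' • x ∈ Above 0 (r' ⊓ supp x) :=
        ⟨psmul_ne_top hx, h4, supp_psmul r' hx, fun η hη => absurd hη not_lt_zero⟩
      obtain ⟨t, ht⟩ := exists_isAleph hmem
      refine ⟨r' ⊓ supp x, inf_le_left.trans hr'q, hs, .fin 0, .aleph ⟨0, Set.mem_Iic.2 zero_le⟩, t, 0,
        AlephExt.fin_lt_aleph _ _, ⟨ht, inf_le_left.trans (hr'q.trans hq)⟩,
        ((isAleph_iff.1 ht).2 hmem).trans (psmul_le _ _), E.zero _, ?_⟩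
      rw [← h3]
      exact psmul_le_psmul inf_le_left y
  · push Not at hd
    have hle := hn.le hx hy
    have key : ∀ z : Tot S, z ≠ ⊤ → (∀ r ≤ q, r ≠ ⊥ → ¬ DFin (r • z)) → PInf (q • z) := by
      intro z hz h
      obtain ⟨p, hp, hp'⟩ := exists_dfin_pinf hz
      have h0 : q ⊓ p = ⊥ := by
        by_contra hne
        exact h _ inf_le_left hne (hp.of_le (psmul_le_psmul inf_le_right z))
      have : q ≤ pᶜ := le_compl_iff_disjoint_right.2 (_root_.disjoint_iff.2 h0)
      rw [← Projection.psmul_of_le this]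
      exact hp'.psmul (psmul_ne_top hz) q
    have hyP := key y hy hd
    have hxP := key x hx fun r hr hr0 hF => hd r hr hr0 (hF.of_le (by
      rw [← Projection.psmul_of_le hr, ← Projection.psmul_of_le hr x]
      exact psmul_mono r hle))
    have hy0 : q • y ≠ 0 := fun h0 => hd q le_rfl hq0 (by rw [h0]; exact dfin_zero)
    obtain ⟨ξ, r, hr, hr0, hA⟩ := exists_isAleph_psmul hyP (psmul_ne_top hy) hy0
    rw [supp_psmul q hy] at hr
    have hrq : r ≤ q := hr.trans inf_le_left
    rw [Projection.psmul_of_le hrq] at hA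
    have hryx : r • y ≤ r • x := by
      rw [← Projection.psmul_of_le hrq, ← Projection.psmul_of_le hrq x]
      exact psmul_mono r hle
    have hmem : r • x ∈ Above (Order.succ ξ) r := by
      refine ⟨psmul_ne_top hx, ?_, ?_, ?_⟩
      · rw [← Projection.psmul_of_le hrq]
        exact hxP.psmul (psmul_ne_top hx) r
      · refine le_antisymm ?_ ?_
        · rw [supp_psmul r hx]; exact inf_le_left
        · calc r = supp (r • y) := hA.mem.2.2.1.symm
            _ ≤ _ := supp_mono hryx (psmul_ne_top hx)
      · intro η hη p hp s hs
        rw [Projection.psmul_of_le hp]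
        have hpy : s ≤ p • y := by
          have := hA.psmul_of_le hp
          rw [Projection.psmul_of_le hp] at this
          exact hs.le this (Order.lt_succ_iff.1 hη)
        have hpyx : p • y ≤ p • x := by
          rw [← Projection.psmul_of_le hp, ← Projection.psmul_of_le hp x]
          exact psmul_mono p hryx
        refine ⟨hpy.trans hpyx, fun p' hp' => ?_⟩
        have h1 : p' ⊓ p = ⊥ := hn _ (inf_le_right.trans (hp.trans hrq)) (by
          rw [inf_psmul, inf_psmul, ← hp']
          exact psmul_mono p' hpy)
        rw [← inf_psmul, h1, bot_psmul hx]
    obtain ⟨t, ht⟩ := exists_isAleph hmem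
    exact ⟨r, hrq, hr0, .aleph ⟨ξ, hγ _ _ _ hA hr0⟩, .aleph ⟨Order.succ ξ, hγ _ _ _ ht hr0⟩, t,
      r • y, AlephExt.aleph_lt_aleph.2 (Order.lt_succ ξ), ⟨ht, hrq.trans hq⟩,
      ((isAleph_iff.1 ht).2 hmem).trans (psmul_le _ _), ⟨hA, hrq.trans hq⟩, le_rfl⟩

/-- The unit system with values in `AlephExt F γ`. -/
def ext (E : FinUnits S F) (γ : Ordinal.{u}) [CanonicallyOrderedAdd F]
    (hγ : ∀ (ξ : Ordinal.{u}) (q : Projection S) (t : Tot S), IsAleph ξ q t → q ≠ ⊥ → ξ ≤ γ) :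
    UnitSystem S (AlephExt F γ) where
  base := E.base
  -- All alephs belong to this set vacuously.
  D := {c | ∀ x, c = .fin x → x ∈ E.D}
  A := E.extA γ
  mem_D := by
    rintro (c | c) q t h x hx
    · cases hx; exact E.mem_D h
    · cases hx
  ne_top := by
    rintro (c | c) q t h
    · exact (E.dfin h).ne_top
    · exact h.1.mem.1
  fixed := by
    rintro (c | c) q t h
    · exact E.fixed h
    · exact h.1.fixed
  psmul := by
    rintro (c | c) q t p h
    · exact E.psmul p h
    · exact ⟨h.1.psmul p, inf_le_right.trans h.2⟩
  zero := E.zero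
  le_base := by
    rintro (c | c) q t h h0
    · exact E.le_base h (AlephExt.fin_lt_fin.1 h0)
    · exact h.2
  le := by
    rintro (c | c) (d | d) q t s ht hs hcd
    · exact E.le ht hs (AlephExt.fin_le_fin.1 hcd)
    · exact fin_le_isAleph ht hs.1
    · exact absurd (AlephExt.fin_lt_aleph d c) (not_lt.2 hcd)
    · exact ht.1.le hs.1 (AlephExt.aleph_le_aleph.1 hcd)
  eq_bot := by
    rintro (c | c) (d | d) q t s ht hs hcd hst
    · exact E.eq_bot ht hs (AlephExt.fin_lt_fin.1 hcd) hst
    · exact eq_bot_of_isAleph_le (E.dfin ht) hs.1 hst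
    · exact absurd hcd (AlephExt.not_aleph_lt_fin _ _)
    · exact ht.1.eq_bot_of_le hs.1 (AlephExt.aleph_lt_aleph.1 hcd) hst
  add := by
    rintro (c | c) (d | d) q t s ht hs hts
    · exact E.add ht hs hts
    · rw [hs.1.mem.2.1.add_of_le (fin_le_isAleph ht hs.1)]
      exact hs
    · rw [add_comm t, ht.1.mem.2.1.add_of_le (fin_le_isAleph hs ht.1)]
      exact ht
    · rw [AlephExt.aleph_add_aleph]
      rcases le_total c d with h | h
      · rw [max_eq_right h, hs.1.mem.2.1.add_of_le (ht.1.le hs.1 h)]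
        exact hs
      · rw [max_eq_left h, add_comm t, ht.1.mem.2.1.add_of_le (hs.1.le ht.1 h)]
        exact ht
  add_eq := by
    rintro (c | c) (d | d) q t s u ht hs hu
    · exact E.add_eq ht hs hu
    · rw [hs.1.mem.2.1.add_of_le (fin_le_isAleph ht hs.1)]
      exact hs.1.unique hu.1
    · rw [add_comm t, ht.1.mem.2.1.add_of_le (fin_le_isAleph hs ht.1)]
      exact ht.1.unique hu.1
    · rw [AlephExt.aleph_add_aleph] at hu
      rcases le_total c d with h | h
      · rw [max_eq_right h] at hu
        rw [hs.1.mem.2.1.add_of_le (ht.1.le hs.1 h)]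
        exact hs.1.unique hu.1
      · rw [max_eq_left h] at hu
        rw [add_comm t, ht.1.mem.2.1.add_of_le (hs.1.le ht.1 h)]
        exact ht.1.unique hu.1
  add_mem := by
    rintro (c | c) (d | d) hc hd x hx
    · cases hx; exact E.add_mem (hc c rfl) (hd d rfl)
    all_goals cases hx
  exists_of_le := by
    rintro (c | c) (d | d) q s hs hq hc hcd
    · exact E.exists_of_le hs hq (hc c rfl) (AlephExt.fin_le_fin.1 hcd)
    · obtain ⟨h1, h2, h3, -⟩ := hs.1.mem
      obtain ⟨p, hp, hp0, t, ht⟩ := E.exists_of_pinf h2 h1 (fun h0 => hq (by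
        rw [← h3, h0, supp_zero])) (h3.le.trans hs.2) (hc c rfl)
      exact ⟨p, hp.trans h3.le, hp0, t, ht⟩
    · exact absurd (AlephExt.fin_lt_aleph d c) (not_lt.2 hcd)
    · obtain ⟨t, ht⟩ := exists_isAleph (above_anti (AlephExt.aleph_le_aleph.1 hcd) q hs.1.mem)
      exact ⟨q, le_rfl, hq, t, ht, hs.2⟩
  dense := by
    rintro (a | a) (b | b) hab
    · obtain ⟨c, hc, h1, h2⟩ := E.dense (AlephExt.fin_lt_fin.1 hab)
      refine ⟨.fin c, fun x hx => ?_, AlephExt.fin_lt_fin.2 h1, AlephExt.fin_le_fin.2 h2⟩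
      cases hx; exact hc
    · exact ⟨.aleph b, fun x hx => (by cases hx), hab, le_rfl⟩
    · exact absurd hab (AlephExt.not_aleph_lt_fin _ _)
    · exact ⟨.aleph b, fun x hx => (by cases hx), hab, le_rfl⟩
  covBy := by
    rintro (a | a) b hab x hx
    · cases hx
      by_contra hD
      obtain ⟨c, hc⟩ := E.exists_gt hD
      rcases b with b | b
      · refine hD (E.covBy (b := b) ⟨AlephExt.fin_lt_fin.1 hab.1, fun c h1 h2 =>
          hab.2 (AlephExt.fin_lt_fin.2 h1) (AlephExt.fin_lt_fin.2 h2)⟩)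
      · exact hab.2 (AlephExt.fin_lt_fin.2 hc) (AlephExt.fin_lt_aleph _ _)
    · cases hx
  sep := E.ext_sep hγ
  exists_lub := AlephExt.exists_isLUB E.exists_lub

/-- By `bounded`, some part carries no finite unit of large value below `y`, and an aleph never fits
under a directly finite element. So directly finite elements have finite values on a dense set; they
may be infinite elsewhere. -/
theorem exists_fin_val (E : FinUnits S F) {γ : Ordinal.{u}} [CanonicallyOrderedAdd F]
    (hγ : ∀ (ξ : Ordinal.{u}) (q : Projection S) (t : Tot S), IsAleph ξ q t → q ≠ ⊥ → ξ ≤ γ)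
    {q : Projection S} {y : Tot S} (hq : q ≤ E.base) (hq0 : q ≠ ⊥) (hy : DFin (q • y)) :
    ∃ ω : UltrafilterSpace (Projection S), q ∈ ω.1 ∧ ∃ v, (E.ext γ hγ).val y ω = .fin v := by
  obtain ⟨r, hr, hr0, v, hv⟩ := E.bounded hq hq0 hy
  obtain ⟨ω, hω⟩ := exists_mem hr0
  refine ⟨ω, Order.PFilter.mem_of_le hr hω, ?_⟩
  have hle : (E.ext γ hγ).val y ω ≤ .fin v := by
    refine not_lt.1 fun hlt => ?_
    obtain ⟨c, hc, hvc, hcm⟩ := UnitSystem.lt_val_iff.1 hlt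
    obtain ⟨p, hp, hp0, t, ht, hty⟩ := UnitSystem.exists_of_le_ge (E := E.ext γ hγ) inf_le_right
      (ne_bot_of_mem (Order.PFilter.inf_mem hω hcm))
    have hpr : p ≤ r := hp.trans inf_le_left
    rcases c with c | c
    · exact hp0 (hv p hpr c (AlephExt.fin_lt_fin.1 hvc) t ht hty)
    · refine hp0 (eq_bot_of_isAleph_le hy ht.1 ?_)
      rw [← ht.1.fixed]
      exact (psmul_mono p hty).trans (psmul_le_psmul (hpr.trans hr) y)
  rcases h : (E.ext γ hγ).val y ω with z | z
  · exact ⟨z, rfl⟩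
  · rw [h] at hle
    exact absurd hle (not_le.2 (AlephExt.fin_lt_aleph _ _))

end FinUnits

end PartialCommMonoid

/-! ### Finite units obtained by division. -/

namespace PartialCommMonoid

open Projection Tot

section

variable {S : Type u} [PartialCommMonoid S] [hS : Fact (IsContinuousDimensionScale S)]

theorem Tot.PInf.nsmul_le {s : Tot S} (hs : PInf s) (n : ℕ) : n • s ≤ s := by
  induction n with
  | zero => rw [zero_nsmul]; exact zero_le' _
  | succ n ih =>
    rw [succ_nsmul]
    exact (add_le_add_left ih s).trans (le_of_eq hs)

theorem Tot.nsmul_mono_left {m n : ℕ} (h : m ≤ n) (x : Tot S) : m • x ≤ n • x := by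
  obtain ⟨k, rfl⟩ := Nat.exists_eq_add_of_le h
  rw [add_nsmul]
  exact le_self_add

theorem Tot.le_nsmul {n : ℕ} (h : n ≠ 0) (x : Tot S) : x ≤ n • x := by
  simpa using nsmul_mono_left (Nat.one_le_iff_ne_zero.2 h) x

theorem Tot.supp_nsmul {n : ℕ} (hn : n ≠ 0) {x : Tot S} (h : n • x ≠ ⊤) :
    supp (n • x) = supp x := by
  refine le_antisymm ?_ (supp_mono (le_nsmul hn x) h)
  rw [supp_le_iff, psmul_nsmul _ _ h, supp_psmul_self]

/-- Division with remainder: by the Archimedean property some multiple of `h` does not fit under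
`y`, and `m + 1` is the least such multiplicity. -/
theorem Tot.DFin.exists_eq_nsmul_add {y h : Tot S} (hy : DFin y) (h0 : h ≠ 0) :
    ∃ (m : ℕ) (ρ : Tot S), y = m • h + ρ ∧ ¬ h ≤ ρ := by
  have hex : ∃ n : ℕ, ¬ n • h ≤ y := by
    by_contra! hc
    exact h0 (hy.eq_zero_of_forall_nsmul_le hc)
  classical
  obtain ⟨m, hm⟩ : ∃ m, Nat.find hex = m + 1 := Nat.exists_eq_succ_of_ne_zero (by
    intro h1
    have := Nat.find_spec hex
    rw [h1, zero_nsmul] at this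
    exact this (zero_le' _))
  have h1 : m • h ≤ y := not_not.1 (Nat.find_min hex (m := m) (by omega))
  have h2 := Nat.find_spec hex
  obtain ⟨ρ, hρ⟩ := h1
  refine ⟨m, ρ, hρ, fun hle => h2 ?_⟩
  rw [hm, succ_nsmul, hρ]
  exact add_le_add_right hle _

theorem Tot.MFree.of_le {x y : Tot S} (hy : MFree y) (h : x ≤ y) : MFree x :=
  fun z hz => hy z (hz.trans h)

/-- An element absorbed by `x` is absorbed twice, so its double lies below `x`. -/
theorem Tot.MFree.dfin {x : Tot S} (hx : MFree x) : DFin x := by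
  intro z hz
  refine hx z ⟨x, ?_⟩
  rw [add_assoc, hz, hz]

/-- The data that determine finite units: the elements `h` such that `b ^ k • h ∈ G` represent the
value `val 1 k`. -/
structure UnitData (S : Type u) [PartialCommMonoid S] [Fact (IsContinuousDimensionScale S)]
    (F : Type) [LinearOrder F] [AddCommMonoid F] where
  /-- The projection that carries the units. -/
  base : Projection S
  /-- The units with value `1`. -/
  G : Set (Tot S)
  /-- The number of parts into which units are divided. -/
  b : ℕ
  /-- `val m k` is the value of `m / b ^ k`. -/
  val : ℕ → ℕ → F
  b_ne_zero : b ≠ 0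
  dfin : ∀ g ∈ G, DFin g
  supp_le : ∀ g ∈ G, supp g ≤ base
  psmul : ∀ g ∈ G, ∀ p : Projection S, p • g ∈ G
  unique : ∀ g ∈ G, ∀ h ∈ G, supp g = supp h → g = h
  div : ∀ g, DFin g → supp g ≤ base → ∃ h, b • h = g
  -- In type II there is room for two copies of `h`; in type I that may fail, but then `h` is
  -- multiple-free.
  sep : ∀ z ≠ 0, z ≠ ⊤ → supp z ≤ base → ∃ (k : ℕ) (h : Tot S), b ^ k • h ∈ G ∧ h ≠ 0 ∧ h ≤ z ∧
    (h + h ≤ z ∨ MFree h)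
  val_le : ∀ m n k l, val m k ≤ val n l ↔ m * b ^ l ≤ n * b ^ k
  val_zero : ∀ k, val 0 k = 0
  val_add : ∀ m n k, val m k + val n k = val (m + n) k
  dense : ∀ {a b : F}, a < b → ∃ m k, a < val m k ∧ val m k ≤ b
  covBy : ∀ {a b : F}, a ⋖ b → ∃ m k, a = val m k
  exists_gt : ∀ a : F, ∃ b, a < b
  exists_lub : ∀ s : Set F, BddAbove s → ∃ m, IsLUB s m

namespace UnitData

variable {F : Type} [LinearOrder F] [AddCommMonoid F] (U : UnitData S F)

theorem pow_ne_zero (k : ℕ) : U.b ^ k ≠ 0 := _root_.pow_ne_zero k U.b_ne_zero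

theorem dfin_of_mem {k : ℕ} {h : Tot S} (hh : U.b ^ k • h ∈ U.G) : DFin h :=
  (U.dfin _ hh).of_le (le_nsmul (U.pow_ne_zero k) h)

theorem supp_pow {k : ℕ} {h : Tot S} (hh : U.b ^ k • h ∈ U.G) :
    supp (U.b ^ k • h) = supp h :=
  supp_nsmul (U.pow_ne_zero k) (U.dfin _ hh).ne_top

theorem supp_le_base {k : ℕ} {h : Tot S} (hh : U.b ^ k • h ∈ U.G) : supp h ≤ U.base := by
  rw [← U.supp_pow hh]
  exact U.supp_le _ hh

theorem psmul_mem {k : ℕ} {h : Tot S} (hh : U.b ^ k • h ∈ U.G) (p : Projection S) :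
    U.b ^ k • (p • h) ∈ U.G := by
  rw [← psmul_nsmul p _ (U.dfin _ hh).ne_top]
  exact U.psmul _ hh p

theorem exists_pow_div (k : ℕ) {g : Tot S} (hg : DFin g) (hs : supp g ≤ U.base) :
    ∃ h, U.b ^ k • h = g := by
  induction k with
  | zero => exact ⟨g, by simp⟩
  | succ k ih =>
    obtain ⟨h, rfl⟩ := ih
    have h1 : h ≤ U.b ^ k • h := le_nsmul (U.pow_ne_zero k) h
    obtain ⟨h', rfl⟩ := U.div h (hg.of_le h1) ((supp_mono h1 hg.ne_top).trans hs)
    exact ⟨h', by rw [pow_succ, mul_nsmul']⟩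

/-- Both `h` and `h'` are fractions of the same unit. Divide it by `b ^ (k + l)`; uniqueness of
division for directly finite elements shows that both are multiples of the result. -/
theorem exists_common {k l : ℕ} {h h' : Tot S} (hh : U.b ^ k • h ∈ U.G)
    (hh' : U.b ^ l • h' ∈ U.G) (hs : supp h = supp h') :
    ∃ w, U.b ^ (k + l) • w ∈ U.G ∧ supp w = supp h ∧ h = U.b ^ l • w ∧ h' = U.b ^ k • w := by
  have hg : U.b ^ k • h = U.b ^ l • h' := U.unique _ hh _ hh' (by
    rw [U.supp_pow hh, U.supp_pow hh', hs])
  have hF := U.dfin _ hh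
  obtain ⟨w, hw⟩ := U.exists_pow_div (k + l) hF (U.supp_le _ hh)
  have hwG : U.b ^ (k + l) • w ∈ U.G := by rw [hw]; exact hh
  have e1 : U.b ^ k • (U.b ^ l • w) = U.b ^ k • h := by rw [← mul_nsmul', ← pow_add, hw]
  have e2 : U.b ^ l • (U.b ^ k • w) = U.b ^ l • h' := by
    rw [← mul_nsmul', ← pow_add, add_comm l, hw, hg]
  refine ⟨w, hwG, ?_, ?_, ?_⟩
  · rw [← U.supp_pow hwG, hw, U.supp_pow hh]
  · refine (DFin.eq_of_nsmul_eq (U.pow_ne_zero k) ?_ (U.dfin_of_mem hh) e1 ?_).symm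
    · exact (U.dfin _ hh).of_le (by rw [← e1]; exact le_nsmul (U.pow_ne_zero k) _)
    · rw [e1]; exact hF.ne_top
  · refine (DFin.eq_of_nsmul_eq (U.pow_ne_zero l) ?_ (U.dfin_of_mem hh') e2 ?_).symm
    · exact (U.dfin _ hh').of_le (by rw [← e2]; exact le_nsmul (U.pow_ne_zero l) _)
    · rw [e2, ← hg]; exact hF.ne_top

theorem nsmul_le {k l m n : ℕ} {h h' : Tot S} (hh : U.b ^ k • h ∈ U.G)
    (hh' : U.b ^ l • h' ∈ U.G) (hs : supp h = supp h') (hle : U.val m k ≤ U.val n l) :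
    m • h ≤ n • h' := by
  obtain ⟨w, -, -, e1, e2⟩ := U.exists_common hh hh' hs
  rw [U.val_le] at hle
  rw [e1, e2, ← mul_nsmul', ← mul_nsmul']
  exact nsmul_mono_left hle w

/-- The units determined by `U`. -/
def A (c : F) (q : Projection S) (t : Tot S) : Prop :=
  (c = 0 ∧ t = 0) ∨ ∃ m k h, c = U.val m k ∧ U.b ^ k • h ∈ U.G ∧ supp h = q ∧ t = m • h ∧ t ≠ ⊤

theorem val_eq_zero {m k : ℕ} (h : U.val m k = 0) : m = 0 := by
  have := h.le
  rw [← U.val_zero k, U.val_le, zero_mul, Nat.le_zero, mul_eq_zero] at this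
  exact this.resolve_right (U.pow_ne_zero k)

variable {U}

/-- Bringing fractions to a common denominator turns comparison and addition of units into
statements about natural numbers. -/
theorem A.common {c d : F} {q : Projection S} {t s : Tot S} (ht : U.A c q t) (hs : U.A d q s) :
    (c = 0 ∧ d = 0 ∧ t = 0 ∧ s = 0) ∨ ∃ k m n w, U.b ^ k • w ∈ U.G ∧ supp w = q ∧ c = U.val m k ∧
      d = U.val n k ∧ t = m • w ∧ s = n • w ∧ t ≠ ⊤ ∧ s ≠ ⊤ := by
  rcases ht with ⟨rfl, rfl⟩ | ⟨m, k, h, rfl, hh, hq, rfl, htt⟩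
  · rcases hs with ⟨rfl, rfl⟩ | ⟨n, l, h', rfl, hh', hq', rfl, hst⟩
    · exact Or.inl ⟨rfl, rfl, rfl, rfl⟩
    · exact Or.inr ⟨l, 0, n, h', hh', hq', (U.val_zero l).symm, rfl, (zero_nsmul _).symm, rfl,
        zero_ne_top, hst⟩
  · rcases hs with ⟨rfl, rfl⟩ | ⟨n, l, h', rfl, hh', hq', rfl, hst⟩
    · exact Or.inr ⟨k, m, 0, h, hh, hq, rfl, (U.val_zero k).symm, rfl, (zero_nsmul _).symm,
        htt, zero_ne_top⟩
    · obtain ⟨w, hw, hwq, e1, e2⟩ := U.exists_common hh hh' (hq.trans hq'.symm)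
      refine Or.inr ⟨k + l, m * U.b ^ l, n * U.b ^ k, w, hw, hwq.trans hq, ?_, ?_, ?_, ?_, htt, hst⟩
      · apply le_antisymm <;> rw [U.val_le] <;> exact le_of_eq (by ring)
      · apply le_antisymm <;> rw [U.val_le] <;> exact le_of_eq (by ring)
      · rw [mul_nsmul', ← e1]
      · rw [mul_nsmul', ← e2]

theorem val_le_same {m n k : ℕ} : U.val m k ≤ U.val n k ↔ m ≤ n := by
  rw [U.val_le]
  exact Nat.mul_le_mul_right_iff (Nat.pos_of_ne_zero (U.pow_ne_zero k))

theorem A.dfin {c : F} {q : Projection S} {t : Tot S} (ht : U.A c q t) : DFin t := by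
  rcases ht with ⟨rfl, rfl⟩ | ⟨m, k, h, rfl, hh, hq, rfl, htt⟩
  · exact dfin_zero
  · exact (U.dfin_of_mem hh).nsmul htt

theorem A.psmul {c : F} {q : Projection S} {t : Tot S} (ht : U.A c q t) (p : Projection S) :
    U.A c (p ⊓ q) (p • t) := by
  rcases ht with ⟨rfl, rfl⟩ | ⟨m, k, h, rfl, hh, hq, rfl, htt⟩
  · exact Or.inl ⟨rfl, psmul_zero _⟩
  · exact Or.inr ⟨m, k, p • h, rfl, U.psmul_mem hh p,
      by rw [supp_psmul p (U.dfin_of_mem hh).ne_top, hq], psmul_nsmul p m htt, psmul_ne_top htt⟩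

theorem A.fixed {c : F} {q : Projection S} {t : Tot S} (ht : U.A c q t) : q • t = t := by
  rcases ht with ⟨rfl, rfl⟩ | ⟨m, k, h, rfl, hh, rfl, rfl, htt⟩
  · exact psmul_zero _
  · rw [psmul_nsmul _ _ htt, supp_psmul_self]

theorem A.le {c d : F} {q : Projection S} {t s : Tot S} (ht : U.A c q t) (hs : U.A d q s)
    (hcd : c ≤ d) : t ≤ s := by
  rcases ht.common hs with ⟨-, -, rfl, rfl⟩ | ⟨k, m, n, w, hw, hq, rfl, rfl, rfl, rfl, h1, h2⟩
  · exact le_rfl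
  · exact nsmul_mono_left (val_le_same.1 hcd) w

theorem A.eq_bot {c d : F} {q : Projection S} {t s : Tot S} (ht : U.A c q t) (hs : U.A d q s)
    (hcd : c < d) (hst : s ≤ t) : q = ⊥ := by
  rcases ht.common hs with ⟨rfl, rfl, -, -⟩ | ⟨k, m, n, w, hw, hq, rfl, rfl, rfl, rfl, h1, h2⟩
  · exact absurd hcd (lt_irrefl _)
  · have hmn : m + 1 ≤ n := not_lt.1 fun h =>
      absurd (val_le_same.2 (Nat.lt_succ_iff.1 h)) (not_le.2 hcd)
    have h3 : (m + 1) • w ≤ m • w := (nsmul_mono_left hmn w).trans hst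
    have hF := U.dfin_of_mem hw
    have h4 : w = 0 := hF.nsmul h1 w (le_antisymm (by rwa [add_comm, ← succ_nsmul]) le_add_self)
    rw [← hq, h4, supp_zero]

theorem A.add {c d : F} {q : Projection S} {t s : Tot S} (ht : U.A c q t) (hs : U.A d q s)
    (hts : t + s ≠ ⊤) : U.A (c + d) q (t + s) := by
  rcases ht.common hs with ⟨rfl, rfl, rfl, rfl⟩ | ⟨k, m, n, w, hw, hq, rfl, rfl, rfl, rfl, h1, h2⟩
  · exact Or.inl ⟨add_zero _, add_zero _⟩
  · exact Or.inr ⟨m + n, k, w, U.val_add m n k, hw, hq, (add_nsmul _ _ _).symm, hts⟩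

/-- The point is that `t + s` is defined: it is bounded by `u` after passage to common denominators.
-/
theorem A.add_eq {c d : F} {q : Projection S} {t s u : Tot S} (ht : U.A c q t) (hs : U.A d q s)
    (hu : U.A (c + d) q u) : t + s = u := by
  have hne : t + s ≠ ⊤ := by
    rcases ht.common hs with ⟨rfl, rfl, rfl, rfl⟩ | ⟨k, m, n, w, hw, hq, rfl, rfl, rfl, rfl, h1, h2⟩
    · rw [add_zero]; exact zero_ne_top
    · rcases hu with ⟨h0, rfl⟩ | ⟨n', l, h', he, hh', hq', rfl, hut⟩
      · rw [U.val_add] at h0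
        have := U.val_eq_zero h0
        rw [← add_nsmul, this, zero_nsmul]
        exact zero_ne_top
      · rw [U.val_add] at he
        rw [← add_nsmul]
        exact ne_top_of_le (U.nsmul_le hw hh' (hq.trans hq'.symm) he.le) hut
  exact le_antisymm ((ht.add hs hne).le hu le_rfl) (hu.le (ht.add hs hne) le_rfl)

variable (U)

/-- Write `q • x = q • y + z`, choose a fraction `h` of a unit below `z`, and divide `q • y` by `h`
with quotient `m` and remainder `ρ`. On a part `r` where `h ≤ ρ` holds nowhere, `ρ ≤ h`, so `y` is
at most `m + 1` copies of `h`. If two copies fit in `z`, then `x` contains `m + 2`; if `h` is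
multiple-free, the remainder vanishes on `r`, and `m`, `m + 1` separate. -/
theorem exists_sep {q : Projection S} {x y : Tot S} (hq : q ≤ U.base) (hq0 : q ≠ ⊥) (hx : x ≠ ⊤)
    (hy : y ≠ ⊤) (hF : DFin (q • y)) (hn : NowhereLE q x y) :
    ∃ r ≤ q, r ≠ ⊥ ∧ ∃ v c t s, v < c ∧ U.A c r t ∧ t ≤ x ∧ U.A v r s ∧ r • y ≤ s := by
  obtain ⟨z, hz⟩ := hn.le hx hy
  have hxt : q • x ≠ ⊤ := psmul_ne_top hx
  have hzt : z ≠ ⊤ := ne_top_of_le (hz ▸ le_add_self) hxt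
  have hz0 : z ≠ 0 := by
    rintro rfl
    rw [add_zero] at hz
    exact hq0 (hn q le_rfl hz.le)
  have hzq : supp z ≤ q := by
    refine (supp_mono (y := q • x) (by rw [hz]; exact le_add_self) hxt).trans ?_
    rw [supp_psmul q hx]; exact inf_le_left
  obtain ⟨k, h, hh, hh0, hhz, hor⟩ := U.sep z hz0 hzt (hzq.trans hq)
  obtain ⟨m, ρ, hρ, hhρ⟩ := hF.exists_eq_nsmul_add hh0
  have hht := (U.dfin_of_mem hh).ne_top
  have hyt := hF.ne_top
  have hρt : ρ ≠ ⊤ := ne_top_of_le (hρ ▸ le_add_self) hyt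
  obtain ⟨r, hr, hr0, hrn, hrle⟩ := exists_nowhereLE hht hρt hhρ
  have hrq : r ≤ q := hr.trans ((supp_mono hhz hzt).trans hzq)
  have hsupp : supp (r • h) = r := by rw [supp_psmul r hht, inf_eq_left.2 hr]
  have hmt : m • h ≠ ⊤ := ne_top_of_le (hρ ▸ le_self_add) hyt
  have hry : r • y = m • (r • h) + r • ρ := by
    rw [← psmul_of_le hrq, hρ, psmul_add r (hρ ▸ hyt), psmul_nsmul r m hmt]
  have hrx : r • x = r • y + r • z := by
    rw [← psmul_of_le hrq, hz, psmul_add r (hz ▸ hxt), psmul_of_le hrq]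
  have hmem := U.psmul_mem hh r
  have hrxt : r • x ≠ ⊤ := psmul_ne_top hx
  have hle1 : (m + 1) • (r • h) ≤ r • x := by
    rw [succ_nsmul, hrx, hry]
    exact add_le_add le_self_add (psmul_mono r hhz)
  rcases hor with h2 | hmf
  · have hle2 : (m + 2) • (r • h) ≤ r • x := by
      rw [add_nsmul, two_nsmul, hrx, hry, ← psmul_add r (ne_top_of_le h2 hzt)]
      exact add_le_add le_self_add (psmul_mono r h2)
    refine ⟨r, hrq, hr0, U.val (m + 1) k, U.val (m + 2) k, (m + 2) • (r • h), (m + 1) • (r • h),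
      lt_of_not_ge fun hle => ?_, Or.inr ⟨_, k, _, rfl, hmem, hsupp, rfl, ne_top_of_le hle2 hrxt⟩,
      hle2.trans (psmul_le _ _), Or.inr ⟨_, k, _, rfl, hmem, hsupp, rfl, ne_top_of_le hle1 hrxt⟩,
      ?_⟩
    · have := val_le_same.1 hle
      omega
    · rw [hry, succ_nsmul]
      exact add_le_add_right hrle _
  -- Complete `ρ` to `h` on `r` by `σ`, and compare the two. Where `ρ ≤ σ`, two copies of `ρ` lie in
  -- `h`, so `ρ` vanishes. Where `σ ≤ ρ`, likewise `σ` vanishes and `h = ρ`, which is excluded on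
  -- every nonzero part of `r`.
  · have hrρ : r • ρ = 0 := by
      obtain ⟨σ, hσ⟩ := hrle
      have hrht : r • h ≠ ⊤ := psmul_ne_top hht
      have hsum : ∀ p : Projection S, p • r • ρ + p • σ ≤ h := fun p => by
        rw [← psmul_add p (hσ ▸ hrht), ← hσ]
        exact (psmul_le _ _).trans (psmul_le _ _)
      obtain ⟨p, hp1, hp2⟩ := exists_comparable (psmul_ne_top (p := r) hρt)
        (ne_top_of_le (hσ ▸ le_add_self) hrht)
      have e1 : p • r • ρ = 0 := hmf _ ((add_le_add_right hp1 _).trans (hsum p))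
      have e2 : pᶜ • σ = 0 := hmf _ ((add_le_add_left hp2 _).trans (hsum pᶜ))
      have e3 : pᶜ ⊓ r = ⊥ := hrn _ inf_le_right (by
        rw [inf_psmul, hσ, psmul_add _ (hσ ▸ hrht), e2, add_zero, inf_psmul])
      have e4 : pᶜ • r • ρ = 0 := by rw [← inf_psmul, e3, bot_psmul hρt]
      rw [← psmul_add_compl_psmul p (r • ρ), e1, e4, add_zero]
    have hle0 : m • (r • h) ≤ r • x := (nsmul_mono_left (Nat.le_succ m) _).trans hle1
    refine ⟨r, hrq, hr0, U.val m k, U.val (m + 1) k, (m + 1) • (r • h), m • (r • h),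
      lt_of_not_ge fun hle => ?_, Or.inr ⟨_, k, _, rfl, hmem, hsupp, rfl, ne_top_of_le hle1 hrxt⟩,
      hle1.trans (psmul_le _ _), Or.inr ⟨_, k, _, rfl, hmem, hsupp, rfl, ne_top_of_le hle0 hrxt⟩,
      ?_⟩
    · have := val_le_same.1 hle
      omega
    · rw [hry, hrρ, add_zero]

/-- Divide `y` by a fraction `h` and pass to a part where `h` is nowhere below the remainder. A unit
below `y` with value above that of `m + 1` copies of `h` would, after cancellation of `m` copies,
put `h` below the remainder. -/
theorem exists_bound {q : Projection S} {y : Tot S} (hq : q ≤ U.base) (hq0 : q ≠ ⊥)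
    (hF : DFin (q • y)) :
    ∃ r ≤ q, r ≠ ⊥ ∧ ∃ v : F, ∀ p ≤ r, ∀ c, v < c → ∀ t, U.A c p t → t ≤ y → p = ⊥ := by
  by_cases hy0 : q • y = 0
  · refine ⟨q, le_rfl, hq0, 0, fun p hp c hc t ht hty => ?_⟩
    refine A.eq_bot (Or.inl ⟨rfl, rfl⟩) ht hc ?_
    rw [← ht.fixed, ← hy0]
    exact (psmul_mono p hty).trans (psmul_le_psmul hp y)
  have hyt := hF.ne_top
  have hyt' : y ≠ ⊤ := fun h => hyt (by rw [h]; rfl)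
  have hyq : supp (q • y) ≤ q := by rw [supp_psmul q hyt']; exact inf_le_left
  obtain ⟨k, h, hh, hh0, hhy, -⟩ := U.sep _ hy0 hyt (hyq.trans hq)
  obtain ⟨m, ρ, hρ, hhρ⟩ := hF.exists_eq_nsmul_add hh0
  have hht := (U.dfin_of_mem hh).ne_top
  have hρt : ρ ≠ ⊤ := ne_top_of_le (hρ ▸ le_add_self) hyt
  obtain ⟨r, hr, hr0, hrn, -⟩ := exists_nowhereLE hht hρt hhρ
  have hrq : r ≤ q := hr.trans ((supp_mono hhy hyt).trans hyq)
  have hmt : m • h ≠ ⊤ := ne_top_of_le (hρ ▸ le_self_add) hyt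
  refine ⟨r, hrq, hr0, U.val (m + 1) k, fun p hp c hc t ht hty => hrn p hp ?_⟩
  have hpmem := U.psmul_mem hh p
  have hps : supp (p • h) = p := by rw [supp_psmul p hht, inf_eq_left.2 (hp.trans hr)]
  have hpy : t ≤ m • (p • h) + p • ρ := by
    rw [← psmul_nsmul p m hmt, ← psmul_add p (hρ ▸ hyt), ← hρ, psmul_of_le (hp.trans hrq),
      ← ht.fixed]
    exact psmul_mono p hty
  have hpyt : m • (p • h) + p • ρ ≠ ⊤ := by
    rw [← psmul_nsmul p m hmt, ← psmul_add p (hρ ▸ hyt), ← hρ]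
    exact psmul_ne_top hyt
  have hle : (m + 1) • (p • h) ≤ t := by
    rcases ht with ⟨rfl, rfl⟩ | ⟨n, l, h', rfl, hh', hq', rfl, htt⟩
    · rw [← U.val_zero k] at hc
      have := (U.val_le _ _ _ _).1 hc.le
      rw [zero_mul, Nat.le_zero, mul_eq_zero] at this
      exact absurd (this.resolve_right (U.pow_ne_zero k)) (Nat.succ_ne_zero m)
    · exact U.nsmul_le hpmem hh' (hps.trans hq'.symm) hc.le
  have hdm : DFin (m • (p • h)) := (U.dfin_of_mem hpmem).nsmul (left_ne_top hpyt)
  have h3 := hle.trans hpy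
  rw [succ_nsmul, add_comm] at h3
  exact hdm.le_of_add_le_add_right (h3.trans (add_comm _ _).le) (by rwa [add_comm])

/-- The finite units determined by `U`. -/
def finUnits [CanonicallyOrderedAdd F] : FinUnits S F where
  base := U.base
  D := {c | ∃ m k, c = U.val m k}
  A := U.A
  mem_D := by
    rintro c q t (⟨rfl, rfl⟩ | ⟨m, k, h, rfl, -⟩)
    · exact ⟨0, 0, (U.val_zero 0).symm⟩
    · exact ⟨m, k, rfl⟩
  dfin := A.dfin
  fixed := A.fixed
  psmul p h := h.psmul p
  zero q := Or.inl ⟨rfl, rfl⟩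
  le_base := by
    rintro c q t (⟨rfl, rfl⟩ | ⟨m, k, h, rfl, hh, rfl, -⟩) hc
    · exact absurd hc (lt_irrefl _)
    · exact U.supp_le_base hh
  le := A.le
  eq_bot := A.eq_bot
  add := A.add
  add_eq := A.add_eq
  add_mem := by
    rintro _ _ ⟨m, k, rfl⟩ ⟨n, l, rfl⟩
    refine ⟨m * U.b ^ l + n * U.b ^ k, k + l, ?_⟩
    rw [← U.val_add]
    congr 1 <;> apply le_antisymm <;> rw [U.val_le] <;> exact le_of_eq (by ring)
  exists_of_le := by
    rintro c d q s hs hq ⟨m, k, rfl⟩ hcd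
    rcases hs with ⟨rfl, rfl⟩ | ⟨n, l, h', rfl, hh', hq', rfl, hst⟩
    · exact ⟨q, le_rfl, hq, 0, Or.inl ⟨le_antisymm hcd (zero_le), rfl⟩⟩
    · obtain ⟨h, hh⟩ := U.exists_pow_div k (U.dfin _ hh') (U.supp_le _ hh')
      have hhG : U.b ^ k • h ∈ U.G := hh ▸ hh'
      have hsq : supp h = q := by rw [← U.supp_pow hhG, hh, U.supp_pow hh', hq']
      exact ⟨q, le_rfl, hq, m • h, Or.inr ⟨m, k, h, rfl, hhG, hsq, rfl,
        ne_top_of_le (U.nsmul_le hhG hh' (hsq.trans hq'.symm) hcd) hst⟩⟩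
  exists_of_pinf := by
    rintro c s hs hst hs0 hsb ⟨m, k, rfl⟩
    -- One fraction of a unit below `s` suffices: `s` absorbs all its multiples, so every required
    -- multiple is defined.
    obtain ⟨l, h', hh', h0, hle, -⟩ := U.sep s hs0 hst hsb
    obtain ⟨h, hh⟩ := U.exists_pow_div k (U.dfin _ hh') (U.supp_le _ hh')
    have hhG : U.b ^ k • h ∈ U.G := hh ▸ hh'
    have hhs : h ≤ s := (le_nsmul (U.pow_ne_zero k) h).trans
      (hh.le.trans ((nsmul_le_nsmul_right hle _).trans (hs.nsmul_le _)))
    refine ⟨supp h, supp_mono hhs hst, fun hb => h0 ?_, m • h,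
      Or.inr ⟨m, k, h, rfl, hhG, rfl, rfl,
        ne_top_of_le ((nsmul_le_nsmul_right hhs m).trans (hs.nsmul_le m)) hst⟩⟩
    rw [← U.supp_pow hhG, hh, U.supp_pow hh'] at hb
    exact (supp_eq_bot (U.dfin_of_mem hh').ne_top).1 hb
  dense := by
    intro a b hab
    obtain ⟨m, k, h1, h2⟩ := U.dense hab
    exact ⟨_, ⟨m, k, rfl⟩, h1, h2⟩
  covBy := U.covBy
  exists_gt := fun {a} _ => U.exists_gt a
  sep hq hq0 hx hy hF hn := Or.inl (U.exists_sep hq hq0 hx hy hF hn)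
  bounded := U.exists_bound
  exists_lub := U.exists_lub

end UnitData

end

end PartialCommMonoid

/-! ### The projections onto the three types, and their units. -/

namespace PartialCommMonoid

open Projection Tot

section

variable {S : Type u} [PartialCommMonoid S] [hS : Fact (IsContinuousDimensionScale S)]

namespace Projection

theorem mem_range_iff {p : Projection S} {x : S} :
    x ∈ Set.range p ↔ p • (Tot.of x) = Tot.of x := by
  rw [smul_of]
  constructor
  · rintro ⟨y, rfl⟩
    rw [p.idem]
  · intro h
    exact ⟨x, of_injective h⟩

theorem range_compl (p : Projection S) : Set.range (pᶜ : Projection S) = perp (Set.range p) :=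
  (isPerp_iff.2 rfl).1

theorem range_inf (p q : Projection S) : Set.range (p ⊓ q : Projection S) = Set.range p ∩ Set.range q := by
  ext x
  rw [Set.mem_inter_iff, mem_range_iff, mem_range_iff, mem_range_iff, inf_psmul_eq_iff]

variable (S) in
theorem exists_polar_mfree : ∃ p : Projection S, ∀ x : Tot S, x ≠ ⊤ →
    (p • x = x ↔ ∀ a, MFree a → Disjoint x a) :=
  exists_polar {a | MFree a} fun _ ha => (MFree.dfin ha).ne_top

variable (S) in
theorem exists_polar_dfin : ∃ p : Projection S, ∀ x : Tot S, x ≠ ⊤ →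
    (p • x = x ↔ ∀ a, DFin a → Disjoint x a) :=
  exists_polar {a | DFin a} fun _ ha => DFin.ne_top ha

variable (S) in
/-- The projection onto the elements that are orthogonal to all multiple-free elements. -/
noncomputable def polarMFree : Projection S := (exists_polar_mfree S).choose

variable (S) in
/-- The projection onto the type III part. -/
noncomputable def typeThree : Projection S := (exists_polar_dfin S).choose

variable (S) in
/-- The projection onto the type I part. -/
noncomputable def typeOne : Projection S := (polarMFree S)ᶜ

variable (S) in
/-- The projection onto the type II part. -/
noncomputable def typeTwo : Projection S := polarMFree S ⊓ (typeThree S)ᶜ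

theorem polarMFree_psmul_eq_iff {x : Tot S} (hx : x ≠ ⊤) :
    polarMFree S • x = x ↔ ∀ a, MFree a → Disjoint x a :=
  (exists_polar_mfree S).choose_spec x hx

theorem typeThree_psmul_eq_iff {x : Tot S} (hx : x ≠ ⊤) :
    typeThree S • x = x ↔ ∀ a, DFin a → Disjoint x a :=
  (exists_polar_dfin S).choose_spec x hx

theorem typeThree_le_polarMFree : typeThree S ≤ polarMFree S := by
  rw [le_iff_fixed]
  intro x hx h
  rw [polarMFree_psmul_eq_iff hx]
  exact fun a ha => (typeThree_psmul_eq_iff hx).1 h a ha.dfin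

theorem range_polarMFree : Set.range (polarMFree S) = perp {a | MultipleFree a} := by
  ext x
  rw [mem_range_iff, polarMFree_psmul_eq_iff (of_ne_top x)]
  constructor
  · intro h a ha
    exact orth_iff.2 (h _ (mfree_of.2 ha))
  · intro h a ha
    obtain ⟨a, rfl⟩ := exists_of ha.dfin.ne_top
    exact orth_iff.1 (h a (mfree_of.1 ha))

theorem range_typeThree : Set.range (typeThree S) = typeIII S := by
  ext x
  rw [mem_range_iff, typeThree_psmul_eq_iff (of_ne_top x)]
  constructor
  · intro h a ha
    exact orth_iff.2 (h _ (dfin_of.2 ha))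
  · intro h a ha
    obtain ⟨a, rfl⟩ := exists_of ha.ne_top
    exact orth_iff.1 (h a (dfin_of.1 ha))

theorem range_typeOne : Set.range (typeOne S) = typeI S := by
  rw [typeOne, range_compl, range_polarMFree]
  rfl

theorem range_typeTwo : Set.range (typeTwo S) = typeII S := by
  rw [typeTwo, range_inf, range_compl, range_polarMFree, range_typeThree]
  rfl

theorem disjoint_typeOne_typeTwo : Disjoint (typeOne S) (typeTwo S) :=
  disjoint_compl_left.mono_right inf_le_left

theorem disjoint_typeOne_typeThree : Disjoint (typeOne S) (typeThree S) :=
  disjoint_compl_left.mono_right typeThree_le_polarMFree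

theorem disjoint_typeTwo_typeThree : Disjoint (typeTwo S) (typeThree S) :=
  disjoint_compl_left.mono_left inf_le_right

theorem types_sup : typeOne S ⊔ typeTwo S ⊔ typeThree S = ⊤ := by
  rw [typeOne, typeTwo, sup_inf_left, compl_sup_eq_top, top_inf_eq, sup_assoc, compl_sup_eq_top,
    sup_top_eq]

end Projection

theorem Tot.eq_zero_of_psmul_compl {p : Projection S} {x : Tot S} (hx : x ≠ ⊤) (h : p • x = x)
    (h' : supp x ≤ pᶜ) : x = 0 := by
  rw [← supp_eq_bot hx]
  exact eq_bot_of_le_of_le_compl (supp_le_iff.2 h) h'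

theorem Tot.eq_zero_of_dfin_typeThree {x : Tot S} (hx : DFin x) (h : supp x ≤ typeThree S) :
    x = 0 :=
  eq_zero_of_disjoint_self ((typeThree_psmul_eq_iff hx.ne_top).1 (supp_le_iff.1 h) x hx)

theorem Tot.MFree.eq_zero_of_typeTwo {x : Tot S} (hx : MFree x) (h : supp x ≤ typeTwo S) :
    x = 0 :=
  eq_zero_of_disjoint_self ((polarMFree_psmul_eq_iff hx.dfin.ne_top).1
    (supp_le_iff.1 (h.trans inf_le_left)) x hx)

/-- Otherwise `z` is orthogonal to all multiple-free elements, although its support lies in the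
complement of that polar. -/
theorem Tot.exists_mfree_le {z : Tot S} (hz : z ≠ 0) (hzt : z ≠ ⊤) (h : supp z ≤ typeOne S) :
    ∃ x ≤ z, x ≠ 0 ∧ MFree x := by
  by_contra! hc
  refine hz (eq_zero_of_psmul_compl hzt ((polarMFree_psmul_eq_iff hzt).2 fun a ha => ?_) h)
  rw [Tot.disjoint_iff]
  intro x hxz hxa
  by_contra h0
  exact hc x hxz h0 (ha.of_le hxa)

theorem Tot.exists_dfin_le {z : Tot S} (hz : z ≠ 0) (hzt : z ≠ ⊤) (h : supp z ≤ (typeThree S)ᶜ) :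
    ∃ x ≤ z, x ≠ 0 ∧ DFin x := by
  by_contra! hc
  refine hz (eq_zero_of_psmul_compl hzt ((typeThree_psmul_eq_iff hzt).2 fun a ha => ?_) h)
  rw [Tot.disjoint_iff]
  intro x hxz hxa
  by_contra h0
  exact hc x hxz h0 (ha.of_le hxa)

/-! ### Units of type I -/

theorem Tot.MFree.disjoint {x y z : Tot S} (hz : MFree z) (h : x + y ≤ z) : Disjoint x y := by
  rw [Tot.disjoint_iff]
  exact fun t hx hy => hz t ((add_le_add hx hy).trans h)

/-- The two summands of a multiple-free element are disjoint, so the difference has support both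
inside that of `x` and disjoint from it. -/
theorem Tot.MFree.eq_of_le {x y : Tot S} (hy : MFree y) (h : x ≤ y) (hs : supp y ≤ supp x) :
    x = y := by
  obtain ⟨r, rfl⟩ := h
  have ht := hy.dfin.ne_top
  have hd := hy.disjoint le_rfl
  rw [disjoint_iff_supp (left_ne_top ht) (right_ne_top ht)] at hd
  have hr : supp r ≤ supp x := (supp_mono le_add_self ht).trans hs
  have hr0 : r = 0 := by
    rw [← supp_eq_bot (right_ne_top ht)]
    exact disjoint_self.1 (hd.mono_left hr)
  rw [hr0, add_zero]

theorem Tot.MFree.unique {x y : Tot S} (hx : MFree x) (hy : MFree y) (hs : supp x = supp y) :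
    x = y := by
  have hxt := hx.dfin.ne_top
  have hyt := hy.dfin.ne_top
  obtain ⟨p, h1, h2⟩ := exists_comparable hxt hyt
  refine eq_of_psmul p ((hy.of_le (psmul_le _ _)).eq_of_le h1 ?_)
    ((hx.of_le (psmul_le _ _)).eq_of_le h2 ?_).symm
  · rw [supp_psmul p hxt, supp_psmul p hyt, hs]
  · rw [supp_psmul _ hxt, supp_psmul _ hyt, hs]

variable (S) in
/-- The unit data of type I. -/
noncomputable def unitDataOne : UnitData S ℕ where
  base := typeOne S
  G := {g | MFree g ∧ supp g ≤ typeOne S}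
  -- No subdivision is needed in type I; the parameter `k` is a dummy there.
  b := 1
  val m _ := m
  b_ne_zero := one_ne_zero
  dfin g hg := hg.1.dfin
  supp_le g hg := hg.2
  psmul g hg p := ⟨hg.1.of_le (psmul_le _ _), by
    rw [supp_psmul p hg.1.dfin.ne_top]
    exact inf_le_right.trans hg.2⟩
  unique g hg h hh := hg.1.unique hh.1
  div g _ _ := ⟨g, one_nsmul g⟩
  sep z hz hzt hzs := by
    obtain ⟨h, hle, h0, hm⟩ := exists_mfree_le hz hzt hzs
    refine ⟨0, h, ?_, h0, hle, Or.inr hm⟩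
    rw [pow_zero, one_nsmul]
    exact ⟨hm, (supp_mono hle hzt).trans hzs⟩
  val_le := by simp
  val_zero _ := rfl
  val_add _ _ _ := rfl
  dense {a b} h := ⟨b, 0, h, le_rfl⟩
  covBy {a b} _ := ⟨a, 0, rfl⟩
  exists_gt a := ⟨a + 1, Nat.lt_succ_self a⟩
  exists_lub s hs := ⟨sSup s, isLUB_csSup' hs⟩

/-! ### Units of type II -/

/-- Choose `t` maximal with `t + t ≤ x`. If `z + z` fits in the remainder, then `t + z` competes
with `t`, so `z` is absorbed by `t` and vanishes. Hence the remainder is multiple-free, and in type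
II it is zero. -/
theorem Tot.DFin.exists_half {x : Tot S} (hx : DFin x) (h : supp x ≤ typeTwo S) :
    ∃ t, 2 • t = x := by
  have hxt := hx.ne_top
  have hle : ∀ {s t w : Tot S}, s + t ≤ x → x = s + w → t ≤ w := by
    intro s t w h1 h2
    have hs : DFin s := hx.of_le (h2 ▸ le_self_add)
    refine hs.le_of_add_le_add_right (b := w) ?_ ?_
    · rwa [add_comm t, add_comm w, ← h2]
    · rwa [add_comm w, ← h2]
  obtain ⟨t, ht⟩ := zorn_le₀ {t : Tot S | t + t ≤ x} (fun c hc hchain => by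
    -- The bound is carried to the supremum one summand at a time: with `x = s + w`, cancellation
    -- turns `s + t ≤ x` into `t ≤ w`, which passes to suprema in `t`.
    have h1 : ∀ s ∈ c, ∀ t ∈ c, s + t ≤ x := by
      intro s hs t ht
      rcases hchain.total hs ht with h | h
      · exact (add_le_add_left h t).trans (hc ht)
      · exact (add_le_add_right h s).trans (hc hs)
    have h2 : ∀ s ∈ c, s + sSup c ≤ x := by
      intro s hs
      obtain ⟨w, hw⟩ : s ≤ x := le_self_add.trans (h1 s hs s hs)
      have : sSup c ≤ w := sSup_le fun t ht => hle (h1 s hs t ht) hw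
      rw [hw]
      exact add_le_add_right this s
    refine ⟨sSup c, ?_, fun s hs => le_sSup hs⟩
    obtain ⟨w, hw⟩ : sSup c ≤ x := sSup_le fun s hs => le_self_add.trans (h1 s hs s hs)
    have : sSup c ≤ w := sSup_le fun s hs => hle (by rw [add_comm]; exact h2 s hs) hw
    change sSup c + sSup c ≤ x
    conv_rhs => rw [hw]
    exact add_le_add_right this _)
  obtain ⟨r, hr⟩ := ht.prop
  have hr0 : r = 0 := by
    have hrx : r ≤ x := hr ▸ le_add_self
    have hm : MFree r := by
      intro z hz
      have htz : (t + z) + (t + z) ≤ x := by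
        rw [hr, add_add_add_comm]
        exact add_le_add_right hz _
      have hts : t ≤ x := le_self_add.trans ht.prop
      exact (hx.of_le hts) z (le_antisymm (by
        rw [add_comm]; exact ht.le_of_ge htz le_self_add) le_add_self)
    exact hm.eq_zero_of_typeTwo ((supp_mono hrx hxt).trans h)
  exact ⟨t, by rw [two_nsmul, hr, hr0, add_zero]⟩

theorem Tot.DFin.exists_pow_half {x : Tot S} (hx : DFin x) (h : supp x ≤ typeTwo S) (k : ℕ) :
    ∃ t, 2 ^ k • t = x := by
  induction k with
  | zero => exact ⟨x, by simp⟩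
  | succ k ih =>
    obtain ⟨t, rfl⟩ := ih
    have h1 : t ≤ 2 ^ k • t := le_nsmul (by positivity) t
    obtain ⟨t', rfl⟩ := (hx.of_le h1).exists_half ((supp_mono h1 hx.ne_top).trans h)
    exact ⟨t', by rw [pow_succ, mul_nsmul']⟩

/-- Sets of pairwise compatible directly finite elements of type II. -/
def IsCompatible (W : Set (Tot S)) : Prop :=
  (∀ g ∈ W, DFin g ∧ supp g ≤ typeTwo S) ∧ ∀ g ∈ W, ∀ h ∈ W, supp h • g = supp g • h

variable (S) in
theorem exists_maximal_isCompatible : ∃ W : Set (Tot S), Maximal IsCompatible W :=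
  zorn_subset {W | IsCompatible W} fun c hc hchain => ⟨⋃₀ c, ⟨by
    rintro g ⟨W, hW, hg⟩
    exact (hc hW).1 g hg, by
    rintro g ⟨W, hW, hg⟩ h ⟨W', hW', hh⟩
    rcases hchain.total hW hW' with hle | hle
    · exact (hc hW').2 g (hle hg) h hh
    · exact (hc hW).2 g hg h (hle hh)⟩, fun _ => Set.subset_sUnion_of_mem⟩

theorem mem_of_maximal_isCompatible {W : Set (Tot S)} (hW : Maximal IsCompatible W) {x : Tot S}
    (hx : DFin x) (hs : supp x ≤ typeTwo S) (hc : ∀ g ∈ W, supp x • g = supp g • x) : x ∈ W := by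
  have hI : IsCompatible (insert x W) := by
    refine ⟨?_, ?_⟩
    · rintro g (rfl | hg)
      · exact ⟨hx, hs⟩
      · exact hW.prop.1 g hg
    · rintro g (rfl | hg) h (rfl | hh)
      · rfl
      · exact (hc h hh).symm
      · exact hc g hg
      · exact hW.prop.2 g hg h hh
  exact hW.le_of_ge hI (Set.subset_insert _ _) (Set.mem_insert _ _)

variable (S) in
/-- A set of units of type II. -/
noncomputable def unitsTwo : Set (Tot S) := (exists_maximal_isCompatible S).choose

theorem maximal_unitsTwo : Maximal IsCompatible (unitsTwo S) :=
  (exists_maximal_isCompatible S).choose_spec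

theorem psmul_mem_unitsTwo {g : Tot S} (hg : g ∈ unitsTwo S) (p : Projection S) :
    p • g ∈ unitsTwo S := by
  obtain ⟨h1, h2⟩ := maximal_unitsTwo.prop.1 g hg
  refine mem_of_maximal_isCompatible maximal_unitsTwo (h1.psmul p) ?_ fun h hh => ?_
  · rw [supp_psmul p h1.ne_top]
    exact inf_le_right.trans h2
  · rw [supp_psmul p h1.ne_top, inf_psmul, ← maximal_unitsTwo.prop.2 g hg h hh, psmul_comm]

/-- An element whose support misses those of all members is compatible with all of them, and by
maximality it would be a member itself. -/
theorem exists_mem_unitsTwo {x : Tot S} (hx : DFin x) (hs : supp x ≤ typeTwo S) (h0 : x ≠ 0) :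
    ∃ g ∈ unitsTwo S, supp g ⊓ supp x ≠ ⊥ := by
  by_contra! hc
  have hm : x ∈ unitsTwo S := by
    refine mem_of_maximal_isCompatible maximal_unitsTwo hx hs fun g hg => ?_
    have hgt := (maximal_unitsTwo.prop.1 g hg).1.ne_top
    rw [(psmul_eq_zero_iff hx.ne_top).2 (hc g hg),
      (psmul_eq_zero_iff hgt).2 (by rw [inf_comm, hc g hg])]
  have := hc x hm
  rw [inf_idem] at this
  exact h0 ((supp_eq_bot hx.ne_top).1 this)

/-- Halve a unit meeting a directly finite `x ≤ z`. If `x` stayed below all these fractions on the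
common support, its multiples would all lie below the unit, against the Archimedean property. So
some fraction falls below `x` on a part, and one more halving makes two copies fit. -/
theorem unitsTwo_sep {z : Tot S} (hz : z ≠ 0) (hzt : z ≠ ⊤) (hzs : supp z ≤ typeTwo S) :
    ∃ (k : ℕ) (h : Tot S), 2 ^ k • h ∈ unitsTwo S ∧ h ≠ 0 ∧ h + h ≤ z := by
  obtain ⟨x, hxz, hx0, hx⟩ := exists_dfin_le hz hzt (hzs.trans inf_le_right)
  have hxs := (supp_mono hxz hzt).trans hzs
  obtain ⟨g, hg, hgx⟩ := exists_mem_unitsTwo hx hxs hx0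
  obtain ⟨hgF, hgs⟩ := maximal_unitsTwo.prop.1 g hg
  set p := supp g ⊓ supp x with hp
  have hgp : supp (p • g) = p := by rw [supp_psmul p hgF.ne_top, inf_eq_left]; exact inf_le_left
  have hxp : supp (p • x) = p := by rw [supp_psmul p hx.ne_top, inf_eq_left]; exact inf_le_right
  have hpt : p ≤ typeTwo S := inf_le_left.trans hgs
  have hex : ∃ (k : ℕ) (h : Tot S), 2 ^ k • h = p • g ∧ ¬ p • x ≤ h := by
    by_contra! hc
    refine hgx ?_
    rw [← hxp, supp_eq_bot (hx.psmul p).ne_top]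
    refine (hgF.psmul p).eq_zero_of_forall_nsmul_le fun n => ?_
    obtain ⟨h, hh⟩ := (hgF.psmul p).exists_pow_half (hgp.le.trans hpt) n
    refine (nsmul_mono_left (Nat.lt_two_pow_self).le _).trans ?_
    rw [← hh]
    exact nsmul_le_nsmul_right (hc n h hh) _
  obtain ⟨k, h, hh, hxh⟩ := hex
  have hhF : DFin h := (hgF.psmul p).of_le (hh ▸ le_nsmul (by positivity) h)
  have hhs : supp h = p := by
    rw [← hgp, ← hh, supp_nsmul (by positivity)]
    rw [hh]; exact (hgF.psmul p).ne_top
  obtain ⟨q, hq, hq0, -, hle⟩ := exists_nowhereLE (hx.psmul p).ne_top hhF.ne_top hxh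
  rw [hxp] at hq
  obtain ⟨h', rfl⟩ := hhF.exists_half (hhs.le.trans hpt)
  have h3 : 2 ^ (k + 1) • h' = p • g := by rw [pow_succ, mul_nsmul', hh]
  refine ⟨k + 1, q • h', ?_, fun h0 => hq0 ?_, ?_⟩
  · rw [← psmul_nsmul q _ (by rw [h3]; exact (hgF.psmul p).ne_top), h3]
    exact psmul_mem_unitsTwo (psmul_mem_unitsTwo hg p) q
  · have h4 : q • (2 • h') = 0 := by rw [psmul_nsmul q _ hhF.ne_top, h0, nsmul_zero]
    rw [psmul_eq_zero_iff hhF.ne_top, hhs, inf_eq_left.2 hq] at h4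
    exact h4
  · rw [← two_nsmul, ← psmul_nsmul q _ hhF.ne_top]
    exact hle.trans ((psmul_le _ _).trans ((psmul_le _ _).trans hxz))

theorem _root_.NNReal.exists_dyadic {a b : NNReal} (h : a < b) :
    ∃ m k : ℕ, a < (m : NNReal) / 2 ^ k ∧ (m : NNReal) / 2 ^ k ≤ b := by
  obtain ⟨c, hc⟩ := exists_add_of_le h.le
  have hc0 : 0 < c := by
    refine pos_iff_ne_zero.2 fun h0 => ?_
    rw [hc, h0, add_zero] at h
    exact lt_irrefl _ h
  obtain ⟨k, hk⟩ := exists_pow_lt_of_lt_one hc0 (y := (1 / 2 : NNReal)) (by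
    rw [div_lt_one two_pos]; exact one_lt_two)
  have hpos : (0 : NNReal) < 2 ^ k := by positivity
  -- The largest multiple of `1 / 2 ^ k` not above `b`; it exceeds `a` because `k` was chosen with
  -- `1 / 2 ^ k` smaller than `c = b - a`.
  refine ⟨⌊b * 2 ^ k⌋₊, k, ?_, ?_⟩
  · rw [lt_div_iff₀ hpos]
    have h1 := Nat.lt_floor_add_one (b * 2 ^ k)
    have h2 : 1 < c * 2 ^ k := by
      rw [one_div, inv_pow] at hk
      rw [inv_lt_iff_one_lt_mul₀ hpos] at hk
      linarith [mul_comm c (2 ^ k)]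
    rw [hc, add_mul] at h1 ⊢
    have h3 := (add_lt_add_right h2 (a * 2 ^ k)).trans h1
    exact lt_of_add_lt_add_right h3
  · rw [div_le_iff₀ hpos]
    exact Nat.floor_le zero_le

variable (S) in
/-- The unit data of type II. -/
noncomputable def unitDataTwo : UnitData S NNReal where
  base := typeTwo S
  G := unitsTwo S
  b := 2
  val m k := m / 2 ^ k
  b_ne_zero := two_ne_zero
  dfin g hg := (maximal_unitsTwo.prop.1 g hg).1
  supp_le g hg := (maximal_unitsTwo.prop.1 g hg).2
  psmul g hg p := psmul_mem_unitsTwo hg p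
  unique g hg h hh hs := by
    rw [← supp_psmul_self g, hs, maximal_unitsTwo.prop.2 g hg h hh, hs, supp_psmul_self]
  div g hg hs := hg.exists_half hs
  sep z hz hzt hzs := by
    obtain ⟨k, h, h1, h2, h3⟩ := unitsTwo_sep hz hzt hzs
    exact ⟨k, h, h1, h2, le_self_add.trans h3, Or.inl h3⟩
  val_le m n k l := by
    rw [div_le_div_iff₀ (by positivity) (by positivity)]
    exact_mod_cast Iff.rfl
  val_zero k := by simp
  val_add m n k := by rw [Nat.cast_add, add_div]
  dense h := NNReal.exists_dyadic h
  covBy {a b} h := absurd h (not_covBy)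
  exists_gt a := ⟨a + 1, lt_add_of_pos_right a one_pos⟩
  exists_lub s hs := ⟨sSup s, isLUB_csSup' hs⟩

/-! ### Units of type III -/

variable (S) in
/-- The finite units of type III. -/
noncomputable def finUnitsThree : FinUnits S PUnit where
  base := typeThree S
  D := Set.univ
  A _ _ t := t = 0
  mem_D _ := trivial
  dfin := by rintro _ _ _ rfl; exact dfin_zero
  fixed := by rintro _ _ _ rfl; exact psmul_zero _
  psmul := by rintro _ _ _ p rfl; exact psmul_zero _
  zero _ := rfl
  le_base := fun _ h => absurd h (lt_irrefl _)
  le := by rintro _ _ _ _ _ rfl rfl _; exact le_rfl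
  eq_bot := fun _ _ h => absurd h (lt_irrefl _)
  add := by rintro _ _ _ _ _ rfl rfl _; exact add_zero _
  add_eq := by rintro _ _ _ _ _ _ rfl rfl rfl; exact add_zero _
  add_mem _ _ := trivial
  exists_of_le := fun {_ _ q _} _ hq _ _ => ⟨q, le_rfl, hq, 0, rfl⟩
  exists_of_pinf := fun {_ s} _ hst hs _ _ =>
    ⟨supp s, le_rfl, fun h => hs ((supp_eq_bot hst).1 h), 0, rfl⟩
  dense := fun h => absurd h (lt_irrefl _)
  covBy _ := trivial
  exists_gt := fun h => absurd trivial h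
  sep := by
    intro q x y hq hq0 hx hy hF hn
    -- Nothing nonzero of type III is directly finite: `y` vanishes on `q`, and `x` loses its finite
    -- part there and is left purely infinite.
    have hz : ∀ w : Tot S, w ≠ ⊤ → DFin (q • w) → q • w = 0 := fun w hw hF =>
      eq_zero_of_dfin_typeThree hF (by rw [supp_psmul q hw]; exact inf_le_left.trans hq)
    refine Or.inr ⟨q, le_rfl, hq0, hz y hy hF, ?_⟩
    obtain ⟨p, hp, hp'⟩ := exists_dfin_pinf hx
    refine PInf.of_psmul p ?_ ?_
    · rw [psmul_comm, hz _ (psmul_ne_top hx) (hp.psmul q)]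
      exact pinf_zero
    · rw [psmul_comm]
      exact hp'.psmul (psmul_ne_top hx) q
  bounded := fun {q _} _ hq0 _ =>
    ⟨q, le_rfl, hq0, 0, fun _ _ _ h => absurd h (lt_irrefl _)⟩
  exists_lub s _ := ⟨0, fun _ _ => le_rfl, fun _ _ => le_rfl⟩

end

end PartialCommMonoid

/-! ### From values back to sums, and the embedding. -/

theorem AlephExt.add_eq_of_idem {F : Type} {γ : Ordinal.{w}} [AddCommMonoid F] [LinearOrder F]
    [CanonicallyOrderedAdd F] [IsLeftCancelAdd F] {x y : AlephExt F γ} (hxy : x ≤ y)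
    (h : (x + y) + (x + y) = x + y) : x + y = y := by
  rcases x with x | x <;> rcases y with y | y
  · have h1 : (x + y) + (x + y) = x + y := by
      rw [fin_add_fin, fin_add_fin] at h
      exact fin.inj h
    have h2 : x + y = 0 := add_left_cancel (h1.trans (add_zero (x + y)).symm)
    have h3 : x = 0 := le_antisymm (le_self_add.trans h2.le) zero_le
    rw [fin_add_fin, h3, zero_add]
  · rfl
  · exact absurd (fin_lt_aleph y x) (not_lt.2 hxy)
  · rw [aleph_add_aleph, max_eq_right (aleph_le_aleph.1 hxy)]

theorem AlephExt.add_left_cancel_of_fin {F : Type} {γ : Ordinal.{w}} [AddCommMonoid F]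
    [IsLeftCancelAdd F] {x y z : AlephExt F γ} {v : F} (h : x + y = fin v) (h' : x + z = fin v) :
    y = z := by
  rcases x with x | x <;> rcases y with y | y <;> rcases z with z | z <;>
    first
    | exact congrArg fin (add_left_cancel (fin.inj (h.trans h'.symm)))
    | (cases h; done)
    | (cases h'; done)

namespace PartialCommMonoid

theorem mem_padd_iff {M : Type u} [AddCommMonoid M] {a b c : M} : c ∈ a +ₚ b ↔ c = a + b :=
  Part.mem_some_iff

theorem algLE_iff_exists {M : Type u} [AddCommMonoid M] {a b : M} : a ≼ b ↔ ∃ x, b = a + x :=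
  exists_congr fun _ => mem_padd_iff

open Projection Tot

section

variable {S : Type u} [PartialCommMonoid S] [hS : Fact (IsContinuousDimensionScale S)]

namespace UnitSystem

variable {K : Type v} [LinearOrder K] [AddCommMonoid K] [TopologicalSpace K] [OrderTopology K]
  [CanonicallyOrderedAdd K] (E : UnitSystem S K)

/-- The continuous function that represents `x` on the part that carries the units. -/
noncomputable def toMap (x : Tot S) : C(basicSet E.base, K) :=
  ⟨fun ω => E.val x ω.1, (continuous_val x).comp continuous_subtype_val⟩

variable {E}

theorem toMap_apply (x : Tot S) (ω : basicSet E.base) : E.toMap x ω = E.val x ω.1 := rfl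

theorem val_zero (ω : UltrafilterSpace (Projection S)) : E.val 0 ω = 0 := by
  rw [← psmul_zero (⊥ : Projection S)]
  exact val_psmul_of_notMem (UltrafilterSpace.bot_notMem ω) zero_ne_top

theorem toMap_zero [ContinuousAdd K] : E.toMap (0 : Tot S) = 0 :=
  ContinuousMap.ext fun ω => val_zero ω.1

theorem toMap_add [ContinuousAdd K] {x y : Tot S} (h : x + y ≠ ⊤) :
    E.toMap (x + y) = E.toMap x + E.toMap y :=
  ContinuousMap.ext fun ω => val_add h ω.1

theorem psmul_le_of_toMap_algLE [ContinuousAdd K] {x y : Tot S} (hx : x ≠ ⊤) (hy : y ≠ ⊤)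
    (h : E.toMap x ≼ E.toMap y) : E.base • x ≤ E.base • y := by
  obtain ⟨z, hz⟩ := algLE_iff_exists.1 h
  refine psmul_base_le_of_val_le hx hy fun ω hω => ?_
  have := DFunLike.congr_fun hz ⟨ω, hω⟩
  exact le_self_add.trans this.ge

theorem exists_toMap_eq [ContinuousAdd K] {x : Tot S} (hx : x ≠ ⊤) {g : C(basicSet E.base, K)}
    (h : g ≼ E.toMap x) : ∃ y ≤ x, E.base • y = y ∧ E.toMap y = g := by
  classical
  obtain ⟨z, hz⟩ := algLE_iff_exists.1 h
  have hgx : ∀ ω, g ω ≤ E.val x ω.1 := fun ω => by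
    have := DFunLike.congr_fun hz ω
    exact le_self_add.trans this.ge
  -- Extension by zero is continuous since the carrying set is clopen.
  set g' : UltrafilterSpace (Projection S) → K := fun ω =>
    if hω : ω ∈ basicSet E.base then g ⟨ω, hω⟩ else 0 with hg'
  have hcont : Continuous g' := by
    rw [continuous_iff_continuousAt]
    intro ω
    by_cases hω : ω ∈ basicSet E.base
    · have hop := (isOpen_basicSet E.base).isOpenEmbedding_subtypeVal
      have : ContinuousAt (g' ∘ Subtype.val) (⟨ω, hω⟩ : basicSet E.base) := by
        have he : g' ∘ (Subtype.val : basicSet E.base → _) = g := funext fun ω => by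
          simp only [hg', Function.comp_apply, ω.2, dite_true]
        rw [he]
        exact g.continuous.continuousAt
      exact hop.continuousAt_iff.1 this
    · refine (continuousAt_const (y := (0 : K))).congr ?_
      filter_upwards [(isClopen_basicSet E.base).1.isOpen_compl.mem_nhds hω] with ω' hω'
      simp only [hg']
      rw [dif_neg hω']
  obtain ⟨y, hyx, hy, hval⟩ := exists_val_eq (E := E) hx hcont fun ω => by
    simp only [hg']
    split_ifs with hω
    · exact hgx ⟨ω, hω⟩
    · exact val_nonneg _ _
  refine ⟨y, hyx, hy, ContinuousMap.ext fun ω => ?_⟩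
  rw [toMap_apply, hval]
  simp only [hg', ω.2, dite_true]

theorem toMap_base_psmul (x : Tot S) : E.toMap (E.base • x) = E.toMap x :=
  ContinuousMap.ext fun ω => val_psmul_of_mem ω.2 x

end UnitSystem

namespace FinUnits

variable {F : Type} [LinearOrder F] [AddCommMonoid F] [CanonicallyOrderedAdd F] [TopologicalSpace F]
  [OrderTopology F] [ContinuousAdd F] [IsLeftCancelAdd F] {E : FinUnits S F} {γ : Ordinal.{u}}
  {hγ : ∀ (ξ : Ordinal.{u}) (q : Projection S) (t : Tot S), IsAleph ξ q t → q ≠ ⊥ → ξ ≤ γ}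

theorem val_eq_zero (x : Tot S) {ω : UltrafilterSpace (Projection S)}
    (h : E.base ∉ ω.1) : (E.ext γ hγ).val x ω = 0 :=
  UnitSystem.val_eq_zero_of_base_notMem (E := E.ext γ hγ) h

theorem le_of_val_le {x y : Tot S} (hx : x ≠ ⊤) (hy : y ≠ ⊤) (hxb : E.base • x = x)
    (h : ∀ ω, (E.ext γ hγ).val x ω ≤ (E.ext γ hγ).val y ω) : x ≤ y := by
  rw [← hxb]
  exact (UnitSystem.psmul_base_le_of_val_le (E := E.ext γ hγ) hx hy fun ω _ => h ω).trans
    (psmul_le _ _)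

theorem eq_of_val_eq {x y : Tot S} (hx : x ≠ ⊤) (hy : y ≠ ⊤) (hxb : E.base • x = x)
    (hyb : E.base • y = y) (h : ∀ ω, (E.ext γ hγ).val x ω = (E.ext γ hγ).val y ω) : x = y :=
  le_antisymm (le_of_val_le hx hy hxb fun ω => (h ω).le)
    (le_of_val_le hy hx hyb fun ω => (h ω).ge)

theorem val_add_psmul {a b c : Tot S} (ha : a ≠ ⊤) (hb : b ≠ ⊤) (hc : c ≠ ⊤)
    (h : ∀ ω, (E.ext γ hγ).val c ω = (E.ext γ hγ).val a ω + (E.ext γ hγ).val b ω)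
    (p : Projection S) (ω : UltrafilterSpace (Projection S)) :
    (E.ext γ hγ).val (p • c) ω = (E.ext γ hγ).val (p • a) ω + (E.ext γ hγ).val (p • b) ω := by
  by_cases hp : p ∈ ω.1
  · rw [UnitSystem.val_psmul_of_mem hp, UnitSystem.val_psmul_of_mem hp,
      UnitSystem.val_psmul_of_mem hp, h]
  · rw [UnitSystem.val_psmul_of_notMem hp hc, UnitSystem.val_psmul_of_notMem hp ha,
      UnitSystem.val_psmul_of_notMem hp hb, add_zero]

/-- With `c = a + w`, the values of `w` and `b` agree wherever that of `c` is finite, by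
cancellation. Such points are dense in the carrier, both values vanish off it, and values are
continuous; so they agree everywhere. -/
theorem eq_add_of_dfin {a b c : Tot S} (hc : DFin c) (ha : a ≤ c) (hb : b ≤ c)
    (hcb : E.base • c = c)
    (h : ∀ ω, (E.ext γ hγ).val c ω = (E.ext γ hγ).val a ω + (E.ext γ hγ).val b ω) :
    c = a + b := by
  obtain ⟨w, hw⟩ := ha
  have hct := hc.ne_top
  have hwc : w ≤ c := hw ▸ le_add_self
  have hd : ∀ ω, (∃ v, (E.ext γ hγ).val c ω = .fin v) →
      (E.ext γ hγ).val w ω = (E.ext γ hγ).val b ω := by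
    rintro ω ⟨v, hv⟩
    refine AlephExt.add_left_cancel_of_fin (x := (E.ext γ hγ).val a ω) (v := v) ?_ ?_
    · rw [← UnitSystem.val_add (hw ▸ hct), ← hw, hv]
    · rw [← h, hv]
  have hclosed : IsClosed {ω | (E.ext γ hγ).val w ω = (E.ext γ hγ).val b ω} :=
    isClosed_eq (UnitSystem.continuous_val w) (UnitSystem.continuous_val b)
  have hdense : Dense {ω | (E.ext γ hγ).val w ω = (E.ext γ hγ).val b ω} := by
    rw [dense_iff_inter_open]
    rintro U hU ⟨ω₀, hω₀⟩
    obtain ⟨q, hq, hqU⟩ := exists_basicSet_subset hU hω₀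
    by_cases h0 : q ⊓ E.base = ⊥
    · refine ⟨ω₀, hω₀, ?_⟩
      have hn : E.base ∉ ω₀.1 := fun hb => by
        have := Order.PFilter.inf_mem hq hb
        rw [h0] at this
        exact UltrafilterSpace.bot_notMem _ this
      exact (val_eq_zero w hn).trans (val_eq_zero b hn).symm
    · obtain ⟨ω, hω, hv⟩ := E.exists_fin_val hγ inf_le_right h0 (hc.psmul (q ⊓ E.base))
      exact ⟨ω, hqU (Order.PFilter.mem_of_le inf_le_left hω), hd ω hv⟩
  have hall : ∀ ω, (E.ext γ hγ).val w ω = (E.ext γ hγ).val b ω := fun ω => by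
    have := hclosed.closure_eq ▸ hdense ω
    exact this
  rw [hw, eq_of_val_eq (ne_top_of_le hwc hct) (ne_top_of_le hb hct)
    (psmul_eq_of_le hct hcb hwc) (psmul_eq_of_le hct hcb hb) hall]

/-- Cancellation is unavailable at infinite values. Instead, the idempotent value of `c` must equal
that of the larger summand `b`; so `b = c`, which absorbs `a`. -/
theorem eq_add_of_pinf_of_le {a b c : Tot S} (hc : PInf c) (hct : c ≠ ⊤) (ha : a ≤ c) (hb : b ≤ c)
    (hcb : E.base • c = c) (hab : a ≤ b)
    (h : ∀ ω, (E.ext γ hγ).val c ω = (E.ext γ hγ).val a ω + (E.ext γ hγ).val b ω) :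
    c = a + b := by
  have hbc : b = c := by
    refine eq_of_val_eq (hγ := hγ) (ne_top_of_le hb hct) hct (psmul_eq_of_le hct hcb hb) hcb fun ω => ?_
    rw [h ω]
    refine (AlephExt.add_eq_of_idem (UnitSystem.val_mono hab ω) ?_).symm
    rw [← h, ← UnitSystem.val_add (by rw [hc]; exact hct), hc]
  rw [hbc, hc.add_of_le ha]

/-- Cut along the finite and infinite parts of `c`, and cut the infinite part again by comparing `a`
with `b`. It follows that `a + b` is defined whenever the values add up to a value. -/
theorem eq_add_of_val_eq {a b c : Tot S} (ha : a ≠ ⊤) (hb : b ≠ ⊤) (hc : c ≠ ⊤)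
    (hab : E.base • a = a) (hbb : E.base • b = b) (hcb : E.base • c = c)
    (h : ∀ ω, (E.ext γ hγ).val c ω = (E.ext γ hγ).val a ω + (E.ext γ hγ).val b ω) :
    c = a + b := by
  have hac : a ≤ c := le_of_val_le ha hc hab fun ω => by rw [h]; exact le_self_add
  have hbc : b ≤ c := le_of_val_le hb hc hbb fun ω => by rw [h]; exact le_add_self
  obtain ⟨p, hp, hp'⟩ := exists_dfin_pinf hc
  have hfix : ∀ q : Projection S, ∀ x : Tot S, E.base • x = x → E.base • q • x = q • x :=
    fun q x hx => by rw [psmul_comm, hx]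
  refine eq_add_of_psmul p (eq_add_of_dfin hp (psmul_mono p hac) (psmul_mono p hbc) (hfix _ _ hcb)
    (val_add_psmul ha hb hc h p)) ?_
  have h' := val_add_psmul ha hb hc h pᶜ
  have ha' := psmul_ne_top (p := pᶜ) ha
  have hb' := psmul_ne_top (p := pᶜ) hb
  have hc' := psmul_ne_top (p := pᶜ) hc
  obtain ⟨r, hr, hr'⟩ := exists_comparable ha' hb'
  refine eq_add_of_psmul r ?_ ?_
  · exact eq_add_of_pinf_of_le (hp'.psmul hc' r) (psmul_ne_top hc')
      (psmul_mono r (psmul_mono _ hac)) (psmul_mono r (psmul_mono _ hbc))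
      (hfix _ _ (hfix _ _ hcb)) hr (val_add_psmul ha' hb' hc' h' r)
  · rw [add_comm]
    refine eq_add_of_pinf_of_le (hγ := hγ) (hp'.psmul hc' rᶜ) (psmul_ne_top hc')
      (psmul_mono _ (psmul_mono _ hbc)) (psmul_mono _ (psmul_mono _ hac))
      (hfix _ _ (hfix _ _ hcb)) hr' fun ω => ?_
    rw [add_comm]
    exact val_add_psmul ha' hb' hc' h' rᶜ ω

theorem psmul_eq_add_of_toMap_eq {a b c : Tot S} (ha : a ≠ ⊤) (hb : b ≠ ⊤) (hc : c ≠ ⊤)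
    (h : (E.ext γ hγ).toMap a + (E.ext γ hγ).toMap b = (E.ext γ hγ).toMap c) :
    E.base • c = E.base • a + E.base • b := by
  refine eq_add_of_val_eq (hγ := hγ) (psmul_ne_top ha) (psmul_ne_top hb) (psmul_ne_top hc)
    (psmul_idem _ _) (psmul_idem _ _) (psmul_idem _ _) fun ω => ?_
  by_cases hω : E.base ∈ ω.1
  · rw [UnitSystem.val_psmul_of_mem hω, UnitSystem.val_psmul_of_mem hω,
      UnitSystem.val_psmul_of_mem hω]
    exact (DFunLike.congr_fun h ⟨ω, hω⟩).symm
  · rw [val_eq_zero _ hω, val_eq_zero _ hω, val_eq_zero _ hω, add_zero]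

end FinUnits

/-! ### The embedding -/

namespace Projection

theorem types_psmul_add (x : Tot S) :
    typeOne S • x + (typeTwo S • x + typeThree S • x) = x := by
  have h := psmul_add_compl_psmul (typeThree S) (polarMFree S • x)
  rw [psmul_of_le typeThree_le_polarMFree, psmul_comm, ← inf_psmul] at h
  have h' := psmul_add_compl_psmul (polarMFree S) x
  rw [typeOne, typeTwo, add_comm (_ • x) (typeThree S • x), h, add_comm, h']

theorem le_of_types {x y : Tot S} (h1 : typeOne S • x ≤ typeOne S • y)
    (h2 : typeTwo S • x ≤ typeTwo S • y) (h3 : typeThree S • x ≤ typeThree S • y) : x ≤ y := by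
  rw [← types_psmul_add x, ← types_psmul_add y]
  exact add_le_add h1 (add_le_add h2 h3)

theorem eq_add_of_types {a b c : Tot S} (h1 : typeOne S • c = typeOne S • a + typeOne S • b)
    (h2 : typeTwo S • c = typeTwo S • a + typeTwo S • b)
    (h3 : typeThree S • c = typeThree S • a + typeThree S • b) : c = a + b := by
  rw [← types_psmul_add a, ← types_psmul_add b, ← types_psmul_add c, h1, h2, h3,
    add_add_add_comm (typeTwo S • a), add_add_add_comm]

end Projection

theorem UnitSystem.toMap_eq_zero_of_disjoint {K : Type v} [LinearOrder K] [AddCommMonoid K]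
    [TopologicalSpace K] [OrderTopology K] [CanonicallyOrderedAdd K] [ContinuousAdd K]
    {E : UnitSystem S K} {p : Projection S} (hd : Disjoint E.base p) {x : Tot S} (hx : x ≠ ⊤)
    (h : p • x = x) : E.toMap x = 0 := by
  rw [← toMap_base_psmul, ← h, ← inf_psmul, hd.eq_bot, bot_psmul hx, toMap_zero]

section Representation

variable {γ : Ordinal.{u}}
  (hγ : ∀ (ξ : Ordinal.{u}) (q : Projection S) (t : Tot S), IsAleph ξ q t → q ≠ ⊥ → ξ ≤ γ)

/-- The function that represents `x`. -/
noncomputable def representation (x : Tot S) :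
    FunctionScale (basicSet (typeOne S)) (basicSet (typeTwo S)) (basicSet (typeThree S)) γ :=
  (((unitDataOne S).finUnits.ext γ hγ).toMap x, ((unitDataTwo S).finUnits.ext γ hγ).toMap x,
    ((finUnitsThree S).ext γ hγ).toMap x)

theorem representation_zero : representation hγ (0 : Tot S) = 0 :=
  Prod.ext (UnitSystem.toMap_zero (E := (unitDataOne S).finUnits.ext γ hγ))
    (Prod.ext (UnitSystem.toMap_zero (E := (unitDataTwo S).finUnits.ext γ hγ))
      (UnitSystem.toMap_zero (E := (finUnitsThree S).ext γ hγ)))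

theorem representation_add {x y : Tot S} (h : x + y ≠ ⊤) :
    representation hγ (x + y) = representation hγ x + representation hγ y :=
  Prod.ext (UnitSystem.toMap_add (E := (unitDataOne S).finUnits.ext γ hγ) h)
    (Prod.ext (UnitSystem.toMap_add (E := (unitDataTwo S).finUnits.ext γ hγ) h)
      (UnitSystem.toMap_add (E := (finUnitsThree S).ext γ hγ) h))

theorem le_of_representation_algLE {x y : Tot S} (hx : x ≠ ⊤) (hy : y ≠ ⊤)
    (h : representation hγ x ≼ representation hγ y) : x ≤ y := by
  obtain ⟨z, hz⟩ := algLE_iff_exists.1 h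
  exact le_of_types
    (UnitSystem.psmul_le_of_toMap_algLE (E := (unitDataOne S).finUnits.ext γ hγ) hx hy
      (algLE_iff_exists.2 ⟨z.1, congrArg Prod.fst hz⟩))
    (UnitSystem.psmul_le_of_toMap_algLE (E := (unitDataTwo S).finUnits.ext γ hγ) hx hy
      (algLE_iff_exists.2 ⟨z.2.1, congrArg (fun f => f.2.1) hz⟩))
    (UnitSystem.psmul_le_of_toMap_algLE (E := (finUnitsThree S).ext γ hγ) hx hy
      (algLE_iff_exists.2 ⟨z.2.2, congrArg (fun f => f.2.2) hz⟩))

theorem eq_add_of_representation {a b c : Tot S} (ha : a ≠ ⊤) (hb : b ≠ ⊤) (hc : c ≠ ⊤)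
    (h : representation hγ a + representation hγ b = representation hγ c) : c = a + b :=
  eq_add_of_types
    (FinUnits.psmul_eq_add_of_toMap_eq (E := (unitDataOne S).finUnits) (hγ := hγ) ha hb hc
      (congrArg Prod.fst h))
    (FinUnits.psmul_eq_add_of_toMap_eq (E := (unitDataTwo S).finUnits) (hγ := hγ) ha hb hc
      (congrArg (fun f => f.2.1) h))
    (FinUnits.psmul_eq_add_of_toMap_eq (E := finUnitsThree S) (hγ := hγ) ha hb hc
      (congrArg (fun f => f.2.2) h))

/-- The three components are realized separately below `x`. Their sum is defined because they lie
below the three type components of `x`, and each is invisible to the scales of the other types. -/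
theorem exists_representation_eq {x : Tot S} (hx : x ≠ ⊤)
    {g : FunctionScale (basicSet (typeOne S)) (basicSet (typeTwo S)) (basicSet (typeThree S)) γ}
    (h : g ≼ representation hγ x) : ∃ y ≠ ⊤, representation hγ y = g := by
  obtain ⟨z, hz⟩ := algLE_iff_exists.1 h
  obtain ⟨y₁, hy₁, hb₁, hv₁⟩ := UnitSystem.exists_toMap_eq
    (E := (unitDataOne S).finUnits.ext γ hγ) hx (g := g.1)
    (algLE_iff_exists.2 ⟨z.1, congrArg Prod.fst hz⟩)
  obtain ⟨y₂, hy₂, hb₂, hv₂⟩ := UnitSystem.exists_toMap_eq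
    (E := (unitDataTwo S).finUnits.ext γ hγ) hx (g := g.2.1)
    (algLE_iff_exists.2 ⟨z.2.1, congrArg (fun f => f.2.1) hz⟩)
  obtain ⟨y₃, hy₃, hb₃, hv₃⟩ := UnitSystem.exists_toMap_eq
    (E := (finUnitsThree S).ext γ hγ) hx (g := g.2.2)
    (algLE_iff_exists.2 ⟨z.2.2, congrArg (fun f => f.2.2) hz⟩)
  have hyx : y₁ + (y₂ + y₃) ≤ x := by
    rw [← types_psmul_add x, ← hb₁, ← hb₂, ← hb₃]
    exact add_le_add (psmul_mono _ hy₁) (add_le_add (psmul_mono _ hy₂) (psmul_mono _ hy₃))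
  have ht := ne_top_of_le hyx hx
  have ht' := right_ne_top ht
  refine ⟨y₁ + (y₂ + y₃), ht, ?_⟩
  have hd₁₂ := disjoint_typeOne_typeTwo (S := S)
  have hd₁₃ := disjoint_typeOne_typeThree (S := S)
  have hd₂₃ := disjoint_typeTwo_typeThree (S := S)
  have key : ∀ {K : Type (u + 1)} [LinearOrder K] [AddCommMonoid K] [TopologicalSpace K]
      [OrderTopology K] [CanonicallyOrderedAdd K] [ContinuousAdd K] (E : UnitSystem S K),
      E.toMap (y₁ + (y₂ + y₃)) = E.toMap y₁ + (E.toMap y₂ + E.toMap y₃) := fun E => by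
    rw [UnitSystem.toMap_add ht, UnitSystem.toMap_add ht']
  refine Prod.ext ?_ (Prod.ext ?_ ?_)
  · refine (key ((unitDataOne S).finUnits.ext γ hγ)).trans ?_
    rw [UnitSystem.toMap_eq_zero_of_disjoint (p := typeTwo S) hd₁₂ (left_ne_top ht') hb₂,
      UnitSystem.toMap_eq_zero_of_disjoint (p := typeThree S) hd₁₃ (right_ne_top ht') hb₃,
      add_zero, add_zero, hv₁]
  · refine (key ((unitDataTwo S).finUnits.ext γ hγ)).trans ?_
    rw [UnitSystem.toMap_eq_zero_of_disjoint (p := typeOne S) hd₁₂.symm (left_ne_top ht) hb₁,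
      UnitSystem.toMap_eq_zero_of_disjoint (p := typeThree S) hd₂₃ (right_ne_top ht') hb₃,
      zero_add, add_zero, hv₂]
  · refine (key ((finUnitsThree S).ext γ hγ)).trans ?_
    rw [UnitSystem.toMap_eq_zero_of_disjoint (p := typeOne S) hd₁₃.symm (left_ne_top ht) hb₁,
      UnitSystem.toMap_eq_zero_of_disjoint (p := typeTwo S) hd₂₃.symm (left_ne_top ht') hb₂,
      zero_add, zero_add, hv₃]

theorem isCutoff_representation {x : Tot S} (hx : x ≠ ⊤) (p : Projection S) :
    FunctionScale.IsCutoff (basicSet p) (representation hγ x) (representation hγ (p • x)) :=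
  ⟨fun _ => ⟨fun h => UnitSystem.val_psmul_of_mem (E := (unitDataOne S).finUnits.ext γ hγ) h x,
      fun h => UnitSystem.val_psmul_of_notMem (E := (unitDataOne S).finUnits.ext γ hγ) h hx⟩,
    fun _ => ⟨fun h => UnitSystem.val_psmul_of_mem (E := (unitDataTwo S).finUnits.ext γ hγ) h x,
      fun h => UnitSystem.val_psmul_of_notMem (E := (unitDataTwo S).finUnits.ext γ hγ) h hx⟩,
    fun _ => ⟨fun h => UnitSystem.val_psmul_of_mem (E := (finUnitsThree S).ext γ hγ) h x,
      fun h => UnitSystem.val_psmul_of_notMem (E := (finUnitsThree S).ext γ hγ) h hx⟩⟩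

theorem isLowerEmbedding_representation :
    IsLowerEmbedding fun x : S => representation hγ (Tot.of x) where
  isHom :=
    { map_zero := representation_zero hγ
      map_padd := fun a b c h => by
        rw [mem_padd_iff, ← representation_add, of_add_of_eq_of.2 h]
        rw [of_add_of_eq_of.2 h]
        exact of_ne_top c }
  injective := fun x y h => by
    have h : representation hγ (Tot.of x) = representation hγ (Tot.of y) := h
    refine of_injective (le_antisymm ?_ ?_)
    · exact le_of_representation_algLE hγ (of_ne_top x) (of_ne_top y) (h ▸ AlgLE.refl _)
    · exact le_of_representation_algLE hγ (of_ne_top y) (of_ne_top x) (h ▸ AlgLE.refl _)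
  le_of_map_le := fun x y h =>
    of_le_of.1 (le_of_representation_algLE hγ (of_ne_top x) (of_ne_top y) h)
  range_lower := by
    rintro g _ hg ⟨x, rfl⟩
    obtain ⟨y, hy, rfl⟩ := exists_representation_eq hγ (of_ne_top x) hg
    obtain ⟨y, rfl⟩ := exists_of hy
    exact ⟨y, rfl⟩

end Representation

end

theorem exists_lowerEmbedding (S : Type u) [PartialCommMonoid S]
    (hS : IsContinuousDimensionScale S) :
    IsCompleteBooleanAlgebra (Projection S) ∧
    IsCompleteBooleanSpace (UltrafilterSpace (Projection S)) ∧
    ∃ pI pII pIII : Projection S,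
      Set.range pI = typeI S ∧ Set.range pII = typeII S ∧ Set.range pIII = typeIII S ∧
      IsClopenDecomposition (basicSet pI) (basicSet pII) (basicSet pIII) ∧
      ∃ (γ : Ordinal.{u})
        (ε : S → FunctionScale (basicSet pI) (basicSet pII) (basicSet pIII) γ),
        IsLowerEmbedding ε ∧
        (∀ a b c : S, ε a + ε b = ε c → c ∈ a +ₚ b) ∧
        ∀ (x : S) (p : Projection S),
          FunctionScale.IsCutoff (basicSet p) (ε x) (ε (p x)) := by
  have : Fact (IsContinuousDimensionScale S) := ⟨hS⟩
  obtain ⟨γ, hγ⟩ := bddAbove_isAleph (S := S)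
  exact ⟨Projection.isCompleteBooleanAlgebra S, Projection.isCompleteBooleanSpace_ultrafilterSpace S,
    typeOne S, typeTwo S, typeThree S, range_typeOne, range_typeTwo, range_typeThree,
    UltrafilterSpace.isClopenDecomposition disjoint_typeOne_typeTwo disjoint_typeOne_typeThree
      disjoint_typeTwo_typeThree types_sup,
    γ, fun x => representation hγ (Tot.of x), isLowerEmbedding_representation hγ,
    fun a b c h => of_add_of_eq_of.1 (eq_add_of_representation hγ (of_ne_top a) (of_ne_top b)
      (of_ne_top c) h).symm,
    fun x p => isCutoff_representation hγ (of_ne_top x) p⟩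

end PartialCommMonoid

/-! ### The converse: continuous functions on extremally disconnected spaces. -/

theorem IsOpen.extremallyDisconnected {X : Type v} [TopologicalSpace X] [ExtremallyDisconnected X]
    {U : Set X} (hU : IsOpen U) : ExtremallyDisconnected U where
  open_closure V hV := by
    rw [Topology.IsInducing.subtypeVal.closure_eq_preimage_closure_image]
    exact (ExtremallyDisconnected.open_closure _
      (hU.isOpenEmbedding_subtypeVal.isOpenMap V hV)).preimage continuous_subtype_val

/-! ### Envelopes of functions on extremally disconnected spaces -/

namespace Envelope

open Topology

variable {X : Type v} [TopologicalSpace X] {K : Type w} [LinearOrder K]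
  (hK : ∀ s : Set K, ∃ m, IsGLB s m)

/-- The regularization of the sublevel set `{u ≤ c}`. -/
def sublevel (u : X → K) (c : K) : Set X := closure (interior {ω | u ω ≤ c})

theorem sublevel_mono (u : X → K) {c d : K} (h : c ≤ d) : sublevel u c ⊆ sublevel u d :=
  closure_mono (interior_mono fun _ hω => le_trans hω h)

/-- The upper envelope of `u`. -/
noncomputable def envelope (u : X → K) (ω : X) : K := (hK {c | ω ∈ sublevel u c}).choose

theorem isGLB_envelope (u : X → K) (ω : X) : IsGLB {c | ω ∈ sublevel u c} (envelope hK u ω) :=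
  (hK {c | ω ∈ sublevel u c}).choose_spec

theorem envelope_lt_iff {u : X → K} {ω : X} {d : K} :
    envelope hK u ω < d ↔ ∃ c < d, ω ∈ sublevel u c := by
  rw [isGLB_lt_iff (isGLB_envelope hK u ω)]
  exact ⟨fun ⟨c, h1, h2⟩ => ⟨c, h2, h1⟩, fun ⟨c, h1, h2⟩ => ⟨c, h2, h1⟩⟩

variable [TopologicalSpace K] [OrderTopology K]

theorem le_envelope {u f : X → K} {ω : X} (hf : ContinuousAt f ω) (h : ∀ᶠ x in 𝓝 ω, f x ≤ u x) :
    f ω ≤ envelope hK u ω := by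
  refine (le_isGLB_iff (isGLB_envelope hK u ω)).2 fun c hc => not_lt.1 fun hlt => ?_
  have h1 := (hf.eventually (lt_mem_nhds hlt)).and h
  obtain ⟨x, ⟨hx1, hx2⟩, hx⟩ := mem_closure_iff_nhds.1 hc _ h1
  have hxc : u x ≤ c := interior_subset (s := {ω | u ω ≤ c}) hx
  exact absurd (hx1.trans_le hx2) (not_lt.2 hxc)

theorem envelope_le {u f : X → K} {ω : X} (hf : ContinuousAt f ω) (h : ∀ᶠ x in 𝓝 ω, u x ≤ f x) :
    envelope hK u ω ≤ f ω := by
  have key : ∀ c, (∀ᶠ x in 𝓝 ω, f x ≤ c) → envelope hK u ω ≤ c := fun c hc =>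
    (isGLB_envelope hK u ω).1 (subset_closure (mem_interior_iff_mem_nhds.2 (by
      filter_upwards [hc, h] with x h1 h2 using h2.trans h1)))
  refine not_lt.1 fun hlt => ?_
  -- The chain may have jumps: when nothing lies strictly between, `f < envelope hK u ω` near `ω`
  -- already says `f ≤ f ω` there.
  by_cases hc : ∃ e, f ω < e ∧ e < envelope hK u ω
  · obtain ⟨e, h1, h2⟩ := hc
    exact absurd (key e ((hf.eventually (gt_mem_nhds h1)).mono fun _ h => h.le)) (not_le.2 h2)
  · push Not at hc
    refine absurd (key (f ω) ((hf.eventually (gt_mem_nhds hlt)).mono fun x hx => ?_)) (not_le.2 hlt)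
    exact not_lt.1 fun hx' => absurd hx (not_lt.2 (hc _ hx'))

theorem envelope_eq {u : X → K} {ω : X} (hu : ContinuousAt u ω) : envelope hK u ω = u ω :=
  le_antisymm (envelope_le hK hu (Filter.Eventually.of_forall fun _ => le_rfl))
    (le_envelope hK hu (Filter.Eventually.of_forall fun _ => le_rfl))

/-- Regularized sublevel sets are clopen by extremal disconnectedness. Lower rays pull back to
unions of them, and upper rays to neighbourhoods given by their complements. -/
theorem continuous_envelope [ExtremallyDisconnected X] (u : X → K) :
    Continuous (envelope hK u) := by
  have hopen : ∀ c, IsOpen (sublevel u c) := fun c =>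
    ExtremallyDisconnected.open_closure _ isOpen_interior
  rw [OrderTopology.continuous_iff]
  refine fun d => ⟨isOpen_iff_forall_mem_open.2 fun ω hω => ?_, ?_⟩
  · have hlt : d < envelope hK u ω := hω
    have hc : ∃ c, c < envelope hK u ω ∧ ∀ x, x ∉ sublevel u c → d < envelope hK u x := by
      by_cases hc : ∃ e, d < e ∧ e < envelope hK u ω
      · obtain ⟨e, h1, h2⟩ := hc
        refine ⟨e, h2, fun x hx => h1.trans_le ?_⟩
        refine (le_isGLB_iff (isGLB_envelope hK u x)).2 fun c hc => not_lt.1 fun hlt => ?_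
        exact hx (sublevel_mono u hlt.le hc)
      · push Not at hc
        refine ⟨d, hlt, fun x hx => hlt.trans_le ?_⟩
        refine (le_isGLB_iff (isGLB_envelope hK u x)).2 fun c hxc => hc c ?_
        exact not_le.1 fun hcd => hx (sublevel_mono u hcd hxc)
    obtain ⟨c, h1, h2⟩ := hc
    exact ⟨(sublevel u c)ᶜ, fun x hx => h2 x hx, isClosed_closure.isOpen_compl,
      fun hωc => absurd ((isGLB_envelope hK u ω).1 hωc) (not_le.2 h1)⟩
  · have : envelope hK u ⁻¹' Set.Iio d = ⋃ c ∈ Set.Iio d, sublevel u c := by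
      ext ω
      simp only [Set.mem_preimage, Set.mem_Iio, Set.mem_iUnion, exists_prop]
      exact envelope_lt_iff hK
    rw [this]
    exact isOpen_biUnion fun c _ => hopen c

include hK in
/-- Local solutions of a closed relation can be glued. -/
theorem exists_global [ExtremallyDisconnected X] {ι : Type*} (R : X → (ι → K) → Prop)
    (hR : ∀ h : ι → C(X, K), IsClosed {ω | R ω fun i => h i ω})
    (hloc : ∀ U : Set X, IsOpen U → U.Nonempty → ∃ V ⊆ U, IsOpen V ∧ V.Nonempty ∧
      ∃ h : ι → X → K, (∀ i, ContinuousOn (h i) V) ∧ ∀ ω ∈ V, R ω fun i => h i ω) :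
    ∃ h : ι → C(X, K), ∀ ω, R ω fun i => h i ω := by
  classical
  have hne : Nonempty K := ⟨(hK ∅).choose⟩
  let Good : Set X → (ι → X → K) → Prop := fun V h => IsOpen V ∧
    (∀ i, ContinuousOn (h i) V) ∧ ∀ ω ∈ V, R ω fun i => h i ω
  -- A maximal disjoint family of open sets carrying local solutions; by the local hypothesis its
  -- union is dense.
  obtain ⟨𝒱, h𝒱⟩ : ∃ 𝒱 : Set (Set X), Maximal
      (fun 𝒱 : Set (Set X) => (∀ V ∈ 𝒱, ∃ h, Good V h) ∧ 𝒱.PairwiseDisjoint id) 𝒱 :=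
    zorn_subset {𝒱 : Set (Set X) | (∀ V ∈ 𝒱, ∃ h, Good V h) ∧ 𝒱.PairwiseDisjoint id}
      fun c hc hchain => ⟨⋃₀ c, ⟨by
        rintro V ⟨𝒲, h𝒲, hV⟩
        exact (hc h𝒲).1 V hV, by
        rintro V ⟨𝒲, h𝒲, hV⟩ V' ⟨𝒲', h𝒲', hV'⟩ hne
        rcases hchain.total h𝒲 h𝒲' with hle | hle
        · exact (hc h𝒲').2 (hle hV) hV' hne
        · exact (hc h𝒲).2 hV (hle hV') hne⟩, fun _ => Set.subset_sUnion_of_mem⟩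
  choose h hh using h𝒱.prop.1
  have hdense : Dense (⋃₀ 𝒱) := by
    rw [← compl_compl (⋃₀ 𝒱), ← interior_eq_empty_iff_dense_compl]
    by_contra hint
    obtain ⟨V, hVU, hVo, hVne, g, hg, hgR⟩ := hloc _ isOpen_interior
      (Set.nonempty_iff_ne_empty.2 hint)
    have hVd : ∀ W ∈ 𝒱, Disjoint V W := fun W hW => by
      rw [Set.disjoint_left]
      exact fun ω h1 h2 => interior_subset (hVU h1) ⟨W, hW, h2⟩
    have hins := h𝒱.le_of_ge (y := insert V 𝒱) ⟨by
      rintro W (rfl | hW)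
      · exact ⟨g, hVo, hg, hgR⟩
      · exact h𝒱.prop.1 W hW, h𝒱.prop.2.insert fun W hW _ => hVd W hW⟩ (Set.subset_insert _ _)
    obtain ⟨ω, hω⟩ := hVne
    exact Set.disjoint_left.1 (hVd V (hins (Set.mem_insert _ _))) hω hω
  -- Values off the dense union are arbitrary: the envelope is continuous everywhere, agrees with
  -- the patched solution on the union, and the closed relation extends from there.
  set u : ι → X → K := fun i ω =>
    if hω : ∃ V, ∃ hV : V ∈ 𝒱, ω ∈ V then h hω.choose hω.choose_spec.choose i ω
    else Classical.arbitrary K with hu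
  have huV : ∀ V (hV : V ∈ 𝒱), ∀ ω ∈ V, ∀ i, u i ω = h V hV i ω := by
    intro V hV ω hω i
    have hex : ∃ V, ∃ hV : V ∈ 𝒱, ω ∈ V := ⟨V, hV, hω⟩
    have heq : hex.choose = V := by
      by_contra hne
      exact Set.disjoint_left.1 (h𝒱.prop.2 hex.choose_spec.choose hV hne)
        hex.choose_spec.choose_spec hω
    simp only [hu, dif_pos hex]
    congr 1
  refine ⟨fun i => ⟨envelope hK (u i), continuous_envelope hK (u i)⟩, fun ω => ?_⟩
  have hsub : ⋃₀ 𝒱 ⊆ {ω | R ω fun i => envelope hK (u i) ω} := by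
    rintro ω ⟨V, hV, hω⟩
    have hVo := (hh V hV).1
    have hc : ∀ i, ContinuousAt (u i) ω := fun i =>
      ((hh V hV).2.1 i).continuousAt (hVo.mem_nhds hω) |>.congr (by
        filter_upwards [hVo.mem_nhds hω] with x hx using (huV V hV x hx i).symm)
    have he : (fun i => envelope hK (u i) ω) = fun i => h V hV i ω := funext fun i => by
      rw [envelope_eq hK (hc i), huV V hV ω hω i]
    change R ω _
    rw [he]
    exact (hh V hV).2.2 ω hω
  have := hR fun i => ⟨envelope hK (u i), continuous_envelope hK (u i)⟩
  exact this.closure_subset_iff.2 hsub (hdense ω)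

end Envelope

/-! ### Idempotents and infinite sums in the value scales. -/

namespace AlephExt

variable {F : Type} {γ : Ordinal.{w}}

theorem exists_isGLB [LinearOrder F] (hF : ∀ s : Set F, BddAbove s → ∃ m, IsLUB s m)
    (s : Set (AlephExt F γ)) : ∃ m, IsGLB s m := by
  obtain ⟨m, hm⟩ := exists_isLUB hF (lowerBounds s)
  exact ⟨m, isLUB_lowerBounds.1 hm⟩

/-- The least infinite element. -/
def alephZero : AlephExt F γ := aleph ⟨0, Set.mem_Iic.2 zero_le⟩

section Order

variable [LinearOrder F]

theorem lt_alephZero_iff {a : AlephExt F γ} : a < alephZero ↔ ∃ x, a = fin x := by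
  rcases a with x | ξ
  · exact ⟨fun _ => ⟨x, rfl⟩, fun _ => fin_lt_aleph _ _⟩
  · refine ⟨fun h => ?_, ?_⟩
    · exact absurd (aleph_lt_aleph.1 h) (not_lt.2 (zero_le (a := ξ.1)))
    · rintro ⟨x, h⟩
      cases h

theorem alephZero_le_iff {a : AlephExt F γ} : alephZero ≤ a ↔ ∃ ξ, a = aleph ξ := by
  rcases a with x | ξ
  · refine ⟨fun h => absurd (fin_lt_aleph x _) (not_lt.2 h), ?_⟩
    rintro ⟨ξ, h⟩
    cases h
  · exact ⟨fun _ => ⟨ξ, rfl⟩, fun _ => aleph_le_aleph.2 (zero_le (a := ξ.1))⟩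

/-- The finite part of `a`. -/
def finPart [Zero F] : AlephExt F γ → F
  | fin x => x
  | aleph _ => 0

theorem continuousOn_finPart [Zero F] [TopologicalSpace F] [OrderTopology F] :
    ContinuousOn (finPart : AlephExt F γ → F) (Set.Iio alephZero) := by
  intro a ha
  obtain ⟨x, rfl⟩ := lt_alephZero_iff.1 ha
  refine ContinuousAt.continuousWithinAt ?_
  exact (isOpenEmbedding_fin (F := F) (γ := γ)).continuousAt_iff.1
    (continuousAt_id : ContinuousAt (id : F → F) x)

end Order

variable [AddCommMonoid F]

variable [LinearOrder F] [CanonicallyOrderedAdd F]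

theorem add_eq_of_alephZero_le {a b : AlephExt F γ} (h : a ≤ b) (hb : alephZero ≤ b) :
    a + b = b := by
  obtain ⟨ξ, rfl⟩ := alephZero_le_iff.1 hb
  exact add_aleph_of_le h

theorem idem_iff [IsLeftCancelAdd F] {a : AlephExt F γ} :
    a + a = a ↔ a = 0 ∨ alephZero ≤ a := by
  constructor
  · rcases a with x | ξ
    · intro h
      left
      have h1 : x + x = x := by
        rw [fin_add_fin] at h
        exact fin.inj h
      have h2 : x = 0 := add_left_cancel (h1.trans (add_zero x).symm)
      rw [h2]
      rfl
    · exact fun _ => Or.inr (alephZero_le_iff.2 ⟨ξ, rfl⟩)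
  · rintro (rfl | h)
    · exact add_zero 0
    · exact add_eq_of_alephZero_le le_rfl h

theorem add_self_le_add_self {a b : AlephExt F γ} (h : a ≤ b) : a + a ≤ b + b := by
  obtain ⟨c, rfl⟩ := exists_add_of_le h
  rw [add_add_add_comm]
  exact le_self_add

/-- The idempotents are zero and the alephs, a well-ordered set; this is where (M6) comes from. -/
theorem exists_isLeast_of_idem [IsLeftCancelAdd F] {s : Set (AlephExt F γ)}
    (hs : ∀ a ∈ s, a + a = a) (hne : s.Nonempty) : ∃ m, IsLeast s m := by
  by_cases h0 : 0 ∈ s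
  · exact ⟨0, h0, fun _ _ => zero_le⟩
  · have ha : ∀ a ∈ s, ∃ ξ, a = aleph ξ := fun a has =>
      alephZero_le_iff.1 ((idem_iff.1 (hs a has)).resolve_left fun h => h0 (h ▸ has))
    have hne' : {ξ : Set.Iic γ | aleph ξ ∈ s}.Nonempty := by
      obtain ⟨a, has⟩ := hne
      obtain ⟨ξ, rfl⟩ := ha a has
      exact ⟨ξ, has⟩
    obtain ⟨ξ, hξ, hmin⟩ := WellFounded.has_min (wellFounded_lt (α := Set.Iic γ)) _ hne'
    refine ⟨aleph ξ, hξ, fun a has => ?_⟩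
    obtain ⟨η, rfl⟩ := ha a has
    exact aleph_le_aleph.2 (not_lt.1 (hmin η has))

theorem add_eq_max_of_alephZero_le {a b : AlephExt F γ} (h : alephZero ≤ a + b) :
    a + b = max a b := by
  rcases le_total a b with hab | hab
  · rw [max_eq_right hab]
    refine add_eq_of_alephZero_le hab ?_
    rcases a with x | x <;> rcases b with y | y
    · exact absurd h (not_le.2 (fin_lt_aleph _ _))
    · exact alephZero_le_iff.2 ⟨y, rfl⟩
    · exact absurd (fin_lt_aleph y x) (not_lt.2 hab)
    · exact alephZero_le_iff.2 ⟨y, rfl⟩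
  · rw [max_eq_left hab, add_comm]
    refine add_eq_of_alephZero_le hab ?_
    rcases a with x | x <;> rcases b with y | y
    · exact absurd h (not_le.2 (fin_lt_aleph _ _))
    · exact absurd (fin_lt_aleph x y) (not_lt.2 hab)
    · exact alephZero_le_iff.2 ⟨x, rfl⟩
    · exact alephZero_le_iff.2 ⟨x, rfl⟩

end AlephExt

/-! ### Total scales, and the axioms for monoids of continuous functions. -/

namespace PartialCommMonoid

/-- Complementary additive maps with orthogonal ranges. -/
structure IsCutoffPair {M : Type v} [AddCommMonoid M] [PartialOrder M] (p q : M →+ M) : Prop where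
  add : ∀ x, p x + q x = x
  disjoint : ∀ x y z, z ≤ p x → z ≤ q y → z = 0

/-- The elements `x` and `y` have no nonzero common lower bound. -/
def Orthogonal {M : Type v} [AddCommMonoid M] [PartialOrder M] (x y : M) : Prop :=
  ∀ z, z ≤ x → z ≤ y → z = 0

/-- The purely infinite elements `x` from which `a` is removable, with the same polar as `b`. -/
def removableClass {M : Type v} [AddCommMonoid M] [PartialOrder M] (a b : M) : Set M :=
  {x | x + x = x ∧ (a ≤ x ∧ ∀ y, x ≤ a + y → x ≤ y) ∧ ∀ s, Orthogonal s x ↔ Orthogonal s b}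

/-- Continuous dimension scales with everywhere defined addition, in terms of their ordering. -/
structure IsTotalScale (M : Type v) [AddCommMonoid M] [PartialOrder M] : Prop where
  le_iff : ∀ a b : M, a ≤ b ↔ ∃ x, b = a + x
  refinement : ∀ a₀ a₁ b₀ b₁ : M, a₀ + a₁ = b₀ + b₁ → ∃ c₀₀ c₀₁ c₁₀ c₁₁ : M,
    a₀ = c₀₀ + c₀₁ ∧ a₁ = c₁₀ + c₁₁ ∧ b₀ = c₀₀ + c₁₀ ∧ b₁ = c₀₁ + c₁₁
  exists_isGLB : ∀ s : Set M, s.Nonempty → ∃ m, IsGLB s m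
  -- The last clause expresses maximality of `p` by elements alone, so that it survives passage to a
  -- lower subset, which may have more projections: `a'` and `y` stand for the two parts of `a`
  -- under a competitor, and `z` for an element of its range killed by `p`.
  exists_pair : ∀ a b : M, ∃ p q : M →+ M, IsCutoffPair p q ∧ p a ≤ p b ∧ q b ≤ q a ∧
    ∀ a' y z, a = a' + y → a' ≤ b → Orthogonal y z → p z = 0 → z = 0
  decomp : ∀ a : M, ∃ x y, (∀ w, w + x = x → w = 0) ∧ y + y = y ∧ a = x + y
  exists_least : ∀ a b : M, a + a = a → b ∈ removableClass a b →
    ∃ m, IsLeast (removableClass a b) m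

open Envelope AlephExt

section ContinuousMaps

variable {X : Type v} [TopologicalSpace X] [ExtremallyDisconnected X] {F : Type} [LinearOrder F]
  [AddCommMonoid F] [CanonicallyOrderedAdd F] [TopologicalSpace F] [OrderTopology F]
  [ContinuousAdd F] [IsLeftCancelAdd F] {γ : Ordinal.{w}}
  (hF : ∀ s : Set F, BddAbove s → ∃ m, IsLUB s m)
  (hsub : ∃ d : F × F → F, Continuous d ∧ ∀ x y, x ≤ y → x + d (x, y) = y)

theorem apply_le_apply {f g : C(X, AlephExt F γ)} (h : f ≤ g) (ω : X) : f ω ≤ g ω := h ω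

theorem exists_open_alternative {U P : Set X} (hU : IsOpen U) (hne : U.Nonempty) (hP : IsOpen P) :
    ∃ V ⊆ U, IsOpen V ∧ V.Nonempty ∧ (V ⊆ P ∨ Disjoint V P) := by
  by_cases h : (U ∩ P).Nonempty
  · exact ⟨U ∩ P, Set.inter_subset_left, hU.inter hP, h, Or.inl Set.inter_subset_right⟩
  · exact ⟨U, subset_rfl, hU, hne, Or.inr (Set.disjoint_iff_inter_eq_empty.2
      (Set.not_nonempty_iff_eq_empty.1 h))⟩

-- Differences are glued from local ones: where `g` is finite subtract by `d`, and where `g` is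
-- infinite take `g` itself, which absorbs `f`.
include hF hsub in
theorem exists_eq_add_of_le {f g : C(X, AlephExt F γ)} (h : f ≤ g) : ∃ x, g = f + x := by
  obtain ⟨d, hd, hd'⟩ := hsub
  obtain ⟨x, hx⟩ := exists_global (AlephExt.exists_isGLB hF) (ι := Unit)
    (fun ω v => g ω = f ω + v ())
    (fun x => isClosed_eq g.continuous (f.continuous.add (x ()).continuous)) (fun U hU hne => by
      have hP : IsOpen {ω | g ω < alephZero} := isOpen_lt g.continuous continuous_const
      obtain ⟨V, hVU, hV, hVne, hor⟩ := exists_open_alternative hU hne hP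
      refine ⟨V, hVU, hV, hVne, ?_⟩
      rcases hor with hor | hor
      · refine ⟨fun _ ω => fin (d (finPart (f ω), finPart (g ω))), fun _ => ?_, fun ω hω => ?_⟩
        · refine (isOpenEmbedding_fin.continuous.comp hd).comp_continuousOn ?_
          exact (continuousOn_finPart.comp f.continuous.continuousOn
              fun ω hω => (h ω).trans_lt (hor hω)).prodMk
            (continuousOn_finPart.comp g.continuous.continuousOn fun ω hω => hor hω)
        · obtain ⟨y, hy⟩ := lt_alephZero_iff.1 (hor hω)
          obtain ⟨x, hx⟩ := lt_alephZero_iff.1 ((apply_le_apply h ω).trans_lt (hor hω))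
          have hle := apply_le_apply h ω
          rw [hx, hy, fin_le_fin] at hle
          change g ω = f ω + fin (d (finPart (f ω), finPart (g ω)))
          rw [hx, hy]
          exact (congrArg fin (hd' x y hle)).symm
      · refine ⟨fun _ => g, fun _ => g.continuous.continuousOn, fun ω hω => ?_⟩
        exact (add_eq_of_alephZero_le (h ω)
          (not_lt.1 fun hlt => Set.disjoint_left.1 hor hω hlt)).symm)
  exact ⟨x (), ContinuousMap.ext hx⟩

include hF in
/-- The gluing principle for a refinement problem. -/
theorem exists_refinement_of_local {a₀ a₁ b₀ b₁ : C(X, AlephExt F γ)}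
    (hloc : ∀ U : Set X, IsOpen U → U.Nonempty → ∃ V ⊆ U, IsOpen V ∧ V.Nonempty ∧
      ∃ c₀₀ c₀₁ c₁₀ c₁₁ : C(X, AlephExt F γ), ∀ ω ∈ V, a₀ ω = c₀₀ ω + c₀₁ ω ∧
        a₁ ω = c₁₀ ω + c₁₁ ω ∧ b₀ ω = c₀₀ ω + c₁₀ ω ∧ b₁ ω = c₀₁ ω + c₁₁ ω) :
    ∃ c₀₀ c₀₁ c₁₀ c₁₁ : C(X, AlephExt F γ), a₀ = c₀₀ + c₀₁ ∧ a₁ = c₁₀ + c₁₁ ∧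
      b₀ = c₀₀ + c₁₀ ∧ b₁ = c₀₁ + c₁₁ := by
  obtain ⟨c, hc⟩ := exists_global (AlephExt.exists_isGLB hF) (ι := Fin 4)
    (fun ω (v : Fin 4 → AlephExt F γ) => a₀ ω = v 0 + v 1 ∧ a₁ ω = v 2 + v 3 ∧
      b₀ ω = v 0 + v 2 ∧ b₁ ω = v 1 + v 3)
    (fun c => by
      have h : ∀ (f : C(X, AlephExt F γ)) (i j : Fin 4), IsClosed {ω | f ω = c i ω + c j ω} :=
        fun f i j => isClosed_eq f.continuous ((c i).continuous.add (c j).continuous)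
      exact (h a₀ 0 1).inter ((h a₁ 2 3).inter ((h b₀ 0 2).inter (h b₁ 1 3))))
    (fun U hU hne => by
      obtain ⟨V, hVU, hV, hVne, c₀₀, c₀₁, c₁₀, c₁₁, h⟩ := hloc U hU hne
      refine ⟨V, hVU, hV, hVne, ![c₀₀, c₀₁, c₁₀, c₁₁], fun i => ?_, h⟩
      fin_cases i
      exacts [c₀₀.continuous.continuousOn, c₀₁.continuous.continuousOn,
        c₁₀.continuous.continuousOn, c₁₁.continuous.continuousOn])
  exact ⟨c 0, c 1, c 2, c 3, ContinuousMap.ext fun ω => (hc ω).1,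
    ContinuousMap.ext fun ω => (hc ω).2.1, ContinuousMap.ext fun ω => (hc ω).2.2.1,
    ContinuousMap.ext fun ω => (hc ω).2.2.2⟩

theorem eq_add_of_add_eq_add {x y z t d : AlephExt F γ} (h : x + y = z + t) (hz : z = x + d)
    (hf : x + y < alephZero) : y = d + t := by
  obtain ⟨v, hv⟩ := lt_alephZero_iff.1 hf
  refine add_left_cancel_of_fin hv ?_
  rw [← add_assoc, ← hz, ← h, hv]

-- After shrinking the open set, the total is either finite throughout or infinite throughout, and
-- the relevant comparisons are constant. In the finite case compare `a₀` with `b₀` and subtract; in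
-- the infinite case the sums are maxima.
include hF hsub in
theorem exists_refinement {a₀ a₁ b₀ b₁ : C(X, AlephExt F γ)} (h : a₀ + a₁ = b₀ + b₁) :
    ∃ c₀₀ c₀₁ c₁₀ c₁₁ : C(X, AlephExt F γ), a₀ = c₀₀ + c₀₁ ∧ a₁ = c₁₀ + c₁₁ ∧
      b₀ = c₀₀ + c₁₀ ∧ b₁ = c₀₁ + c₁₁ := by
  have hω : ∀ ω, a₀ ω + a₁ ω = b₀ ω + b₁ ω := fun ω => DFunLike.congr_fun h ω
  refine exists_refinement_of_local hF fun U hU hne => ?_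
  have hP : IsOpen {ω | a₀ ω + a₁ ω < alephZero} :=
    isOpen_lt (a₀.continuous.add a₁.continuous) continuous_const
  obtain ⟨V, hVU, hV, hVne, hor⟩ := exists_open_alternative hU hne hP
  have hcmp : ∀ (f g : C(X, AlephExt F γ)) (V : Set X), IsOpen V → V.Nonempty →
      ∃ W ⊆ V, IsOpen W ∧ W.Nonempty ∧ ((∀ ω ∈ W, f ω ≤ g ω) ∨ ∀ ω ∈ W, g ω ≤ f ω) := by
    intro f g V hV hVne
    obtain ⟨W, hWV, hW, hWne, hor⟩ := exists_open_alternative hV hVne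
      (isOpen_lt f.continuous g.continuous)
    refine ⟨W, hWV, hW, hWne, hor.imp (fun h ω hω => (h hω).le) fun h ω hω => not_lt.1 fun hlt => ?_⟩
    exact Set.disjoint_left.1 h hω hlt
  rcases hor with hor | hor
  -- The comparison holds only locally, so the difference is taken from `f` to `f ⊔ g`, where it
  -- exists globally.
  · have hd : ∀ f g : C(X, AlephExt F γ), ∃ d : C(X, AlephExt F γ), ∀ ω, f ω ≤ g ω →
        g ω = f ω + d ω := fun f g => by
      obtain ⟨d, hd⟩ := exists_eq_add_of_le hF hsub (f := f) (g := f ⊔ g) le_sup_left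
      refine ⟨d, fun ω hle => ?_⟩
      have := DFunLike.congr_fun hd ω
      rwa [ContinuousMap.sup_apply, sup_eq_right.2 hle] at this
    obtain ⟨W, hWV, hW, hWne, hle⟩ := hcmp a₀ b₀ V hV hVne
    refine ⟨W, hWV.trans hVU, hW, hWne, ?_⟩
    rcases hle with hle | hle
    · obtain ⟨d, hd⟩ := hd a₀ b₀
      refine ⟨a₀, 0, d, b₁, fun ω hωW => ⟨(add_zero _).symm, ?_, hd ω (hle ω hωW),
        (zero_add _).symm⟩⟩
      exact eq_add_of_add_eq_add (hω ω) (hd ω (hle ω hωW)) (hor (hWV hωW))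
    · obtain ⟨d, hd⟩ := hd b₀ a₀
      refine ⟨b₀, d, 0, a₁, fun ω hωW => ⟨hd ω (hle ω hωW), (zero_add _).symm, (add_zero _).symm,
        ?_⟩⟩
      refine eq_add_of_add_eq_add (hω ω).symm (hd ω (hle ω hωW)) ?_
      rw [← hω]
      exact hor (hWV hωW)
  · obtain ⟨W, hWV, hW, hWne, ha⟩ := hcmp a₀ a₁ V hV hVne
    obtain ⟨W', hWW', hW', hWne', hb⟩ := hcmp b₀ b₁ W hW hWne
    refine ⟨W', hWW'.trans (hWV.trans hVU), hW', hWne', ?_⟩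
    have hinf : ∀ ω ∈ W', alephZero ≤ a₀ ω + a₁ ω := fun ω hω =>
      not_lt.1 fun hlt => Set.disjoint_left.1 hor (hWV (hWW' hω)) hlt
    have hmax : ∀ ω ∈ W', max (a₀ ω) (a₁ ω) = max (b₀ ω) (b₁ ω) := fun ω hωW => by
      rw [← add_eq_max_of_alephZero_le (hinf ω hωW), hω,
        add_eq_max_of_alephZero_le (by rw [← hω]; exact hinf ω hωW)]
    have habs : ∀ (s x : AlephExt F γ), alephZero ≤ s → x ≤ s → s = s + x := fun s x hs hx => by
      rw [add_comm, add_eq_of_alephZero_le hx hs]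
    have hinf' : ∀ ω ∈ W', alephZero ≤ max (a₀ ω) (a₁ ω) := fun ω hω => by
      rw [← add_eq_max_of_alephZero_le (hinf ω hω)]
      exact hinf ω hω
    -- The common maximum goes where the larger row meets the larger column, the two smaller
    -- summands complete that row and column, and `0` takes the opposite corner.
    rcases ha with ha | ha <;> rcases hb with hb | hb
    · refine ⟨0, a₀, b₀, a₁, fun ω hω => ?_⟩
      have h1 := hmax ω hω
      have h2 := hinf' ω hω
      have ha' := ha ω (hWW' hω)
      have hb' := hb ω hω
      rw [max_eq_right ha'] at h1 h2
      rw [max_eq_right hb'] at h1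
      refine ⟨(zero_add _).symm, ?_, (zero_add _).symm, ?_⟩
      · exact (add_eq_of_alephZero_le (h1 ▸ hb') h2).symm
      · rw [← h1]; exact (add_eq_of_alephZero_le ha' h2).symm
    · refine ⟨a₀, 0, a₁, b₁, fun ω hω => ?_⟩
      have h1 := hmax ω hω
      have h2 := hinf' ω hω
      have ha' := ha ω (hWW' hω)
      have hb' := hb ω hω
      rw [max_eq_right ha'] at h1 h2
      rw [max_eq_left hb'] at h1
      refine ⟨(add_zero _).symm, habs _ _ h2 (h1 ▸ hb'), ?_, (zero_add _).symm⟩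
      rw [← h1]; exact (add_eq_of_alephZero_le ha' h2).symm
    · refine ⟨b₀, a₀, 0, a₁, fun ω hω => ?_⟩
      have h1 := hmax ω hω
      have h2 := hinf' ω hω
      have ha' := ha ω (hWW' hω)
      have hb' := hb ω hω
      rw [max_eq_left ha'] at h1 h2
      rw [max_eq_right hb'] at h1
      refine ⟨(add_eq_of_alephZero_le (h1 ▸ hb') h2).symm, (zero_add _).symm, (add_zero _).symm, ?_⟩
      rw [← h1]; exact habs _ _ h2 ha'
    · refine ⟨a₀, b₁, a₁, 0, fun ω hω => ?_⟩
      have h1 := hmax ω hω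
      have h2 := hinf' ω hω
      have ha' := ha ω (hWW' hω)
      have hb' := hb ω hω
      rw [max_eq_left ha'] at h1 h2
      rw [max_eq_left hb'] at h1
      refine ⟨habs _ _ h2 (h1 ▸ hb'), (add_zero _).symm, ?_, (add_zero _).symm⟩
      rw [← h1]; exact habs _ _ h2 ha'

-- The envelope of the pointwise infimum: it stays below every continuous function above that
-- infimum, and above every continuous function below it.
include hF in
theorem exists_isGLB_continuousMap (s : Set C(X, AlephExt F γ)) (_ : s.Nonempty) :
    ∃ m, IsGLB s m := by
  have hK := AlephExt.exists_isGLB (γ := γ) hF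
  choose inf hinf using fun ω : X => hK ((fun f : C(X, AlephExt F γ) => f ω) '' s)
  refine ⟨⟨envelope hK inf, continuous_envelope hK inf⟩, fun f hf ω => ?_, fun t ht ω => ?_⟩
  · exact envelope_le hK f.continuous.continuousAt
      (Filter.Eventually.of_forall fun x => (hinf x).1 ⟨f, hf, rfl⟩)
  · refine le_envelope hK t.continuous.continuousAt (Filter.Eventually.of_forall fun x => ?_)
    refine (hinf x).2 ?_
    rintro _ ⟨f, hf, rfl⟩
    exact ht hf x

/-- The cutoff by a clopen set. -/
noncomputable def cutoff {W : Set X} (hW : IsClopen W) :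
    C(X, AlephExt F γ) →+ C(X, AlephExt F γ) where
  toFun f := ⟨W.indicator f, f.continuous.indicator (by simp [hW.frontier_eq])⟩
  map_zero' := ContinuousMap.ext fun ω => by simp
  map_add' f g := ContinuousMap.ext fun ω => congrFun (Set.indicator_add W f g) ω

theorem cutoff_of_mem {W : Set X} (hW : IsClopen W) (f : C(X, AlephExt F γ)) {ω : X} (h : ω ∈ W) :
    cutoff hW f ω = f ω := Set.indicator_of_mem h f

theorem cutoff_of_notMem {W : Set X} (hW : IsClopen W) (f : C(X, AlephExt F γ)) {ω : X}
    (h : ω ∉ W) : cutoff hW f ω = 0 := Set.indicator_of_notMem h f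

theorem isCutoffPair_cutoff {W : Set X} (hW : IsClopen W) :
    IsCutoffPair (cutoff (F := F) (γ := γ) hW) (cutoff hW.compl) where
  add f := ContinuousMap.ext fun ω => by
    rw [ContinuousMap.add_apply]
    by_cases h : ω ∈ W
    · rw [cutoff_of_mem hW f h, cutoff_of_notMem hW.compl f (fun h' => h' h), add_zero]
    · rw [cutoff_of_notMem hW f h, cutoff_of_mem hW.compl f h, zero_add]
  disjoint f g z h1 h2 := ContinuousMap.ext fun ω => by
    refine le_antisymm ?_ zero_le
    by_cases h : ω ∈ W
    · exact (h2 ω).trans (cutoff_of_notMem hW.compl g (fun h' => h' h)).le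
    · exact (h1 ω).trans (cutoff_of_notMem hW f h).le

theorem orthogonal_iff {f g : C(X, AlephExt F γ)} :
    Orthogonal f g ↔ ∀ ω, f ω = 0 ∨ g ω = 0 := by
  constructor
  · intro h ω
    have h0 := DFunLike.congr_fun (h (f ⊓ g) inf_le_left inf_le_right) ω
    rw [ContinuousMap.inf_apply] at h0
    rcases le_total (f ω) (g ω) with hle | hle
    · rw [inf_eq_left.2 hle] at h0
      exact Or.inl h0
    · rw [inf_eq_right.2 hle] at h0
      exact Or.inr h0
  · intro h z hz hz'
    refine ContinuousMap.ext fun ω => le_antisymm ?_ zero_le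
    rcases h ω with h0 | h0
    · exact (hz ω).trans h0.le
    · exact (hz' ω).trans h0.le

theorem isClopen_closure {U : Set X} (hU : IsOpen U) : IsClopen (closure U) :=
  ⟨isClosed_closure, ExtremallyDisconnected.open_closure U hU⟩

/-- Cut along the clopen closure of the set where `b < a`: the inequality `b ≤ a` persists on the
closure, and `a ≤ b` holds off it. -/
theorem exists_cutoffPair (a b : C(X, AlephExt F γ)) :
    ∃ p q : C(X, AlephExt F γ) →+ C(X, AlephExt F γ), IsCutoffPair p q ∧ p a ≤ p b ∧ q b ≤ q a ∧
      ∀ a' y z, a = a' + y → a' ≤ b → Orthogonal y z → p z = 0 → z = 0 := by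
  have hU : IsOpen {ω | b ω < a ω} := isOpen_lt b.continuous a.continuous
  have hW := isClopen_closure hU
  have hp := isCutoffPair_cutoff (F := F) (γ := γ) hW.compl
  refine ⟨cutoff hW.compl, cutoff hW.compl.compl, hp, ContinuousMap.le_def.2 fun ω => ?_,
    ContinuousMap.le_def.2 fun ω => ?_, ?_⟩
  · by_cases h : ω ∈ closure {ω | b ω < a ω}
    · rw [cutoff_of_notMem hW.compl a (fun h' => h' h)]
      exact zero_le
    · rw [cutoff_of_mem hW.compl a h, cutoff_of_mem hW.compl b h]
      exact not_lt.1 fun hlt => h (subset_closure hlt)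
  · by_cases h : ω ∈ closure {ω | b ω < a ω}
    · rw [cutoff_of_mem hW.compl.compl a (not_not.2 h), cutoff_of_mem hW.compl.compl b (not_not.2 h)]
      exact closure_minimal (fun x hx => le_of_lt hx) (isClosed_le b.continuous a.continuous) h
    · rw [cutoff_of_notMem hW.compl.compl b (not_not.2 h)]
      exact zero_le
  · intro a' y z ha ha' hyz hz
    rw [orthogonal_iff] at hyz
    have hV : IsOpen {ω | 0 < z ω} := isOpen_lt continuous_const z.continuous
    -- Where `z` is positive, `y` vanishes, so `a = a' ≤ b`; being open, this set also misses the
    -- closure.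
    have hdisj : Disjoint {ω | 0 < z ω} (closure {ω | b ω < a ω}) := by
      refine Disjoint.closure_right (Set.disjoint_left.2 fun ω hω hlt => ?_) hV
      have hy : y ω = 0 := (hyz ω).resolve_right (ne_of_gt hω)
      have : a ω = a' ω := by
        rw [ha, ContinuousMap.add_apply, hy, add_zero]
      have hlt : b ω < a ω := hlt
      rw [this] at hlt
      exact absurd (apply_le_apply ha' ω) (not_le.2 hlt)
    refine ContinuousMap.ext fun ω => ?_
    by_contra h0
    have hω : 0 < z ω := pos_iff_ne_zero.2 h0
    have h1 := DFunLike.congr_fun hz ω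
    rw [cutoff_of_mem hW.compl z (Set.disjoint_left.1 hdisj hω)] at h1
    exact h0 h1

/-- Cut along the closure of the set where `a` is finite. On the closure `a` may take infinite
values, but anything it absorbs vanishes on a dense subset and so, by continuity, on all of it. -/
theorem exists_decomp (a : C(X, AlephExt F γ)) :
    ∃ x y : C(X, AlephExt F γ), (∀ w, w + x = x → w = 0) ∧ y + y = y ∧ a = x + y := by
  have hU : IsOpen {ω | a ω < alephZero} := isOpen_lt a.continuous continuous_const
  have hW := isClopen_closure hU
  refine ⟨cutoff hW a, cutoff hW.compl a, fun w hw => ?_, ContinuousMap.ext fun ω => ?_,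
    ((isCutoffPair_cutoff hW).add a).symm⟩
  · have hwω : ∀ ω, w ω + cutoff hW a ω = cutoff hW a ω := fun ω => DFunLike.congr_fun hw ω
    refine ContinuousMap.ext fun ω => ?_
    by_cases h : ω ∈ closure {ω | a ω < alephZero}
    · refine closure_minimal (t := {ω | w ω = 0}) (fun x hx => ?_)
        (isClosed_eq w.continuous continuous_const) h
      have h1 := hwω x
      obtain ⟨v, hv⟩ := lt_alephZero_iff.1 hx
      rw [cutoff_of_mem hW a (subset_closure hx), hv] at h1
      exact add_left_cancel_of_fin (x := fin v) (by rw [add_comm]; exact h1) (add_zero _)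
    · have h1 := hwω ω
      rwa [cutoff_of_notMem hW a h, add_zero] at h1
  · rw [ContinuousMap.add_apply]
    by_cases h : ω ∈ closure {ω | a ω < alephZero}
    · rw [cutoff_of_notMem hW.compl a (not_not.2 h), add_zero]
    · rw [cutoff_of_mem hW.compl a h]
      exact add_eq_of_alephZero_le le_rfl (not_lt.1 fun hlt => h (subset_closure hlt))

/-! ### Removable functions -/

/-- A nonzero idempotent value is at least `ℵ₀`, so not vanishing is a closed condition as well as
an open one. -/
theorem isClopen_ne_zero {x : C(X, AlephExt F γ)} (hx : x + x = x) : IsClopen {ω | x ω ≠ 0} := by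
  have he : {ω | x ω ≠ 0} = {ω | alephZero ≤ x ω} := by
    ext ω
    have h := idem_iff.1 (DFunLike.congr_fun hx ω)
    refine ⟨fun h0 => h.resolve_left h0, fun h1 h0 => ?_⟩
    have h2 : alephZero ≤ (0 : AlephExt F γ) := h0 ▸ h1
    exact absurd (fin_lt_aleph (0 : F) _) (not_lt.2 h2)
  refine ⟨?_, isOpen_ne_fun x.continuous continuous_const⟩
  rw [he]
  exact isClosed_le continuous_const x.continuous

/-- Removability becomes `a < x` on a dense subset of the set where `x` does not vanish. If `x ≤ a`
on an open set, `x` can be cut off there and still be recovered after adding `a`. Conversely, where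
`y < x`, density provides a point with `a < x`, and an aleph is not a sum of two smaller values. -/
theorem mem_removableClass_iff {a b x : C(X, AlephExt F γ)} (hb : b + b = b) :
    x ∈ removableClass a b ↔ x + x = x ∧ a ≤ x ∧
      (∀ V : Set X, IsOpen V → V.Nonempty → (∀ ω ∈ V, x ω ≠ 0) → ∃ ω ∈ V, a ω < x ω) ∧
      ∀ ω, x ω = 0 ↔ b ω = 0 := by
  have key : ∀ f g : C(X, AlephExt F γ), f + f = f → (∀ s, Orthogonal s f → Orthogonal s g) →
      ∀ ω, f ω = 0 → g ω = 0 := by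
    intro f g hf h ω hω
    have hW := (isClopen_ne_zero hf).compl
    have h1 := h (cutoff hW g) (orthogonal_iff.2 fun ω' => by
      by_cases h' : f ω' = 0
      · exact Or.inr h'
      · exact Or.inl (cutoff_of_notMem hW g (not_not.2 h')))
    rcases orthogonal_iff.1 h1 ω with h2 | h2
    · rwa [cutoff_of_mem hW g (not_not.2 hω)] at h2
    · exact h2
  constructor
  · rintro ⟨hx, ⟨hax, hrem⟩, horth⟩
    refine ⟨hx, hax, fun V hV hVne hVx => ?_, fun ω => ⟨key x b hx (fun s => (horth s).1) ω,
      key b x hb (fun s => (horth s).2) ω⟩⟩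
    by_contra! hc
    have hW := isClopen_closure hV
    have hle : x ≤ a + cutoff hW.compl x := ContinuousMap.le_def.2 fun ω => by
      rw [ContinuousMap.add_apply]
      by_cases h : ω ∈ closure V
      · exact (closure_minimal (t := {ω | x ω ≤ a ω}) hc (isClosed_le x.continuous a.continuous)
          h).trans le_self_add
      · rw [cutoff_of_mem hW.compl x h]
        exact le_add_self
    obtain ⟨ω, hω⟩ := hVne
    have h1 := apply_le_apply (hrem _ hle) ω
    rw [cutoff_of_notMem hW.compl x (not_not.2 (subset_closure hω))] at h1
    exact hVx ω hω (le_antisymm h1 zero_le)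
  · rintro ⟨hx, hax, hdense, hzero⟩
    refine ⟨hx, ⟨hax, fun y hy => ?_⟩, fun s => ?_⟩
    · by_contra hn
      have hU : IsOpen {ω | y ω < x ω} := isOpen_lt y.continuous x.continuous
      have hne : {ω | y ω < x ω}.Nonempty := by
        by_contra he
        refine hn fun ω => not_lt.1 fun hlt => he ⟨ω, hlt⟩
      obtain ⟨ω, hω, hlt⟩ := hdense _ hU hne fun ω hω => ne_of_gt (zero_le.trans_lt hω)
      have hxω := (idem_iff.1 (DFunLike.congr_fun hx ω)).resolve_left
        (ne_of_gt (zero_le.trans_lt hlt))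
      obtain ⟨ξ, hξ⟩ := alephZero_le_iff.1 hxω
      have h1 : a ω + y ω < x ω := by
        rw [hξ]
        exact add_lt_aleph (hξ ▸ hlt) (hξ ▸ hω)
      exact absurd (hy ω) (not_le.2 h1)
    · rw [orthogonal_iff, orthogonal_iff]
      exact forall_congr' fun ω => or_congr_right (hzero ω)

-- The infimum of the class is its least element. The delicate condition is that `a` remains
-- strictly below it on a dense set, and this follows from a positive jump: on suitable open sets
-- all members of the class share a constant lower bound above `a`.
include hF in
theorem exists_least_removableClass {a b : C(X, AlephExt F γ)} (ha : a + a = a)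
    (hb : b ∈ removableClass a b) : ∃ m, IsLeast (removableClass a b) m := by
  have hbb := hb.1
  obtain ⟨m, hm⟩ := exists_isGLB_continuousMap hF (removableClass a b) ⟨b, hb⟩
  refine ⟨m, ?_, hm.1⟩
  have hb' := (mem_removableClass_iff hbb).1 hb
  have ham : a ≤ m := hm.2 fun x hx => hx.2.1.1
  have hmb : m ≤ b := hm.1 hb
  have hmm : m + m = m := by
    refine le_antisymm (hm.2 fun x hx => ?_) fun ω => le_self_add
    rw [← hx.1]
    exact ContinuousMap.le_def.2 fun ω => add_self_le_add_self (hm.1 hx ω)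
  have key : ∀ V : Set X, IsOpen V → V.Nonempty → (∀ ω ∈ V, b ω ≠ 0) → ∃ ω ∈ V, a ω < m ω := by
    intro V hV hVne hVb
    -- The least value of `a` on `V` is taken at `ω₀`, and `e` is the next idempotent value above
    -- it.
    obtain ⟨κ, ⟨ω₀, hω₀, rfl⟩, hmin⟩ := exists_isLeast_of_idem (s := a '' V) (by
      rintro _ ⟨ω, _, rfl⟩
      exact DFunLike.congr_fun ha ω) (hVne.image _)
    obtain ⟨ω₁, hω₁, hlt₁⟩ := hb'.2.2.1 V hV hVne hVb
    obtain ⟨e, ⟨he, he'⟩, hemin⟩ := exists_isLeast_of_idem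
      (s := {k : AlephExt F γ | k + k = k ∧ a ω₀ < k}) (fun _ hk => hk.1)
      ⟨b ω₁, DFunLike.congr_fun hbb ω₁, (hmin ⟨ω₁, hω₁, rfl⟩).trans_lt hlt₁⟩
    -- By the choice of `e`, the function `a` is constant on this open set.
    set V' := V ∩ {ω | a ω < e} with hV'
    have hV'o : IsOpen V' := hV.inter (isOpen_lt a.continuous continuous_const)
    have hV'a : ∀ ω ∈ V', a ω = a ω₀ := fun ω hω =>
      le_antisymm (not_lt.1 fun hlt => absurd (hemin ⟨DFunLike.congr_fun ha ω, hlt⟩)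
        (not_le.2 hω.2)) (hmin ⟨ω, hω.1, rfl⟩)
    have hW := isClopen_closure hV'o
    -- A member smaller than `e` somewhere on `V'` would have, by density, an idempotent value
    -- strictly between `a ω₀` and `e`.
    have hlow : cutoff hW (ContinuousMap.const X e) ∈ lowerBounds (removableClass a b) := by
      refine fun x hx => ContinuousMap.le_def.2 fun ω => ?_
      by_cases h : ω ∈ closure V'
      · rw [cutoff_of_mem hW _ h]
        refine closure_minimal (t := {ω | e ≤ x ω}) (fun ω' hω' => ?_)
          (isClosed_le continuous_const x.continuous) h
        by_contra hlt
        have hlt : x ω' < e := not_le.1 hlt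
        have hx' := (mem_removableClass_iff hbb).1 hx
        obtain ⟨ω₂, ⟨hω₂, hx₂⟩, hlt₂⟩ := hx'.2.2.1 (V' ∩ {ω | x ω < e})
          (hV'o.inter (isOpen_lt x.continuous continuous_const)) ⟨ω', hω', hlt⟩
          fun ω hω => fun h0 => hVb ω hω.1.1 ((hx'.2.2.2 ω).1 h0)
        rw [hV'a ω₂ hω₂] at hlt₂
        exact absurd (hemin ⟨DFunLike.congr_fun hx'.1 ω₂, hlt₂⟩) (not_le.2 hx₂)
      · rw [cutoff_of_notMem hW _ h]
        exact zero_le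
    have hω₀' : ω₀ ∈ V' := ⟨hω₀, he'⟩
    refine ⟨ω₀, hω₀, he'.trans_le ?_⟩
    have := apply_le_apply (hm.2 hlow) ω₀
    rwa [cutoff_of_mem hW _ (subset_closure hω₀')] at this
  have hzero : ∀ ω, m ω = 0 ↔ b ω = 0 := fun ω => by
    refine ⟨fun h0 => ?_, fun h0 => le_antisymm ((hmb ω).trans h0.le) zero_le⟩
    by_contra hne
    have hV : IsOpen ({ω | b ω ≠ 0} ∩ {ω | m ω ≠ 0}ᶜ) :=
      (isClopen_ne_zero hbb).2.inter (isClopen_ne_zero hmm).compl.2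
    obtain ⟨ω', hω', hlt⟩ := key _ hV ⟨ω, hne, not_not.2 h0⟩ fun ω hω => hω.1
    exact hω'.2 (ne_of_gt (zero_le.trans_lt hlt))
  exact (mem_removableClass_iff hbb).2 ⟨hmm, ham, fun V hV hVne hVm => key V hV hVne
    fun ω hω h0 => hVm ω hω ((hzero ω).2 h0), hzero⟩

include hF hsub in
theorem isTotalScale_continuousMap : IsTotalScale C(X, AlephExt F γ) where
  le_iff f g := ⟨exists_eq_add_of_le hF hsub, by
    rintro ⟨x, rfl⟩
    exact fun ω => le_self_add⟩
  refinement _ _ _ _ := exists_refinement hF hsub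
  exists_isGLB := exists_isGLB_continuousMap hF
  exists_pair := exists_cutoffPair
  decomp := exists_decomp
  exists_least _ _ := exists_least_removableClass hF

end ContinuousMaps

end PartialCommMonoid

namespace PartialCommMonoid

theorem IsCutoffPair.symm {M : Type v} [AddCommMonoid M] [PartialOrder M] {p q : M →+ M}
    (h : IsCutoffPair p q) : IsCutoffPair q p where
  add x := by rw [add_comm, h.add]
  disjoint x y z hx hy := h.disjoint y x z hy hx

/-! ### Products -/

namespace IsTotalScale

section Order

variable {M : Type v} [AddCommMonoid M] [PartialOrder M] (hM : IsTotalScale M)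

include hM

theorem le_add_right (a b : M) : a ≤ a + b := (hM.le_iff _ _).2 ⟨b, rfl⟩

theorem le_add_left (a b : M) : a ≤ b + a := (hM.le_iff _ _).2 ⟨b, add_comm _ _⟩

theorem zero_le (a : M) : 0 ≤ a := (hM.le_iff _ _).2 ⟨a, (zero_add a).symm⟩

theorem eq_zero_of_le {a : M} (h : a ≤ 0) : a = 0 := le_antisymm h (hM.zero_le a)

theorem add_le_add {a b c d : M} (h : a ≤ b) (h' : c ≤ d) : a + c ≤ b + d := by
  obtain ⟨x, rfl⟩ := (hM.le_iff _ _).1 h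
  obtain ⟨y, rfl⟩ := (hM.le_iff _ _).1 h'
  rw [add_add_add_comm]
  exact hM.le_add_right _ _

theorem map_mono (p : M →+ M) {a b : M} (h : a ≤ b) : p a ≤ p b := by
  obtain ⟨x, rfl⟩ := (hM.le_iff _ _).1 h
  rw [map_add]
  exact hM.le_add_right _ _

end Order

variable {M : Type v} {N : Type w} [AddCommMonoid M] [PartialOrder M] [AddCommMonoid N]
  [PartialOrder N]

theorem orthogonal_prod_iff (hM : IsTotalScale M) (hN : IsTotalScale N) {x y : M × N} :
    Orthogonal x y ↔ Orthogonal x.1 y.1 ∧ Orthogonal x.2 y.2 := by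
  constructor
  · refine fun h => ⟨fun z hz hz' => ?_, fun z hz hz' => ?_⟩
    · exact congrArg Prod.fst (h (z, 0) ⟨hz, hN.zero_le _⟩ ⟨hz', hN.zero_le _⟩)
    · exact congrArg Prod.snd (h (0, z) ⟨hM.zero_le _, hz⟩ ⟨hM.zero_le _, hz'⟩)
  · exact fun h z hz hz' => Prod.ext (h.1 _ hz.1 hz'.1) (h.2 _ hz.2 hz'.2)

theorem mem_removableClass_prod_iff (hM : IsTotalScale M) (hN : IsTotalScale N)
    {a b x : M × N} : x ∈ removableClass a b ↔
      x.1 ∈ removableClass a.1 b.1 ∧ x.2 ∈ removableClass a.2 b.2 := by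
  constructor
  · rintro ⟨h1, ⟨h2, h3⟩, h4⟩
    refine ⟨⟨congrArg Prod.fst h1, ⟨h2.1, fun y hy => ?_⟩, fun s => ?_⟩,
      ⟨congrArg Prod.snd h1, ⟨h2.2, fun y hy => ?_⟩, fun s => ?_⟩⟩
    · exact (h3 (y, x.2) ⟨hy, hN.le_add_left _ _⟩).1
    · have := h4 (s, 0)
      rw [orthogonal_prod_iff hM hN, orthogonal_prod_iff hM hN] at this
      have h0 : ∀ t : N, Orthogonal (0 : N) t := fun t z hz _ => hN.eq_zero_of_le hz
      simpa only [h0, and_true] using this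
    · exact (h3 (x.1, y) ⟨hM.le_add_left _ _, hy⟩).2
    · have := h4 (0, s)
      rw [orthogonal_prod_iff hM hN, orthogonal_prod_iff hM hN] at this
      have h0 : ∀ t : M, Orthogonal (0 : M) t := fun t z hz _ => hM.eq_zero_of_le hz
      simpa only [h0, true_and] using this
  · rintro ⟨⟨h1, ⟨h2, h3⟩, h4⟩, ⟨k1, ⟨k2, k3⟩, k4⟩⟩
    refine ⟨Prod.ext h1 k1, ⟨⟨h2, k2⟩, fun y hy => ⟨h3 _ hy.1, k3 _ hy.2⟩⟩, fun s => ?_⟩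
    rw [orthogonal_prod_iff hM hN, orthogonal_prod_iff hM hN, h4, k4]

theorem prod (hM : IsTotalScale M) (hN : IsTotalScale N) : IsTotalScale (M × N) where
  le_iff a b := by
    constructor
    · rintro ⟨h1, h2⟩
      obtain ⟨x, hx⟩ := (hM.le_iff _ _).1 h1
      obtain ⟨y, hy⟩ := (hN.le_iff _ _).1 h2
      exact ⟨(x, y), Prod.ext hx hy⟩
    · rintro ⟨x, rfl⟩
      exact ⟨hM.le_add_right _ _, hN.le_add_right _ _⟩
  refinement a₀ a₁ b₀ b₁ h := by
    obtain ⟨c₀₀, c₀₁, c₁₀, c₁₁, h1, h2, h3, h4⟩ := hM.refinement _ _ _ _ (congrArg Prod.fst h)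
    obtain ⟨d₀₀, d₀₁, d₁₀, d₁₁, k1, k2, k3, k4⟩ := hN.refinement _ _ _ _ (congrArg Prod.snd h)
    exact ⟨(c₀₀, d₀₀), (c₀₁, d₀₁), (c₁₀, d₁₀), (c₁₁, d₁₁), Prod.ext h1 k1, Prod.ext h2 k2,
      Prod.ext h3 k3, Prod.ext h4 k4⟩
  exists_isGLB s hs := by
    obtain ⟨m, hm⟩ := hM.exists_isGLB (Prod.fst '' s) (hs.image _)
    obtain ⟨n, hn⟩ := hN.exists_isGLB (Prod.snd '' s) (hs.image _)
    exact ⟨(m, n), isGLB_prod.2 ⟨hm, hn⟩⟩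
  exists_pair a b := by
    obtain ⟨p, q, hpq, h1, h2, h3⟩ := hM.exists_pair a.1 b.1
    obtain ⟨p', q', hpq', k1, k2, k3⟩ := hN.exists_pair a.2 b.2
    refine ⟨p.prodMap p', q.prodMap q', ⟨fun x => Prod.ext (hpq.add _) (hpq'.add _),
      fun x y z hx hy => Prod.ext (hpq.disjoint _ _ _ hx.1 hy.1) (hpq'.disjoint _ _ _ hx.2 hy.2)⟩,
      ⟨h1, k1⟩, ⟨h2, k2⟩, fun a' y z ha ha' hyz hz => ?_⟩
    rw [orthogonal_prod_iff hM hN] at hyz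
    exact Prod.ext (h3 _ _ _ (congrArg Prod.fst ha) ha'.1 hyz.1 (congrArg Prod.fst hz))
      (k3 _ _ _ (congrArg Prod.snd ha) ha'.2 hyz.2 (congrArg Prod.snd hz))
  decomp a := by
    obtain ⟨x, y, h1, h2, h3⟩ := hM.decomp a.1
    obtain ⟨x', y', k1, k2, k3⟩ := hN.decomp a.2
    exact ⟨(x, x'), (y, y'), fun w hw => Prod.ext (h1 _ (congrArg Prod.fst hw))
      (k1 _ (congrArg Prod.snd hw)), Prod.ext h2 k2, Prod.ext h3 k3⟩
  exists_least a b ha hb := by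
    rw [mem_removableClass_prod_iff hM hN] at hb
    obtain ⟨m, hm⟩ := hM.exists_least _ _ (congrArg Prod.fst ha) hb.1
    obtain ⟨n, hn⟩ := hN.exists_least _ _ (congrArg Prod.snd ha) hb.2
    exact ⟨(m, n), (mem_removableClass_prod_iff hM hN).2 ⟨hm.1, hn.1⟩, fun x hx =>
      ⟨hm.2 ((mem_removableClass_prod_iff hM hN).1 hx).1,
        hn.2 ((mem_removableClass_prod_iff hM hN).1 hx).2⟩⟩

/-! ### Partial submonoids -/

section LowerSubmonoid

variable (hM : IsTotalScale M) (T : LowerSubmonoid M)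

theorem mem_padd_coe_iff {a b c : T.carrier} : c ∈ a +ₚ b ↔ (c : M) = a + b := by
  constructor
  · rintro ⟨⟨h, h'⟩, rfl⟩
    rfl
  · intro h
    refine ⟨⟨trivial, ?_⟩, Subtype.ext h.symm⟩
    change (a : M) + b ∈ T.carrier
    rw [← h]
    exact c.2

include hM

theorem mem_of_le {x y : M} (h : x ≤ y) (hy : y ∈ T.carrier) : x ∈ T.carrier :=
  T.lower x y (algLE_iff_exists.2 ((hM.le_iff _ _).1 h)) hy

theorem algLE_coe_iff {a b : T.carrier} : a ≼ b ↔ (a : M) ≤ b := by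
  rw [hM.le_iff]
  constructor
  · rintro ⟨x, hx⟩
    exact ⟨x, (mem_padd_coe_iff T).1 hx⟩
  · rintro ⟨x, hx⟩
    have hxT : x ∈ T.carrier := hM.mem_of_le T (hx ▸ hM.le_add_left x a) b.2
    exact ⟨⟨x, hxT⟩, (mem_padd_coe_iff T).2 hx⟩

theorem orth_coe_iff {a b : T.carrier} : Orth a b ↔ Orthogonal (a : M) b := by
  constructor
  · intro h z hza hzb
    exact congrArg Subtype.val (h ⟨z, hM.mem_of_le T hza a.2⟩ ((hM.algLE_coe_iff T).2 hza)
      ((hM.algLE_coe_iff T).2 hzb))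
  · intro h z hza hzb
    exact Subtype.ext (h z ((hM.algLE_coe_iff T).1 hza) ((hM.algLE_coe_iff T).1 hzb))

theorem pair_le_left {p q : M →+ M} (h : IsCutoffPair p q) (x : M) : p x ≤ x := by
  conv_rhs => rw [← h.add x]
  exact hM.le_add_right _ _

theorem pair_apply_eq_zero {p q : M →+ M} (h : IsCutoffPair p q) (x : M) : q (p x) = 0 :=
  h.disjoint x (p x) _ (hM.pair_le_left h.symm _) le_rfl

/-- The restriction of a cutoff to a partial submonoid. -/
def restrict {p q : M →+ M} (h : IsCutoffPair p q) : Projection T.carrier where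
  toFun x := ⟨p x, hM.mem_of_le T (hM.pair_le_left h x) x.2⟩
  isHom :=
    { map_zero := Subtype.ext (map_zero p)
      map_padd := fun a b c hc => by
        rw [mem_padd_coe_iff] at hc ⊢
        change p c = p a + p b
        rw [hc, map_add] }
  decomp x := by
    refine ⟨⟨q x, hM.mem_of_le T (hM.pair_le_left h.symm x) x.2⟩, ?_, ?_⟩
    · rintro _ ⟨y, rfl⟩
      exact (hM.orth_coe_iff T).2 fun z hz hz' => h.disjoint _ _ z hz' hz
    · exact (mem_padd_coe_iff T).2 (h.add x).symm

theorem restrict_apply {p q : M →+ M} (h : IsCutoffPair p q) (x : T.carrier) :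
    (hM.restrict T h x : M) = p x := rfl

theorem isPerp_restrict {p q : M →+ M} (h : IsCutoffPair p q) :
    (hM.restrict T h).IsPerp (hM.restrict T h.symm) := by
  have hfix : ∀ {p q : M →+ M} (h : IsCutoffPair p q) (x : T.carrier), p (x : M) = 0 →
      x ∈ Set.range (hM.restrict T h.symm) := fun {p q} h x hx =>
    ⟨x, Subtype.ext (by rw [restrict_apply, ← zero_add (q (x : M)), ← hx, h.add])⟩
  constructor
  · ext s
    constructor
    · rintro ⟨x, rfl⟩ _ ⟨y, rfl⟩
      exact (hM.orth_coe_iff T).2 fun z hz hz' => h.disjoint _ _ z hz' hz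
    · intro hs
      refine hfix h s ?_
      have := (hM.orth_coe_iff T).1 (hs _ ⟨s, rfl⟩)
      exact this _ (hM.pair_le_left h _) le_rfl
  · ext x
    constructor
    · intro hx
      exact hfix h.symm x (congrArg Subtype.val (Set.mem_singleton_iff.1 hx))
    · rintro ⟨y, rfl⟩
      exact Subtype.ext (hM.pair_apply_eq_zero h y)

/-- The element `y` may lie outside `T`. Refinement of `x ≤ a + y` replaces it by a piece `c₁₀ ≤ x`,
and `a + c₁₀ ≤ x + x = x` keeps the sum inside `T`. -/
theorem exists_removable_iff {a x : T.carrier} (hx : (x : M) + x = x) :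
    Removable a x ↔ (a : M) ≤ x ∧ ∀ y : M, (x : M) ≤ a + y → (x : M) ≤ y := by
  constructor
  · rintro ⟨hax, hrem⟩
    rw [hM.algLE_coe_iff] at hax
    refine ⟨hax, fun y hy => ?_⟩
    obtain ⟨t, ht⟩ := (hM.le_iff _ _).1 hy
    obtain ⟨c₀₀, c₀₁, c₁₀, c₁₁, h1, h2, h3, h4⟩ := hM.refinement _ _ _ _ ht
    have hc : c₁₀ ≤ x := by rw [h3]; exact hM.le_add_left _ _
    have hsum : (a : M) + c₁₀ ≤ x := by
      rw [← hx]
      exact hM.add_le_add hax hc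
    have hcT := hM.mem_of_le T hc x.2
    have hsT := hM.mem_of_le T hsum x.2
    have hle := hrem ⟨c₁₀, hcT⟩ ⟨a + c₁₀, hsT⟩ ((mem_padd_coe_iff T).2 rfl)
      ((hM.algLE_coe_iff T).2 (by
        change (x : M) ≤ a + c₁₀
        rw [h3, h1]
        exact hM.add_le_add (hM.le_add_right _ _) le_rfl))
    refine ((hM.algLE_coe_iff T).1 hle).trans ?_
    rw [h2]
    exact hM.le_add_right _ _
  · rintro ⟨hax, hrem⟩
    refine ⟨(hM.algLE_coe_iff T).2 hax, fun y s hs hxs => ?_⟩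
    rw [hM.algLE_coe_iff] at hxs ⊢
    rw [mem_padd_coe_iff] at hs
    exact hrem y (hs ▸ hxs)

theorem perp_singleton_coe_eq_iff {x b : T.carrier} :
    perp {x} = perp {b} ↔ ∀ s : M, Orthogonal s (x : M) ↔ Orthogonal s (b : M) := by
  have hmem : ∀ (x s : T.carrier), s ∈ perp {x} ↔ Orthogonal (s : M) x := fun x s => by
    rw [← hM.orth_coe_iff T]
    exact ⟨fun h => h x rfl, fun h y hy => by rw [Set.mem_singleton_iff.1 hy]; exact h⟩
  constructor
  · have key : ∀ x b : T.carrier, perp {x} = perp {b} → ∀ s : M, Orthogonal s (x : M) →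
        Orthogonal s (b : M) := by
      intro x b h s hs z hzs hzb
      have hzT := hM.mem_of_le T hzb b.2
      have h1 : (⟨z, hzT⟩ : T.carrier) ∈ perp {x} := (hmem x _).2 fun t htz htx =>
        hs t (htz.trans hzs) htx
      rw [h, hmem] at h1
      exact h1 z le_rfl hzb
    exact fun h s => ⟨key x b h s, key b x h.symm s⟩
  · intro h
    ext s
    rw [hmem, hmem, h]

theorem mem_removableClass_coe_iff {a b x : T.carrier} :
    (x : M) ∈ removableClass (a : M) b ↔
      x ∈ {x : T.carrier | PurelyInfinite x ∧ Removable a x ∧ perp {x} = perp {b}} := by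
  rw [Set.mem_ofPred_eq, hM.perp_singleton_coe_eq_iff T]
  have h : PurelyInfinite x ↔ (x : M) + x = x := (mem_padd_coe_iff T).trans eq_comm
  rw [h]
  exact and_congr_right fun hx => and_congr_left' (hM.exists_removable_iff T hx).symm

/-- For a competitor `r`, apply the maximality clause to `a = r a + y` and `z = r (q x)`. Then `z`
is orthogonal to `y` and killed by `p`, so it vanishes, and `r x = r (p x)`. -/
theorem restrict_greatest {p q : M →+ M} (h : IsCutoffPair p q) {a b : T.carrier}
    (hab : p a ≤ p b) (hmax : ∀ a' y z : M, (a : M) = a' + y → a' ≤ b → Orthogonal y z →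
      p z = 0 → z = 0) :
    IsGreatest {r : Projection T.carrier | r a ≼ r b} (hM.restrict T h) := by
  refine ⟨(hM.algLE_coe_iff T).2 hab, fun r hr x => ?_⟩
  have hr : r a ≼ r b := hr
  rw [hM.algLE_coe_iff] at hr
  have hle : ∀ y : T.carrier, (r y : M) ≤ y := fun y => by
    obtain ⟨y', -, hy'⟩ := r.decomp y
    rw [mem_padd_coe_iff] at hy'
    rw [hy']
    exact hM.le_add_right _ _
  set x' := hM.restrict T h.symm x
  have hz : r x' = 0 := by
    obtain ⟨y, hy, hay⟩ := r.decomp a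
    refine Subtype.ext (hmax (r a) y (r x') ((mem_padd_coe_iff T).1 hay) (hr.trans (hle b))
      ((hM.orth_coe_iff T).1 (hy _ ⟨x', rfl⟩)) ?_)
    refine hM.eq_zero_of_le ((hM.map_mono p (hle x')).trans ?_)
    exact (hM.pair_apply_eq_zero h.symm x).le
  have hx : x ∈ hM.restrict T h x +ₚ x' := (mem_padd_coe_iff T).2 (h.add x).symm
  have := r.isHom.map_padd _ _ _ hx
  rw [hz, padd_zero] at this
  exact (Part.mem_some_iff.1 this).symm

theorem isContinuousDimensionScale : IsContinuousDimensionScale T.carrier where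
  refinement a₀ a₁ b₀ b₁ s hs hs' := by
    rw [mem_padd_coe_iff] at hs hs'
    obtain ⟨c₀₀, c₀₁, c₁₀, c₁₁, h1, h2, h3, h4⟩ := hM.refinement _ _ _ _ (hs.symm.trans hs')
    have hT : ∀ {x y z : M}, z = x + y → z ∈ T.carrier → x ∈ T.carrier ∧ y ∈ T.carrier :=
      fun {x y z} h hz => ⟨hM.mem_of_le T (h ▸ hM.le_add_right x y) hz,
        hM.mem_of_le T (h ▸ hM.le_add_left y x) hz⟩
    obtain ⟨t1, t2⟩ := hT h1 a₀.2
    obtain ⟨t3, t4⟩ := hT h2 a₁.2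
    exact ⟨⟨c₀₀, t1⟩, ⟨c₀₁, t2⟩, ⟨c₁₀, t3⟩, ⟨c₁₁, t4⟩, (mem_padd_coe_iff T).2 h1,
      (mem_padd_coe_iff T).2 h2, (mem_padd_coe_iff T).2 h3, (mem_padd_coe_iff T).2 h4⟩
  antisymm a b h h' := Subtype.ext
    (le_antisymm ((hM.algLE_coe_iff T).1 h) ((hM.algLE_coe_iff T).1 h'))
  exists_inf s hs := by
    obtain ⟨m, hm⟩ := hM.exists_isGLB (Subtype.val '' s) (hs.image _)
    obtain ⟨x, hx⟩ := hs
    have hmT := hM.mem_of_le T (hm.1 ⟨x, hx, rfl⟩) x.2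
    refine ⟨⟨m, hmT⟩, fun y hy => (hM.algLE_coe_iff T).2 (hm.1 ⟨y, hy, rfl⟩), fun t ht => ?_⟩
    rw [hM.algLE_coe_iff]
    refine hm.2 ?_
    rintro _ ⟨y, hy, rfl⟩
    exact (hM.algLE_coe_iff T).1 (ht y hy)
  generalComparability a b := by
    obtain ⟨p, q, h, h1, h2, -⟩ := hM.exists_pair a b
    exact ⟨hM.restrict T h, hM.restrict T h.symm, hM.isPerp_restrict T h,
      (hM.algLE_coe_iff T).2 h1, (hM.algLE_coe_iff T).2 h2⟩
  booleanValued a b := by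
    obtain ⟨p, q, h, h1, -, h3⟩ := hM.exists_pair a b
    exact ⟨hM.restrict T h, hM.restrict_greatest T h h1 h3⟩
  decomp a := by
    obtain ⟨x, y, h1, h2, h3⟩ := hM.decomp a
    have hx := hM.mem_of_le T (h3 ▸ hM.le_add_right x y) a.2
    have hy := hM.mem_of_le T (h3 ▸ hM.le_add_left y x) a.2
    exact ⟨⟨x, hx⟩, ⟨y, hy⟩, fun w hw => Subtype.ext (h1 w ((mem_padd_coe_iff T).1 hw).symm),
      (mem_padd_coe_iff T).2 h2.symm, (mem_padd_coe_iff T).2 h3⟩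
  exists_least a b ha hb hab := by
    have hbm := (hM.mem_removableClass_coe_iff T).2 ⟨hb, hab, rfl⟩
    obtain ⟨m, hm, hmin⟩ := hM.exists_least a b ((mem_padd_coe_iff T).1 ha).symm hbm
    have hmT := hM.mem_of_le T (hmin hbm) b.2
    exact ⟨⟨m, hmT⟩, (hM.mem_removableClass_coe_iff T).1 hm, fun x hx =>
      (hM.algLE_coe_iff T).2 (hmin ((hM.mem_removableClass_coe_iff T).2 hx))⟩

end LowerSubmonoid

end IsTotalScale

/-! ### The function monoids -/

theorem isTotalScale_functionScale {Ω : Type v} [TopologicalSpace Ω]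
    (hΩ : IsCompleteBooleanSpace Ω) {ΩI ΩII ΩIII : Set Ω}
    (h : IsClopenDecomposition ΩI ΩII ΩIII) (γ : Ordinal.{w}) :
    IsTotalScale (FunctionScale ΩI ΩII ΩIII γ) := by
  have := hΩ.2.2
  have := h.clopenI.2.extremallyDisconnected
  have := h.clopenII.2.extremallyDisconnected
  have := h.clopenIII.2.extremallyDisconnected
  -- Truncated subtraction provides continuous differences for integer and real values; in type III
  -- the only finite value is zero.
  refine (isTotalScale_continuousMap (fun s hs => ⟨sSup s, isLUB_csSup' hs⟩)
    ⟨fun z => z.2 - z.1, continuous_of_discreteTopology, fun x y hxy => ?_⟩).prod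
    ((isTotalScale_continuousMap (fun s hs => ⟨sSup s, isLUB_csSup' hs⟩)
      ⟨fun z => z.2 - z.1, continuous_snd.sub continuous_fst, fun x y hxy => ?_⟩).prod
    (isTotalScale_continuousMap (fun _ _ => ⟨0, fun _ _ => le_rfl, fun _ _ => le_rfl⟩)
      ⟨fun _ => 0, continuous_const, fun _ _ _ => rfl⟩))
  · exact add_tsub_cancel_of_le hxy
  · exact add_tsub_cancel_of_le hxy

end PartialCommMonoid

theorem theoremC :
    (∀ (S : Type u) [PartialCommMonoid S], IsContinuousDimensionScale S →
      IsCompleteBooleanAlgebra (Projection S) ∧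
      IsCompleteBooleanSpace (UltrafilterSpace (Projection S)) ∧
      ∃ pI pII pIII : Projection S,
        Set.range pI = typeI S ∧ Set.range pII = typeII S ∧ Set.range pIII = typeIII S ∧
        IsClopenDecomposition (basicSet pI) (basicSet pII) (basicSet pIII) ∧
        ∃ (γ : Ordinal.{u})
          (ε : S → FunctionScale (basicSet pI) (basicSet pII) (basicSet pIII) γ),
          IsLowerEmbedding ε ∧
          (∀ a b c : S, ε a + ε b = ε c → c ∈ a +ₚ b) ∧
          ∀ (x : S) (p : Projection S),
            FunctionScale.IsCutoff (basicSet p) (ε x) (ε (p x))) ∧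
    (∀ (Ω : Type v) [TopologicalSpace Ω], IsCompleteBooleanSpace Ω →
      ∀ ΩI ΩII ΩIII : Set Ω, IsClopenDecomposition ΩI ΩII ΩIII →
        ∀ (γ : Ordinal.{w}) (T : LowerSubmonoid (FunctionScale ΩI ΩII ΩIII γ)),
          IsContinuousDimensionScale T.carrier) :=
  ⟨fun S _ hS => exists_lowerEmbedding S hS,
    fun _ _ hΩ _ _ _ h γ T => (isTotalScale_functionScale hΩ h γ).isContinuousDimensionScale T⟩
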